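/- Let $d\ge 1$, $0<\beta\le 2$, $L,\sigma>0$, $c_0\ge 2/\beta$, and put $c_1=\max\{5c_0,12\}$. **Target.** Let $p^\star$ be a probability density on $\mathbb{R}^d$ such that (i) ($\sigma$-subgaussian) if $X\sim p^\star$, then $\mathbb{E}\big[\exp\big((X^\top\theta/\sigma)^2\big)\big]\le 2$ for every $\theta\in\mathbb{R}^d$ with $\|\theta\|_2=1$; (ii) ($\beta$-Hölder) if $m$ denotes the largest integer strictly smaller than $\beta$, then $p^\star$ is $m$ times differentiable and $|\partial^s p^\star(x)-\partial^s p^\star(x')|\le L\|x-x'\|_2^{\beta-m}$ for all $x,x'\in\mathbb{R}^d$ and all multi-indices $s$ with $|s|\le m$. **Learning rates.** For an integer $K\ge 2$ let $\overline\alpha_0=1$, $\overline\alpha_1=1-K^{-c_0}$, $\overline\alpha_k=\overline\alpha_{k-1}-\frac{c_1\log K}{K}\,\overline\alpha_{k-1}(1-\overline\alpha_{k-1})$ for $2\le k\le K$, and $\alpha_k=\overline\alpha_k/\overline\alpha_{k-1}$ for $1\le k\le K$. **Score estimator.** Let $n\ge 2$ and let $X^{(1)},\dots,X^{(n)}$ be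 i.i.d. with density $p^\star$. For $t>0$ let $\varphi_t(x)=(2\pi t)^{-d/2}e^{-\|x\|_2^2/(2t)}$, $\widehat p_t(x)=\frac1n\sum_{i=1}^n\varphi_t(X^{(i)}-x)$, $\eta_t=\frac{\log n}{n(2\pi t)^{d/2}}$ and $$\widehat s_t(x)=\frac{\nabla\widehat p_t(x)}{\widehat p_t(x)}\,\psi\big(\widehat p_t(x);\eta_t\big),$$ where $\psi(x;\eta)=1$ for $x\ge\eta$, $\psi(x;\eta)=0$ for $x\le\eta/2$, and $\psi(x;\eta)=\Big[1+\exp\Big(\frac{1-2(2x/\eta-1)}{(2x/\eta-1)(2-2x/\eta)}\Big)\Big]^{-1}$ for $\eta/2<x<\eta$. With $\tau=n^{-2/(d+2\beta)}$ and $t_k=\frac{1-\overline\alpha_k}{\overline\alpha_k}+\tau$, let $\widehat s_{X_k}(x)=\frac{1}{\sqrt{\overline\alpha_k}}\,\widehat s_{t_k}\big(x/\sqrt{\overline\alpha_k}\big)$. **Sampler.** Draw $Y_K\sim\mathcal{N}(0,I_d)$ independently of the data, set $Y_{k-1}=\frac{1}{\sqrt{\alpha_k}}\big(Y_k+\frac{1-\alpha_k}{2}\,\widehat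 s_{X_k}(Y_k)\big)$ for $k=K,K-1,\dots,2$, and output $Y=Y_1/\sqrt{\alpha_1}$. Let $p_Y$ be the conditional distribution of $Y$ given the data. **Theorem.** There is a constant $C>0$, depending only on $d,\beta,L,\sigma$ and the fixed schedule constant $c_0$ (and not on $p^\star$, $n$, $K$), such that whenever $K\ge n^{\frac{\beta}{d+2\beta}}(\log K)^3$, $$\mathbb{E}\big[\mathsf{TV}(p_Y,p^\star)\big]\le C\,n^{-\frac{\beta}{d+2\beta}}(\log n)^{\frac{d+1}{2}}\log K,$$ where $\mathsf{TV}$ is the total variation distance ($\mathsf{TV}(p,q)=\frac12\int|p-q|$) and the expectation is over the training data $X^{(1)},\dots,X^{(n)}$. -/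

import Mathlib

open MeasureTheory ProbabilityTheory

noncomputable section

namespace ProbabilityFlow

/-- `ℝ^d` with the Euclidean norm. -/
abbrev Rd (d : ℕ) : Type := EuclideanSpace ℝ (Fin d)

/-! ### Assumptions on the target -/

/-- The probability distribution on `ℝ^d` with Lebesgue density `p`. -/
def lawOfDensity {d : ℕ} (p : Rd d → ℝ) : Measure (Rd d) :=
  volume.withDensity fun x => ENNReal.ofReal (p x)

/-- `p` is a probability density on `ℝ^d`. -/
def IsDensity {d : ℕ} (p : Rd d → ℝ) : Prop :=
  Measurable p ∧ (∀ x, 0 ≤ p x) ∧ IsProbabilityMeasure (lawOfDensity p)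

/-- `E[exp((⟨X, θ⟩ / σ)²)] ≤ 2` for every unit vector `θ`, where `X ∼ P`. -/
def IsSubgaussian {d : ℕ} (σ : ℝ) (P : Measure (Rd d)) : Prop :=
  ∀ θ : Rd d, ‖θ‖ = 1 →
    ∫⁻ x, ENNReal.ofReal (Real.exp ((inner ℝ x θ / σ) ^ 2)) ∂P ≤ 2

/-- The largest integer strictly smaller than `β`, for `β > 0`. -/
def strictFloor (β : ℝ) : ℕ := ⌈β⌉₊ - 1

/-- The partial derivative `∂_{i 0} ⋯ ∂_{i (k-1)} p` at `x`. As `i` varies, these are all the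
partial derivatives of order `k`. -/
def partialDeriv {d k : ℕ} (i : Fin k → Fin d) (p : Rd d → ℝ) (x : Rd d) : ℝ :=
  iteratedFDeriv ℝ k p x fun j => EuclideanSpace.single (i j) (1 : ℝ)

/-- With `m` the largest integer strictly smaller than `β`: the function `p` is `m` times
differentiable, and all its partial derivatives of order at most `m` are
`(β - m)`-Hölder continuous with constant `L`. -/
def IsHolderSmooth {d : ℕ} (β L : ℝ) (p : Rd d → ℝ) : Prop :=
  (∀ j : ℕ, j < strictFloor β → Differentiable ℝ (iteratedFDeriv ℝ j p)) ∧
  ∀ k : ℕ, k ≤ strictFloor β → ∀ i : Fin k → Fin d, ∀ x x' : Rd d,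
    |partialDeriv i p x - partialDeriv i p x'| ≤ L * ‖x - x'‖ ^ (β - (strictFloor β : ℝ))

/-! ### Total variation -/

/-- The total variation distance `½ ∫ |dμ/dλ - dν/dλ| dλ`, with dominating measure `λ = μ + ν`.
It does not depend on the choice of the dominating measure; for two measures with Lebesgue
densities `f` and `g` it equals `½ ∫ |f(x) - g(x)| dx`. -/
def tvDist {d : ℕ} (μ ν : Measure (Rd d)) : ℝ :=
  (1 / 2) * ∫ x, |(μ.rnDeriv (μ + ν) x).toReal - (ν.rnDeriv (μ + ν) x).toReal| ∂(μ + ν)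

/-! ### Learning rates -/

/-- The cumulative noise parameters `ᾱ_0 = 1`, `ᾱ_1 = 1 - K^{-c₀}`,
`ᾱ_k = ᾱ_{k-1} - (c₁ log K / K) ᾱ_{k-1} (1 - ᾱ_{k-1})` for `k ≥ 2`. -/
def alphaBar (K : ℕ) (c₀ c₁ : ℝ) : ℕ → ℝ
  | 0 => 1
  | 1 => 1 - 1 / (K : ℝ) ^ c₀
  | k + 2 => alphaBar K c₀ c₁ (k + 1) -
      c₁ * Real.log K / K * alphaBar K c₀ c₁ (k + 1) * (1 - alphaBar K c₀ c₁ (k + 1))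

/-- The learning rates `α_k` for `k ≥ 1`, determined by `ᾱ_k = α_1 ⋯ α_k`. -/
def alpha (K : ℕ) (c₀ c₁ : ℝ) (k : ℕ) : ℝ :=
  alphaBar K c₀ c₁ k / alphaBar K c₀ c₁ (k - 1)

/-- `t_k = (1 - ᾱ_k) / ᾱ_k + τ`. -/
def noiseTime (K : ℕ) (c₀ c₁ τ : ℝ) (k : ℕ) : ℝ :=
  (1 - alphaBar K c₀ c₁ k) / alphaBar K c₀ c₁ k + τ

/-! ### The score estimator -/

/-- The density of `N(0, t I_d)`. -/
def gaussianKernel {d : ℕ} (t : ℝ) (x : Rd d) : ℝ :=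
  1 / (2 * Real.pi * t) ^ ((d : ℝ) / 2) * Real.exp (-‖x‖ ^ 2 / (2 * t))

/-- The Gaussian kernel density estimator built from the data `X 0, …, X (n-1)`. -/
def pHat {d n : ℕ} (X : Fin n → Rd d) (t : ℝ) (x : Rd d) : ℝ :=
  1 / (n : ℝ) * ∑ i, gaussianKernel t (X i - x)

/-- The threshold `η_t = log n / (n (2πt)^{d/2})`. -/
def threshold (d n : ℕ) (t : ℝ) : ℝ :=
  Real.log n / (n * (2 * Real.pi * t) ^ ((d : ℝ) / 2))

/-- The soft-thresholding function `ψ(x; η)`. -/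
def softThreshold (x η : ℝ) : ℝ :=
  if η ≤ x then 1
  else if x ≤ η / 2 then 0
  else (1 + Real.exp ((1 - 2 * (2 * x / η - 1)) / ((2 * x / η - 1) * (2 - 2 * x / η))))⁻¹

/-- The regularized score estimator `ŝ_t = (∇p̂_t / p̂_t) ψ(p̂_t; η_t)`. -/
def scoreZ {d n : ℕ} (X : Fin n → Rd d) (t : ℝ) (x : Rd d) : Rd d :=
  (softThreshold (pHat X t x) (threshold d n t) / pHat X t x) • gradient (pHat X t) x

/-- The score estimator of the `k`-th step, `ŝ_{X_k}(x) = ŝ_{t_k}(x / √ᾱ_k) / √ᾱ_k`. -/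
def scoreX {d n : ℕ} (X : Fin n → Rd d) (K : ℕ) (c₀ c₁ τ : ℝ) (k : ℕ) (x : Rd d) : Rd d :=
  (1 / √(alphaBar K c₀ c₁ k)) •
    scoreZ X (noiseTime K c₀ c₁ τ k) ((1 / √(alphaBar K c₀ c₁ k)) • x)

/-! ### The sampler -/

/-- One step `Y_k ↦ Y_{k-1} = (Y_k + ((1 - α_k) / 2) ŝ_{X_k}(Y_k)) / √α_k`. -/
def reverseStep {d n : ℕ} (X : Fin n → Rd d) (K : ℕ) (c₀ c₁ τ : ℝ) (k : ℕ) (y : Rd d) : Rd d :=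
  (1 / √(alpha K c₀ c₁ k)) •
    (y + ((1 - alpha K c₀ c₁ k) / 2) • scoreX X K c₀ c₁ τ k y)

/-- The value of `Y_1` when the iteration is started from `Y_k = y`: the steps
`k, k - 1, …, 2` are applied in this order. -/
def runToOne {d n : ℕ} (X : Fin n → Rd d) (K : ℕ) (c₀ c₁ τ : ℝ) : ℕ → Rd d → Rd d
  | 0, y => y
  | 1, y => y
  | k + 2, y => runToOne X K c₀ c₁ τ (k + 1) (reverseStep X K c₀ c₁ τ (k + 2) y)

/-- The output `Y = Y_1 / √α_1` as a function of the data and of the initial value `Y_K = y`. -/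
def samplerOutput {d n : ℕ} (X : Fin n → Rd d) (K : ℕ) (c₀ c₁ τ : ℝ) (y : Rd d) : Rd d :=
  (1 / √(alpha K c₀ c₁ 1)) • runToOne X K c₀ c₁ τ K y

/-- The distribution `p_Y` of the output given the data, for `Y_K ∼ N(0, I_d)`. -/
def outputLaw {d n : ℕ} (X : Fin n → Rd d) (K : ℕ) (c₀ c₁ τ : ℝ) : Measure (Rd d) :=
  (stdGaussian (Rd d)).map (samplerOutput X K c₀ c₁ τ)

end ProbabilityFlow

end

/-! Away from the threshold the score estimator is the exact score `∇ log p̂_t` of the kernel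
density estimator, and `t ↦ p̂_t` is the heat flow started from the empirical measure. The sampler
is therefore an Euler scheme for the probability flow of `p̂_t` itself. Its output can be compared
directly with `p̂_{t_1}`, and no bound on the distance between the estimated and the true score is
needed. In the coordinates `z = y / √ᾱ_k` a step is `F(x) = x + (h/2) ŝ_t(x)` with `t = t_k`, `h =
t_k - t_{k-1}` (`reverseStep_smul`).

All comparisons of measures are one-sided, `μ A ≤ ν A + δ` for every measurable `A`. Such bounds
survive pushforward, they add up along the run (`map_rescaledRun_le`), and they control total
variation (`ofReal_tvDist_le`). Write `ρ = n^{-β/(d+2β)}`. There are four errors.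

Initialization: the rescaled start is `N(0, T I)` with `T = 1/ᾱ_K ≥ K²`, which `p̂_{t_K}` dominates
up to `O(1/K)` times an empirical second moment (`lawOfDensity_gaussianKernel_le`).

Discretization: by change of variables it suffices to bound `p̂_t` by `(p̂_{t-h} ∘ F) det F'` plus
an error (`pHat_le_of_eulerMap`). By the heat equation the terms of first order in `h/t` cancel
where the threshold is inactive, leaving `(h/t)² log² n`. Since `h/t = O(log K / K)`, the `K` steps
contribute `O(log² K log² n / K)`.

Thresholding: where `p̂_t < η_t` the cancellation fails and each step costs `h/t` times the integral
of `thresholdedDensity`, whose expectation is `O(ρ)` uniformly in `t ≥ τ`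
(`exists_lintegral_thresholdedDensity_le`). Over all steps this is `O(ρ log K)`.

Estimation: `t_1` lies in `[τ, 3τ]`, the optimal order of bandwidth, so the expected integral of
`(p̂_{t_1} - p)₊` is `O(ρ (log n)^{d/2})` (`exists_lintegral_pHat_sub_le`).

The lower bound on `K` turns the sum into the stated rate (`accumulated_error_le`). For `K` below a
constant it also bounds `n`, and total variation at most one suffices. -/

namespace ProbabilityFlow

/-! ### Total variation: one-sided criterion and measurability in a parameter -/

section TotalVariation

variable {d : ℕ}

/-- The total variation distance of two probability measures is at most any `δ` with
`μ A ≤ ν A + δ` for all measurable `A`. -/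
theorem ofReal_tvDist_le {μ ν : Measure (Rd d)} [IsProbabilityMeasure μ] [IsProbabilityMeasure ν]
    {δ : ENNReal} (h : ∀ A, MeasurableSet A → μ A ≤ ν A + δ) :
    ENNReal.ofReal (tvDist μ ν) ≤ δ := by
  by_cases hδ : δ = ⊤
  · simp [hδ]
  have hμκ : μ ≪ μ + ν := Measure.AbsolutelyContinuous.rfl.add_right _
  have hνκ : ν ≪ μ + ν := by
    rw [add_comm]; exact Measure.AbsolutelyContinuous.rfl.add_right _
  set κ := μ + ν with hκ
  set f := fun x => (μ.rnDeriv κ x).toReal with hf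
  set g := fun x => (ν.rnDeriv κ x).toReal with hg
  have hfm : Measurable f := (Measure.measurable_rnDeriv μ κ).ennreal_toReal
  have hgm : Measurable g := (Measure.measurable_rnDeriv ν κ).ennreal_toReal
  have hfi : Integrable f κ := Measure.integrable_toReal_rnDeriv
  have hgi : Integrable g κ := Measure.integrable_toReal_rnDeriv
  have hfs : ∀ s, ∫ x in s, f x ∂κ = μ.real s := fun s => by
    rw [Measure.setIntegral_toReal_rnDeriv hμκ]
  have hgs : ∀ s, ∫ x in s, g x ∂κ = ν.real s := fun s => by
    rw [Measure.setIntegral_toReal_rnDeriv hνκ]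
  -- Scheffé's set: the two halves of `∫ |f - g|` agree because both measures have mass one, so the
  -- distance is exactly `μ A - ν A`.
  set A := {x | g x ≤ f x} with hA
  have hAm : MeasurableSet A := measurableSet_le hgm hfm
  have h1 : ∫ x, |f x - g x| ∂κ = (μ.real A - ν.real A) + (ν.real Aᶜ - μ.real Aᶜ) := by
    have hi : Integrable (fun x => |f x - g x|) κ := (hfi.sub hgi).abs
    rw [← integral_add_compl hAm hi]
    congr 1
    · rw [← hfs, ← hgs, ← integral_sub hfi.integrableOn hgi.integrableOn]
      refine setIntegral_congr_fun hAm fun x hx => ?_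
      exact abs_of_nonneg (sub_nonneg.2 hx)
    · rw [← hfs, ← hgs, ← integral_sub hgi.integrableOn hfi.integrableOn]
      refine setIntegral_congr_fun hAm.compl fun x hx => ?_
      have hx' : f x < g x := not_le.1 hx
      rw [abs_of_nonpos (by linarith)]
      ring
  have h2 : tvDist μ ν = μ.real A - ν.real A := by
    have : tvDist μ ν = 1 / 2 * ∫ x, |f x - g x| ∂κ := rfl
    rw [this, h1, probReal_compl_eq_one_sub hAm, probReal_compl_eq_one_sub hAm]
    ring
  rw [h2]
  refine ENNReal.ofReal_le_of_le_toReal ?_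
  have h3 := ENNReal.toReal_mono (by finiteness) (h A hAm)
  rw [ENNReal.toReal_add (by finiteness) hδ] at h3
  simp only [Measure.real]
  linarith

theorem tvDist_nonneg (μ ν : Measure (Rd d)) : 0 ≤ tvDist μ ν :=
  mul_nonneg (by norm_num) (integral_nonneg fun _ => abs_nonneg _)

theorem tvDist_le_one (μ ν : Measure (Rd d)) [IsProbabilityMeasure μ] [IsProbabilityMeasure ν] :
    tvDist μ ν ≤ 1 := by
  have h := ofReal_tvDist_le (μ := μ) (ν := ν) (δ := 1) fun A _ =>
    prob_le_one.trans le_add_self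
  rwa [← ENNReal.ofReal_one, ENNReal.ofReal_le_ofReal_iff zero_le_one] at h

/-- The total variation distance between a Markov kernel and a fixed probability measure is a
measurable function of the parameter. -/
theorem stronglyMeasurable_tvDist {α : Type*} [MeasurableSpace α]
    (κ : Kernel α (Rd d)) [IsMarkovKernel κ] (ν : Measure (Rd d)) [IsProbabilityMeasure ν] :
    StronglyMeasurable fun a => tvDist (κ a) ν := by
  -- Derivatives chosen separately for each parameter are only a.e. defined and need not be jointly
  -- measurable. The kernel version of the Radon–Nikodym derivative is jointly measurable and gives
  -- the same integral.
  set η : Kernel α (Rd d) := Kernel.const α ν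
  set ξ : Kernel α (Rd d) := κ + η
  have h : ∀ a, tvDist (κ a) ν =
      (1 / 2) * ∫ x, |(Kernel.rnDeriv κ ξ a x).toReal - (Kernel.rnDeriv η ξ a x).toReal| ∂(ξ a) := by
    intro a
    have e : ξ a = κ a + ν := by simp [ξ, η]
    unfold tvDist
    congr 1
    rw [← e]
    refine integral_congr_ae ?_
    have h1 := Kernel.rnDeriv_eq_rnDeriv_measure (κ := κ) (η := ξ) (a := a)
    have h2 := Kernel.rnDeriv_eq_rnDeriv_measure (κ := η) (η := ξ) (a := a)
    filter_upwards [h1, h2] with x h1 h2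
    rw [h1, h2]
    simp [η]
  simp_rw [h]
  refine StronglyMeasurable.const_mul ?_ _
  refine StronglyMeasurable.integral_kernel_prod_right (κ := ξ)
    (f := fun a x => |(Kernel.rnDeriv κ ξ a x).toReal - (Kernel.rnDeriv η ξ a x).toReal|) ?_
  refine Measurable.stronglyMeasurable ?_
  exact ((Kernel.measurable_rnDeriv κ ξ).ennreal_toReal.sub
    (Kernel.measurable_rnDeriv η ξ).ennreal_toReal).abs

end TotalVariation


/-! ### The Gaussian kernel as a probability density -/

section GaussianKernel

variable {d : ℕ} {t : ℝ}

theorem gaussianKernel_pos (ht : 0 < t) (x : Rd d) : 0 < gaussianKernel t x := by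
  unfold gaussianKernel; positivity

theorem gaussianKernel_le (ht : 0 < t) (x : Rd d) :
    gaussianKernel t x ≤ 1 / (2 * Real.pi * t) ^ ((d : ℝ) / 2) := by
  unfold gaussianKernel
  refine mul_le_of_le_one_right (by positivity) (Real.exp_le_one_iff.2 ?_)
  rw [neg_div]
  exact neg_nonpos.2 (by positivity)

theorem gaussianKernel_neg (t : ℝ) (x : Rd d) : gaussianKernel t (-x) = gaussianKernel t x := by
  simp [gaussianKernel]

@[fun_prop]
theorem continuous_gaussianKernel (t : ℝ) : Continuous (gaussianKernel (d := d) t) := by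
  unfold gaussianKernel; fun_prop

@[fun_prop]
theorem measurable_gaussianKernel (t : ℝ) : Measurable (gaussianKernel (d := d) t) :=
  (continuous_gaussianKernel t).measurable

theorem integral_gaussianKernel (ht : 0 < t) : ∫ x : Rd d, gaussianKernel t x = 1 := by
  have h := GaussianFourier.integral_rexp_neg_mul_sq_norm (V := Rd d) (b := 1 / (2 * t))
    (by positivity)
  have e : ∀ x : Rd d, gaussianKernel t x =
      1 / (2 * Real.pi * t) ^ ((d : ℝ) / 2) * Real.exp (-(1 / (2 * t)) * ‖x‖ ^ 2) := by
    intro x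
    unfold gaussianKernel
    congr 2
    ring
  simp_rw [e]
  rw [integral_const_mul, h]
  simp only [finrank_euclideanSpace, Fintype.card_fin]
  rw [show Real.pi / (1 / (2 * t)) = 2 * Real.pi * t by field_simp]
  field_simp

theorem integrable_gaussianKernel (ht : 0 < t) : Integrable (gaussianKernel (d := d) t) := by
  by_contra h
  have := integral_gaussianKernel (d := d) ht
  rw [integral_undef h] at this
  exact zero_ne_one this

theorem lintegral_gaussianKernel (ht : 0 < t) :
    ∫⁻ x : Rd d, ENNReal.ofReal (gaussianKernel t x) = 1 := by
  rw [← ofReal_integral_eq_lintegral_ofReal (integrable_gaussianKernel ht)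
    (Filter.Eventually.of_forall fun x => (gaussianKernel_pos ht x).le), integral_gaussianKernel ht]
  simp

theorem lintegral_gaussianKernel_sub_left (ht : 0 < t) (a : Rd d) :
    ∫⁻ x : Rd d, ENNReal.ofReal (gaussianKernel t (a - x)) = 1 := by
  rw [lintegral_sub_left_eq_self (fun x => ENNReal.ofReal (gaussianKernel t x)) a,
    lintegral_gaussianKernel ht]

theorem isProbabilityMeasure_lawOfDensity_gaussianKernel (ht : 0 < t) :
    IsProbabilityMeasure (lawOfDensity (gaussianKernel (d := d) t)) := by
  constructor
  rw [lawOfDensity, withDensity_apply _ .univ, Measure.restrict_univ, lintegral_gaussianKernel ht]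

/-- The link to `stdGaussian`: the law of a scaled standard Gaussian is matched with an explicit
density through characteristic functions. -/
theorem charFun_lawOfDensity_gaussianKernel (ht : 0 < t) (w : Rd d) :
    charFun (lawOfDensity (gaussianKernel t)) w = Complex.exp (-t * ‖w‖ ^ 2 / 2) := by
  have hb : 0 < ((1 / (2 * t) : ℝ) : ℂ).re := by
    rw [Complex.ofReal_re]; positivity
  have h := GaussianFourier.integral_cexp_neg_mul_sq_norm_add (V := Rd d) hb Complex.I w
  rw [charFun_apply, lawOfDensity, integral_withDensity_eq_integral_toReal_smul
    (by fun_prop) (by simp)]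
  have e : ∀ x : Rd d, (ENNReal.ofReal (gaussianKernel t x)).toReal •
        Complex.exp (inner ℝ x w * Complex.I) =
      (1 / (2 * Real.pi * t) ^ ((d : ℝ) / 2) : ℝ) *
      Complex.exp (-((1 / (2 * t) : ℝ) : ℂ) * ‖x‖ ^ 2 + Complex.I * inner ℝ w x) := by
    intro x
    rw [ENNReal.toReal_ofReal (gaussianKernel_pos ht x).le, Complex.exp_add, Complex.real_smul,
      gaussianKernel, Complex.ofReal_mul, mul_assoc, real_inner_comm x w,
      mul_comm Complex.I, Complex.ofReal_exp]
    congr 3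
    push_cast
    ring
  simp_rw [e]
  rw [integral_const_mul, h, ← mul_assoc]
  have e2 : ((1 / (2 * Real.pi * t) ^ ((d : ℝ) / 2) : ℝ) : ℂ) *
      ((Real.pi : ℂ) / ((1 / (2 * t) : ℝ) : ℂ)) ^ ((Module.finrank ℝ (Rd d) : ℂ) / 2) = 1 := by
    have : ((Real.pi : ℂ) / ((1 / (2 * t) : ℝ) : ℂ)) = ((2 * Real.pi * t : ℝ) : ℂ) := by
      push_cast
      field_simp
    rw [this, finrank_euclideanSpace, Fintype.card_fin]
    rw [show ((d : ℂ) / 2) = (((d : ℝ) / 2 : ℝ) : ℂ) by push_cast; ring,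
      ← Complex.ofReal_cpow (by positivity), ← Complex.ofReal_mul]
    have : (2 * Real.pi * t) ^ ((d : ℝ) / 2) ≠ 0 := by positivity
    field_simp
    simp
  rw [e2, one_mul]
  congr 1
  push_cast
  rw [Complex.I_sq]
  have : (t : ℂ) ≠ 0 := by exact_mod_cast ht.ne'
  field_simp
  ring

/-- `c • Z ∼ N(0, c² I)` for `Z ∼ N(0, I)`. -/
theorem stdGaussian_map_smul {c : ℝ} (hc : 0 < c) :
    (stdGaussian (Rd d)).map (fun x => c • x) = lawOfDensity (gaussianKernel (c ^ 2)) := by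
  have := isProbabilityMeasure_lawOfDensity_gaussianKernel (d := d) (t := c ^ 2) (by positivity)
  have : IsProbabilityMeasure ((stdGaussian (Rd d)).map (fun x => c • x)) :=
    Measure.isProbabilityMeasure_map (by fun_prop)
  refine Measure.ext_of_charFun ?_
  ext w
  rw [charFun_map_smul, charFun_stdGaussian, charFun_lawOfDensity_gaussianKernel (by positivity),
    norm_smul]
  congr 1
  push_cast
  rw [mul_pow]
  simp [← Complex.ofReal_pow]

end GaussianKernel


/-! ### Derivatives and moments of the kernel density estimator -/

section KernelDensity

variable {d n : ℕ} {t : ℝ} {X : Fin n → Rd d}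

/-- The gradient of the kernel density estimator. -/
noncomputable def kdeGrad (X : Fin n → Rd d) (t : ℝ) (x : Rd d) : Rd d :=
  (1 / (n : ℝ)) • ∑ i, (gaussianKernel t (X i - x) / t) • (X i - x)

/-- The second moment of the kernel density estimator. -/
noncomputable def kdeSq (X : Fin n → Rd d) (t : ℝ) (x : Rd d) : ℝ :=
  1 / (n : ℝ) * ∑ i, gaussianKernel t (X i - x) * ‖X i - x‖ ^ 2

/-- The Hessian of the kernel density estimator. -/
noncomputable def kdeHess (X : Fin n → Rd d) (t : ℝ) (x : Rd d) : Rd d →L[ℝ] Rd d :=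
  (1 / (n : ℝ)) • ∑ i, (gaussianKernel t (X i - x) / t) •
    ((1 / t) • (innerSL ℝ (X i - x)).smulRight (X i - x) - ContinuousLinearMap.id ℝ (Rd d))

theorem hasFDerivAt_gaussianKernel_sub (t : ℝ) (a x : Rd d) :
    HasFDerivAt (fun x => gaussianKernel t (a - x))
      ((gaussianKernel t (a - x) / t) • innerSL ℝ (a - x)) x := by
  have h1 : HasFDerivAt (fun x : Rd d => a - x) (-ContinuousLinearMap.id ℝ (Rd d)) x :=
    (hasFDerivAt_id x).const_sub a
  have h2 := h1.norm_sq
  have h3 := ((h2.neg.mul_const (1 / (2 * t))).exp).const_mul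
    (1 / (2 * Real.pi * t) ^ ((d : ℝ) / 2))
  have e : (fun x => gaussianKernel t (a - x)) = fun x : Rd d =>
      1 / (2 * Real.pi * t) ^ ((d : ℝ) / 2) * Real.exp (-‖a - x‖ ^ 2 * (1 / (2 * t))) := by
    funext y
    simp only [gaussianKernel]
    congr 2
    ring
  rw [e]
  refine h3.congr_fderiv ?_
  ext v
  simp [gaussianKernel]
  rw [show -‖a - x‖ ^ 2 / (2 * t) = -(‖a - x‖ ^ 2 * (t⁻¹ * 2⁻¹)) by
    rw [div_eq_mul_inv, mul_inv]; ring]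
  ring

theorem hasFDerivAt_pHat (X : Fin n → Rd d) (t : ℝ) (x : Rd d) :
    HasFDerivAt (pHat X t) (innerSL ℝ (kdeGrad X t x)) x := by
  have h : HasFDerivAt (fun x => ∑ i, gaussianKernel t (X i - x))
      (∑ i, (gaussianKernel t (X i - x) / t) • innerSL ℝ (X i - x)) x :=
    HasFDerivAt.fun_sum fun i _ => hasFDerivAt_gaussianKernel_sub t (X i) x
  refine (h.const_mul (1 / (n : ℝ))).congr_fderiv ?_
  simp [kdeGrad]

theorem gradient_pHat (X : Fin n → Rd d) (t : ℝ) (x : Rd d) :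
    gradient (pHat X t) x = kdeGrad X t x := by
  refine HasGradientAt.gradient ?_
  rw [hasGradientAt_iff_hasFDerivAt]
  exact hasFDerivAt_pHat X t x

theorem hasFDerivAt_kdeGrad (X : Fin n → Rd d) (t : ℝ) (x : Rd d) :
    HasFDerivAt (kdeGrad X t) (kdeHess X t x) x := by
  have h : HasFDerivAt (fun x => ∑ i, (gaussianKernel t (X i - x) / t) • (X i - x))
      (∑ i, (gaussianKernel t (X i - x) / t) •
        ((1 / t) • (innerSL ℝ (X i - x)).smulRight (X i - x) -
          ContinuousLinearMap.id ℝ (Rd d))) x := by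
    refine HasFDerivAt.fun_sum fun i _ => ?_
    have h1 : HasFDerivAt (fun x : Rd d => X i - x) (-ContinuousLinearMap.id ℝ (Rd d)) x :=
      (hasFDerivAt_id x).const_sub (X i)
    have h2 := ((hasFDerivAt_gaussianKernel_sub t (X i) x).mul_const (1 / t))
    have h3 := h2.smul h1
    simp_rw [mul_one_div] at h3
    refine h3.congr_fderiv ?_
    ext v
    simp
    ring
  exact h.const_smul (1 / (n : ℝ))

theorem measurable_pHat_uncurry (t : ℝ) :
    Measurable fun z : (Fin n → Rd d) × Rd d => pHat z.1 t z.2 := by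
  unfold pHat
  fun_prop

theorem measurable_kdeSq_uncurry (t : ℝ) :
    Measurable fun z : (Fin n → Rd d) × Rd d => kdeSq z.1 t z.2 := by
  unfold kdeSq
  fun_prop

theorem measurable_kdeGrad_uncurry (t : ℝ) :
    Measurable fun z : (Fin n → Rd d) × Rd d => kdeGrad z.1 t z.2 := by
  unfold kdeGrad
  have h1 : ∀ i, Measurable fun z : (Fin n → Rd d) × Rd d => z.1 i - z.2 := fun i => by fun_prop
  have h2 : ∀ i, Measurable fun z : (Fin n → Rd d) × Rd d =>
      (gaussianKernel t (z.1 i - z.2) / t) • (z.1 i - z.2) := fun i =>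
    (((measurable_gaussianKernel t).comp (h1 i)).div_const t).smul (h1 i)
  have h3 : Measurable fun z : (Fin n → Rd d) × Rd d =>
      ∑ i, (gaussianKernel t (z.1 i - z.2) / t) • (z.1 i - z.2) :=
    Finset.measurable_fun_sum _ fun i _ => h2 i
  exact h3.const_smul (1 / (n : ℝ))

theorem measurable_pHat (X : Fin n → Rd d) (t : ℝ) : Measurable (pHat X t) := by
  unfold pHat
  fun_prop

theorem pHat_pos [NeZero n] (ht : 0 < t) (X : Fin n → Rd d) (x : Rd d) : 0 < pHat X t x := by
  have : 0 < n := Nat.pos_of_neZero n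
  unfold pHat
  refine mul_pos (by positivity) (Finset.sum_pos (fun i _ => gaussianKernel_pos ht _) ?_)
  exact Finset.univ_nonempty

theorem kdeSq_nonneg (ht : 0 < t) (X : Fin n → Rd d) (x : Rd d) : 0 ≤ kdeSq X t x := by
  unfold kdeSq
  have := fun i => (gaussianKernel_pos ht (X i - x)).le
  exact mul_nonneg (by positivity) (Finset.sum_nonneg fun i _ => mul_nonneg (this i) (by positivity))

theorem isProbabilityMeasure_lawOfDensity_pHat [NeZero n] (ht : 0 < t) (X : Fin n → Rd d) :
    IsProbabilityMeasure (lawOfDensity (pHat X t)) := by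
  have hn : (n : ℝ) ≠ 0 := Nat.cast_ne_zero.2 (NeZero.ne n)
  constructor
  rw [lawOfDensity, withDensity_apply _ .univ, Measure.restrict_univ]
  unfold pHat
  have : ∀ x, ENNReal.ofReal (1 / (n : ℝ) * ∑ i, gaussianKernel t (X i - x)) =
      ENNReal.ofReal (1 / n) * ∑ i, ENNReal.ofReal (gaussianKernel t (X i - x)) := fun x => by
    rw [ENNReal.ofReal_mul (by positivity),
      ENNReal.ofReal_sum_of_nonneg fun i _ => (gaussianKernel_pos ht _).le]
  simp_rw [this]
  rw [lintegral_const_mul _ (by fun_prop), lintegral_finsetSum _ (by fun_prop)]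
  simp_rw [lintegral_gaussianKernel_sub_left ht]
  rw [Finset.sum_const, Finset.card_univ, Fintype.card_fin, nsmul_one,
    ← ENNReal.ofReal_natCast, ← ENNReal.ofReal_mul (by positivity), one_div_mul_cancel hn]
  simp

/-- Cauchy–Schwarz with the kernel values as weights. -/
theorem sq_norm_kdeGrad_le (ht : 0 < t) (X : Fin n → Rd d) (x : Rd d) :
    t ^ 2 * ‖kdeGrad X t x‖ ^ 2 ≤ pHat X t x * kdeSq X t x := by
  set w := fun i => gaussianKernel t (X i - x) with hw
  have hw0 : ∀ i, 0 ≤ w i := fun i => (gaussianKernel_pos ht _).le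
  have h1 : t * ‖kdeGrad X t x‖ ≤ 1 / (n : ℝ) * ∑ i, w i * ‖X i - x‖ := by
    unfold kdeGrad
    rw [norm_smul, Real.norm_of_nonneg (by positivity), mul_left_comm]
    refine mul_le_mul_of_nonneg_left ?_ (by positivity)
    calc t * ‖∑ i, (gaussianKernel t (X i - x) / t) • (X i - x)‖
        ≤ t * ∑ i, w i / t * ‖X i - x‖ := by
          refine mul_le_mul_of_nonneg_left ((norm_sum_le _ _).trans (Finset.sum_le_sum fun i _ => ?_))
            ht.le
          rw [norm_smul, Real.norm_of_nonneg (div_nonneg (hw0 i) ht.le)]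
      _ = ∑ i, w i * ‖X i - x‖ := by
          rw [Finset.mul_sum]
          refine Finset.sum_congr rfl fun i _ => ?_
          field_simp
  have h2 : (∑ i, w i * ‖X i - x‖) ^ 2 ≤ (∑ i, w i) * ∑ i, w i * ‖X i - x‖ ^ 2 :=
    Finset.sum_sq_le_sum_mul_sum_of_sq_le_mul _ (fun i _ => hw0 i)
      (fun i _ => mul_nonneg (hw0 i) (by positivity)) (fun i _ => le_of_eq (by ring))
  calc t ^ 2 * ‖kdeGrad X t x‖ ^ 2 = (t * ‖kdeGrad X t x‖) ^ 2 := by ring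
    _ ≤ (1 / (n : ℝ) * ∑ i, w i * ‖X i - x‖) ^ 2 := by gcongr
    _ = (1 / (n : ℝ)) ^ 2 * (∑ i, w i * ‖X i - x‖) ^ 2 := by ring
    _ ≤ (1 / (n : ℝ)) ^ 2 * ((∑ i, w i) * ∑ i, w i * ‖X i - x‖ ^ 2) := by gcongr
    _ = pHat X t x * kdeSq X t x := by unfold pHat kdeSq; ring

/-- Split at `u = 2 log n`: below, `u` itself is bounded; above, half of the exponential absorbs `u`
and the other half is at most `1/n`. It is used with `u = ‖X i - x‖² / (2t)`. -/
theorem two_mul_mul_exp_neg_le (hn : 1 ≤ n) (u : ℝ) :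
    2 * u * Real.exp (-u) ≤ 4 * Real.log n * Real.exp (-u) + 4 / n := by
  have hn0 : (0 : ℝ) < n := by exact_mod_cast hn
  rcases le_total u (2 * Real.log n) with h | h
  · have : 2 * u * Real.exp (-u) ≤ 4 * Real.log n * Real.exp (-u) := by
      refine mul_le_mul_of_nonneg_right ?_ (Real.exp_pos _).le
      linarith
    have : (0 : ℝ) ≤ 4 / n := by positivity
    linarith
  · have h1 : u / 2 ≤ Real.exp (u / 2) := by linarith [Real.add_one_le_exp (u / 2)]
    have h2 : Real.exp (-u) = Real.exp (-(u / 2)) * Real.exp (-(u / 2)) := by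
      rw [← Real.exp_add]; ring_nf
    have h3 : u / 2 * Real.exp (-(u / 2)) ≤ 1 := by
      rw [Real.exp_neg, ← div_eq_mul_inv]
      exact (div_le_one (Real.exp_pos _)).2 h1
    have h4 : Real.exp (-(u / 2)) ≤ 1 / n := by
      rw [Real.exp_neg, ← one_div]
      refine one_div_le_one_div_of_le hn0 ?_
      rw [← Real.log_le_iff_le_exp hn0]
      linarith
    have h5 : 0 ≤ Real.log n := Real.log_natCast_nonneg n
    calc 2 * u * Real.exp (-u) = 4 * (u / 2 * Real.exp (-(u / 2))) * Real.exp (-(u / 2)) := by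
          rw [h2]; ring
      _ ≤ 4 * 1 * (1 / n) := by gcongr
      _ = 4 / n := by ring
      _ ≤ 4 * Real.log n * Real.exp (-u) + 4 / n := by
          have : 0 ≤ 4 * Real.log n * Real.exp (-u) := by positivity
          linarith

/-- The normalized second moment exceeds the density by at most a logarithm, up to an additive term
smaller than the threshold by the order of a logarithm. -/
theorem kdeSq_div_le (hn : 1 ≤ n) (ht : 0 < t) (X : Fin n → Rd d) (x : Rd d) :
    kdeSq X t x / t ≤ 4 * Real.log n * pHat X t x +
      4 / (n * (2 * Real.pi * t) ^ ((d : ℝ) / 2)) := by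
  have hn0 : (0 : ℝ) < n := by exact_mod_cast hn
  set Z := (2 * Real.pi * t) ^ ((d : ℝ) / 2) with hZ
  have hZ0 : 0 < Z := by positivity
  have key : ∀ i, gaussianKernel t (X i - x) * ‖X i - x‖ ^ 2 / t ≤
      4 * Real.log n * gaussianKernel t (X i - x) + 4 / (n * Z) := by
    intro i
    have := two_mul_mul_exp_neg_le hn (‖X i - x‖ ^ 2 / (2 * t))
    unfold gaussianKernel
    rw [← hZ, neg_div]
    calc 1 / Z * Real.exp (-(‖X i - x‖ ^ 2 / (2 * t))) * ‖X i - x‖ ^ 2 / t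
        = 1 / Z * (2 * (‖X i - x‖ ^ 2 / (2 * t)) * Real.exp (-(‖X i - x‖ ^ 2 / (2 * t)))) := by
          field_simp
      _ ≤ 1 / Z * (4 * Real.log n * Real.exp (-(‖X i - x‖ ^ 2 / (2 * t))) + 4 / n) := by gcongr
      _ = _ := by field_simp
  calc kdeSq X t x / t
      = 1 / (n : ℝ) * ∑ i, gaussianKernel t (X i - x) * ‖X i - x‖ ^ 2 / t := by
        unfold kdeSq; rw [← Finset.sum_div]; ring
    _ ≤ 1 / (n : ℝ) * ∑ i, (4 * Real.log n * gaussianKernel t (X i - x) + 4 / (n * Z)) := by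
        gcongr with i; exact key i
    _ = _ := by
        rw [Finset.sum_add_distrib, ← Finset.mul_sum]
        simp only [Finset.sum_const, Finset.card_univ, Fintype.card_fin, nsmul_eq_mul]
        unfold pHat
        field_simp

theorem norm_kdeHess_le (ht : 0 < t) (X : Fin n → Rd d) (x : Rd d) :
    ‖kdeHess X t x‖ ≤ kdeSq X t x / t ^ 2 + pHat X t x / t := by
  have e : kdeSq X t x / t ^ 2 + pHat X t x / t = 1 / (n : ℝ) *
      ∑ i, gaussianKernel t (X i - x) / t * (1 / t * ‖X i - x‖ ^ 2 + 1) := by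
    unfold kdeSq pHat
    rw [Finset.mul_sum, Finset.mul_sum, Finset.mul_sum, Finset.sum_div, Finset.sum_div,
      ← Finset.sum_add_distrib]
    refine Finset.sum_congr rfl fun i _ => ?_
    field_simp
  rw [e]
  unfold kdeHess
  rw [norm_smul, Real.norm_of_nonneg (by positivity)]
  gcongr
  refine (norm_sum_le _ _).trans (Finset.sum_le_sum fun i _ => ?_)
  have hp := (gaussianKernel_pos ht (X i - x)).le
  rw [norm_smul, Real.norm_of_nonneg (by positivity)]
  gcongr
  refine (norm_sub_le _ _).trans (add_le_add ?_ ContinuousLinearMap.norm_id_le)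
  rw [norm_smul, Real.norm_of_nonneg (by positivity), ContinuousLinearMap.norm_smulRight_apply,
    innerSL_apply_norm]
  exact le_of_eq (by ring)

theorem inner_kdeHess_comm (X : Fin n → Rd d) (t : ℝ) (x v w : Rd d) :
    inner ℝ (kdeHess X t x v) w = inner ℝ v (kdeHess X t x w) := by
  simp only [kdeHess, smul_apply, sum_apply, inner_smul_left,
    inner_smul_right, sum_inner, inner_sum, sub_apply, inner_sub_left,
    inner_sub_right, ContinuousLinearMap.smulRight_apply, innerSL_apply_apply,
    ContinuousLinearMap.id_apply]
  congr 1
  refine Finset.sum_congr rfl fun i _ => ?_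
  simp only [conj_trivial, real_inner_comm]
  ring

theorem trace_innerSL_smulRight (a : Rd d) : LinearMap.trace ℝ (Rd d)
    (((innerSL ℝ a).smulRight a : Rd d →L[ℝ] Rd d) : Rd d →ₗ[ℝ] Rd d) = ‖a‖ ^ 2 := by
  rw [LinearMap.trace_eq_sum_inner _ (EuclideanSpace.basisFun (Fin d) ℝ),
    EuclideanSpace.real_norm_sq_eq]
  refine Finset.sum_congr rfl fun i _ => ?_
  simp [EuclideanSpace.inner_single_left, inner_smul_right, EuclideanSpace.inner_single_right]
  ring

/-- The trace is the Laplacian, equal to `2 ∂_t p̂_t`. This is the form in which the heat equation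
enters the cancellation for an Euler step. -/
theorem trace_kdeHess (ht : t ≠ 0) (X : Fin n → Rd d) (x : Rd d) :
    LinearMap.trace ℝ (Rd d) (kdeHess X t x : Rd d →ₗ[ℝ] Rd d) =
      kdeSq X t x / t ^ 2 - d * pHat X t x / t := by
  have h1 : LinearMap.trace ℝ (Rd d) (ContinuousLinearMap.id ℝ (Rd d) : Rd d →ₗ[ℝ] Rd d) = d := by
    simp
  have h2 : ∀ a : Rd d, LinearMap.trace ℝ (Rd d)
      (((1 / t) • (innerSL ℝ a).smulRight a - ContinuousLinearMap.id ℝ (Rd d) :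
        Rd d →L[ℝ] Rd d) : Rd d →ₗ[ℝ] Rd d) = 1 / t * ‖a‖ ^ 2 - d := fun a => by
    rw [ContinuousLinearMap.toLinearMap_sub, ContinuousLinearMap.toLinearMap_smul, map_sub,
      map_smul, trace_innerSL_smulRight, h1, smul_eq_mul]
  unfold kdeHess kdeSq pHat
  simp only [ContinuousLinearMap.toLinearMap_smul, ContinuousLinearMap.toLinearMap_sum,
    map_smul, map_sum, h2, smul_eq_mul]
  rw [Finset.mul_sum, Finset.mul_sum, Finset.mul_sum, Finset.sum_div, Finset.mul_sum, Finset.sum_div,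
    ← Finset.sum_sub_distrib]
  refine Finset.sum_congr rfl fun i _ => ?_
  field_simp

end KernelDensity


/-! ### A lower bound for determinants near the identity -/

section Determinant

/-- The scalar inequality applied to each eigenvalue. The reciprocal exponential is bounded below by
its first-order expansion for `z ≥ 0`; for `z ≤ 0` the second order is needed. -/
theorem exp_sub_sq_le {z : ℝ} (h : |z| ≤ 1 / 2) : Real.exp (z - z ^ 2) ≤ 1 + z := by
  obtain ⟨h1, h2⟩ := abs_le.1 h
  have h3 : Real.exp (z - z ^ 2) = (Real.exp (z ^ 2 - z))⁻¹ := by rw [← Real.exp_neg]; ring_nf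
  rw [h3]
  refine inv_le_of_inv_le₀ (by linarith) ?_
  rw [inv_le_iff_one_le_mul₀ (by linarith)]
  rcases le_total 0 z with hz | hz
  · have h4 := Real.add_one_le_exp (z ^ 2 - z)
    calc 1 ≤ (1 + z) * (z ^ 2 - z + 1) := by nlinarith [pow_nonneg hz 3]
      _ ≤ _ := by rw [mul_comm]; gcongr
  · have h4 := Real.quadratic_le_exp_of_nonneg (x := z ^ 2 - z) (by nlinarith)
    have hs : 0 ≤ -z := by linarith
    have h5 : 1 ≤ (1 + z) * (1 + (z ^ 2 - z) + (z ^ 2 - z) ^ 2 / 2) := by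
      have e : (1 + z) * (1 + (z ^ 2 - z) + (z ^ 2 - z) ^ 2 / 2) =
          1 + z ^ 2 / 2 * (1 - (-z) - (-z) ^ 2 - (-z) ^ 3) := by
        ring
      have h6 : (-z) ^ 2 ≤ (1 / 2) ^ 2 := by gcongr; linarith
      have h7 : (-z) ^ 3 ≤ (1 / 2) ^ 3 := by gcongr; linarith
      rw [e]
      have : 0 ≤ z ^ 2 / 2 * (1 - (-z) - (-z) ^ 2 - (-z) ^ 3) :=
        mul_nonneg (by positivity) (by nlinarith)
      linarith
    calc 1 ≤ _ := h5
      _ ≤ _ := by rw [mul_comm]; gcongr; linarith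

/-- Second-order lower bound for the determinant of a symmetric perturbation of the identity. -/
theorem exp_trace_sub_le_det {d : ℕ} {M : Rd d →L[ℝ] Rd d}
    (hM : (M : Rd d →ₗ[ℝ] Rd d).IsSymmetric) (hn : ‖M‖ ≤ 1 / 2) :
    Real.exp (LinearMap.trace ℝ (Rd d) (M : Rd d →ₗ[ℝ] Rd d) - d * ‖M‖ ^ 2) ≤
      (ContinuousLinearMap.id ℝ (Rd d) + M).det := by
  set T : Rd d →ₗ[ℝ] Rd d := LinearMap.id + (M : Rd d →ₗ[ℝ] Rd d) with hTd
  have hT : T.IsSymmetric := LinearMap.IsSymmetric.id.add hM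
  have hf : Module.finrank ℝ (Rd d) = d := by simp
  have hdet : (ContinuousLinearMap.id ℝ (Rd d) + M).det = ∏ i, hT.eigenvalues hf i := by
    have : (ContinuousLinearMap.id ℝ (Rd d) + M).det = LinearMap.det T := rfl
    rw [this, hT.det_eq_prod_eigenvalues hf]
    rfl
  have hadd : LinearMap.trace ℝ (Rd d) T = d + LinearMap.trace ℝ (Rd d)
      (M : Rd d →ₗ[ℝ] Rd d) := by
    rw [hTd, map_add, LinearMap.trace_id, hf]
  have htr : LinearMap.trace ℝ (Rd d) (M : Rd d →ₗ[ℝ] Rd d) = ∑ i, (hT.eigenvalues hf i - 1) := by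
    have h1 := hT.trace_eq_sum_eigenvalues hf
    rw [hadd] at h1
    rw [Finset.sum_sub_distrib]
    simp only [Finset.sum_const, Finset.card_univ, Fintype.card_fin, nsmul_eq_mul, mul_one]
    have h2 : (((∑ i, hT.eigenvalues hf i : ℝ)) : ℝ) = d + LinearMap.trace ℝ (Rd d)
      (M : Rd d →ₗ[ℝ] Rd d) := h1.symm
    linarith
  have hev : ∀ i, |hT.eigenvalues hf i - 1| ≤ ‖M‖ := by
    intro i
    set b := hT.eigenvectorBasis hf i with hb
    have h1 : T b = (hT.eigenvalues hf i) • b := hT.apply_eigenvectorBasis hf i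
    have h2 : M b = (hT.eigenvalues hf i - 1) • b := by
      have : b + M b = (hT.eigenvalues hf i) • b := h1
      rw [sub_smul, one_smul, ← this]
      abel
    have h3 : ‖b‖ = 1 := (hT.eigenvectorBasis hf).orthonormal.1 i
    have h4 := M.le_opNorm b
    rwa [h2, norm_smul, h3, mul_one, mul_one] at h4
  rw [hdet, htr]
  calc Real.exp (∑ i, (hT.eigenvalues hf i - 1) - d * ‖M‖ ^ 2)
      = Real.exp (∑ i, ((hT.eigenvalues hf i - 1) - ‖M‖ ^ 2)) := by
        rw [Finset.sum_sub_distrib]; simp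
    _ = ∏ i, Real.exp ((hT.eigenvalues hf i - 1) - ‖M‖ ^ 2) := Real.exp_sum _ _
    _ ≤ ∏ i, hT.eigenvalues hf i := by
        refine Finset.prod_le_prod (fun i _ => (Real.exp_pos _).le) fun i _ => ?_
        have h1 := exp_sub_sq_le ((hev i).trans hn)
        have h2 : (hT.eigenvalues hf i - 1) ^ 2 ≤ ‖M‖ ^ 2 := by
          rw [← sq_abs]; exact pow_le_pow_left₀ (abs_nonneg _) (hev i) 2
        calc _ ≤ Real.exp (hT.eigenvalues hf i - 1 - (hT.eigenvalues hf i - 1) ^ 2) := by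
              gcongr
          _ ≤ _ := h1.trans (by linarith)

end Determinant

/-! ### The soft threshold as a smooth transition function -/

section SoftThreshold

/-- With `u = 2x/η - 1` the exponent is `1/u - 1/(1-u)`, so the threshold function is the standard
smooth step, with its smoothness and monotonicity. -/
theorem softThreshold_eq {η : ℝ} (hη : 0 < η) (x : ℝ) :
    softThreshold x η = Real.smoothTransition (2 * x / η - 1) := by
  unfold softThreshold
  split_ifs with h1 h2
  · rw [Real.smoothTransition.one_of_one_le]
    rw [le_sub_iff_add_le, le_div_iff₀ hη]
    linarith
  · rw [Real.smoothTransition.zero_of_nonpos]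
    rw [sub_nonpos, div_le_one hη]
    linarith
  · push Not at h1 h2
    set u := 2 * x / η - 1 with hu
    have hu0 : 0 < u := by
      rw [hu, sub_pos, one_lt_div hη]; linarith
    have hu1 : u < 1 := by
      rw [hu, sub_lt_iff_lt_add, div_lt_iff₀ hη]; linarith
    have e : 2 - 2 * x / η = 1 - u := by rw [hu]; ring
    rw [e]
    unfold Real.smoothTransition expNegInvGlue
    rw [if_neg (not_le.2 hu0), if_neg (not_le.2 (by linarith))]
    have h3 : (1 - 2 * u) / (u * (1 - u)) = -(1 - u)⁻¹ - (-u⁻¹) := by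
      have : (1 - u) ≠ 0 := by linarith
      field_simp
      ring
    rw [h3, Real.exp_sub]
    have := Real.exp_pos (-u⁻¹)
    have := Real.exp_pos (-(1 - u)⁻¹)
    field_simp

/-- Such a point is a global minimum, which also settles the boundary point `y = 0`. -/
theorem deriv_smoothTransition_of_nonpos {y : ℝ} (hy : y ≤ 0) :
    deriv Real.smoothTransition y = 0 := by
  refine IsLocalMin.deriv_eq_zero (Filter.Eventually.of_forall fun z => ?_)
  rw [Real.smoothTransition.zero_of_nonpos hy]
  exact Real.smoothTransition.nonneg z

theorem deriv_smoothTransition_of_one_le {y : ℝ} (hy : 1 ≤ y) :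
    deriv Real.smoothTransition y = 0 := by
  refine IsLocalMax.deriv_eq_zero (Filter.Eventually.of_forall fun z => ?_)
  rw [Real.smoothTransition.one_of_one_le hy]
  exact Real.smoothTransition.le_one z

theorem exists_deriv_smoothTransition_le :
    ∃ D : ℝ, 0 ≤ D ∧ ∀ y, |deriv Real.smoothTransition y| ≤ D := by
  have hc : Continuous (deriv Real.smoothTransition) :=
    (Real.smoothTransition.contDiff (n := 1)).continuous_deriv le_rfl
  obtain ⟨D, hD⟩ := (isCompact_Icc (a := (0 : ℝ)) (b := 1)).exists_bound_of_continuousOn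
    hc.continuousOn
  refine ⟨D, (norm_nonneg _).trans (hD 0 (by simp)), fun y => ?_⟩
  have hD0 : 0 ≤ D := (norm_nonneg _).trans (hD 0 (by simp))
  by_cases h0 : y ≤ 0
  · rwa [deriv_smoothTransition_of_nonpos h0, abs_zero]
  by_cases h1 : 1 ≤ y
  · rwa [deriv_smoothTransition_of_one_le h1, abs_zero]
  · exact hD y ⟨(not_le.1 h0).le, (not_le.1 h1).le⟩

end SoftThreshold


/-! ### The Jacobian of the score estimator -/

section ScoreEstimator

variable {d n : ℕ} {t : ℝ} {X : Fin n → Rd d}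

theorem log_natCast_pos (hn : 2 ≤ n) : 0 < Real.log n :=
  Real.log_pos (by exact_mod_cast hn)

/-- Since `log 2 < 1`, powers of `log n` are not monotone in the exponent near `n = 2`. This
numerical bound lets constants be absorbed into multiples of `log n`. -/
theorem half_le_log_natCast (hn : 2 ≤ n) : 0.69 ≤ Real.log n := by
  have h1 : Real.log 2 ≤ Real.log n := Real.log_le_log (by norm_num) (by exact_mod_cast hn)
  have := Real.log_two_gt_d9
  linarith

theorem threshold_pos (hn : 2 ≤ n) (ht : 0 < t) : 0 < threshold d n t := by
  have h1 := log_natCast_pos hn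
  have h2 : (0 : ℝ) < n := by positivity
  unfold threshold
  positivity

/-- The weight `ψ(p̂_t; η_t)` of the score estimator. -/
noncomputable def scoreWeight (X : Fin n → Rd d) (t : ℝ) (x : Rd d) : ℝ :=
  Real.smoothTransition (2 * pHat X t x / threshold d n t - 1)

/-- The derivative of `ψ(·; η_t)` at `p̂_t`. -/
noncomputable def scoreWeightDeriv (X : Fin n → Rd d) (t : ℝ) (x : Rd d) : ℝ :=
  deriv Real.smoothTransition (2 * pHat X t x / threshold d n t - 1) * (2 / threshold d n t)

/-- The Jacobian of the score estimator. -/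
noncomputable def scoreJac (X : Fin n → Rd d) (t : ℝ) (x : Rd d) : Rd d →L[ℝ] Rd d :=
  (scoreWeight X t x / pHat X t x) • kdeHess X t x +
    (scoreWeightDeriv X t x / pHat X t x - scoreWeight X t x / pHat X t x ^ 2) •
      (innerSL ℝ (kdeGrad X t x)).smulRight (kdeGrad X t x)

theorem scoreZ_eq (hn : 2 ≤ n) (ht : 0 < t) (X : Fin n → Rd d) (x : Rd d) :
    scoreZ X t x = (scoreWeight X t x / pHat X t x) • kdeGrad X t x := by
  rw [scoreZ, gradient_pHat, softThreshold_eq (threshold_pos hn ht), scoreWeight]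

theorem hasFDerivAt_scoreZ (hn : 2 ≤ n) (ht : 0 < t) (X : Fin n → Rd d) (x : Rd d) :
    HasFDerivAt (scoreZ X t) (scoreJac X t x) x := by
  have : NeZero n := ⟨by omega⟩
  have hq := pHat_pos ht X x
  have hη := threshold_pos (d := d) hn ht
  have h1 : HasDerivAt Real.smoothTransition
      (deriv Real.smoothTransition (2 * pHat X t x / threshold d n t - 1))
      (2 * pHat X t x / threshold d n t - 1) :=
    ((Real.smoothTransition.contDiff (n := 1)).differentiable one_ne_zero).differentiableAt.hasDerivAt
  have h2 : HasDerivAt (fun y : ℝ => 2 * y / threshold d n t - 1) (2 / threshold d n t)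
      (pHat X t x) := by
    have := (((hasDerivAt_id (pHat X t x)).const_mul 2).div_const (threshold d n t)).sub_const 1
    simpa using this
  have h3 : HasDerivAt (fun y : ℝ => Real.smoothTransition (2 * y / threshold d n t - 1) / y)
      (scoreWeightDeriv X t x / pHat X t x - scoreWeight X t x / pHat X t x ^ 2) (pHat X t x) := by
    have h4 := (h1.comp (pHat X t x) h2).div (hasDerivAt_id (pHat X t x)) hq.ne'
    refine h4.congr_deriv ?_
    unfold scoreWeightDeriv scoreWeight
    simp only [Function.comp, id]
    field_simp
  have h5 := h3.comp_hasFDerivAt x (hasFDerivAt_pHat X t x)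
  have h6 := h5.smul (hasFDerivAt_kdeGrad X t x)
  have e : scoreZ X t = fun y => (Real.smoothTransition (2 * pHat X t y / threshold d n t - 1) /
      pHat X t y) • kdeGrad X t y := funext fun y => scoreZ_eq hn ht X y
  rw [e]
  refine h6.congr_fderiv ?_
  ext v
  simp [scoreJac, scoreWeight]
  ring

theorem scoreWeight_mem (X : Fin n → Rd d) (t : ℝ) (x : Rd d) :
    0 ≤ scoreWeight X t x ∧ scoreWeight X t x ≤ 1 :=
  ⟨Real.smoothTransition.nonneg _, Real.smoothTransition.le_one _⟩

theorem scoreWeightDeriv_nonneg (hn : 2 ≤ n) (ht : 0 < t) (X : Fin n → Rd d) (x : Rd d) :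
    0 ≤ scoreWeightDeriv X t x :=
  mul_nonneg (Real.smoothTransition.monotone.deriv_nonneg)
    (div_nonneg zero_le_two (threshold_pos hn ht).le)

theorem scoreWeight_of_threshold_le (hn : 2 ≤ n) (ht : 0 < t) {x : Rd d}
    (h : threshold d n t ≤ pHat X t x) : scoreWeight X t x = 1 ∧ scoreWeightDeriv X t x = 0 := by
  have hη := threshold_pos (d := d) hn ht
  have h1 : 1 ≤ 2 * pHat X t x / threshold d n t - 1 := by
    rw [le_sub_iff_add_le, le_div_iff₀ hη]; linarith
  rw [scoreWeight, scoreWeightDeriv, Real.smoothTransition.one_of_one_le h1,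
    deriv_smoothTransition_of_one_le h1]
  simp

theorem scoreWeight_of_le_half (hn : 2 ≤ n) (ht : 0 < t) {x : Rd d}
    (h : pHat X t x ≤ threshold d n t / 2) :
    scoreWeight X t x = 0 ∧ scoreWeightDeriv X t x = 0 := by
  have hη := threshold_pos (d := d) hn ht
  have h1 : 2 * pHat X t x / threshold d n t - 1 ≤ 0 := by
    rw [sub_nonpos, div_le_one hη]; linarith
  rw [scoreWeight, scoreWeightDeriv, Real.smoothTransition.zero_of_nonpos h1,
    deriv_smoothTransition_of_nonpos h1]
  simp

/-- Wherever the score estimator can be nonzero, the additive term in `kdeSq_div_le` is itself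
bounded by the density, leaving a purely multiplicative bound. -/
theorem kdeSq_div_le_of_half_threshold_le (hn : 2 ≤ n) (ht : 0 < t) {x : Rd d}
    (h : threshold d n t / 2 ≤ pHat X t x) :
    kdeSq X t x / t ≤ 24 * Real.log n * pHat X t x := by
  have : NeZero n := ⟨by omega⟩
  have hq := pHat_pos ht X x
  have h1 := kdeSq_div_le (by omega : 1 ≤ n) ht X x
  have hl := half_le_log_natCast hn
  have hn0 : (0 : ℝ) < n := by positivity
  set Z := (2 * Real.pi * t) ^ ((d : ℝ) / 2) with hZ
  have hZ0 : 0 < Z := by positivity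
  have e : threshold d n t = Real.log n * (1 / (n * Z)) := by
    unfold threshold; rw [← hZ]; ring
  have h2 : 4 / (n * Z) = 4 * (1 / (n * Z)) := by ring
  set y := 1 / ((n : ℝ) * Z) with hy
  have hy0 : 0 < y := by positivity
  rw [e] at h
  rw [h2] at h1
  have h3 : 0.69 * y ≤ 2 * pHat X t x := by nlinarith
  have h4 : 4 * y ≤ 20 * Real.log n * pHat X t x := by nlinarith
  linarith

theorem kdeGrad_sq_le (ht : 0 < t) (X : Fin n → Rd d) (x : Rd d) :
    ‖kdeGrad X t x‖ ^ 2 ≤ pHat X t x * (kdeSq X t x / t) / t := by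
  have := sq_norm_kdeGrad_le ht X x
  rw [le_div_iff₀ ht, mul_div_assoc', le_div_iff₀ ht]
  linarith

/-- Outside the support of the threshold function the Jacobian vanishes. On it, Hessian and squared
gradient are at most `log n / t` times `p̂` and `p̂²`. The constant depends only on a bound for the
derivative of the smooth step. -/
theorem exists_norm_scoreJac_le :
    ∃ B : ℝ, 1 ≤ B ∧ ∀ {d n : ℕ} {t : ℝ}, 2 ≤ n → 0 < t → ∀ (X : Fin n → Rd d) (x : Rd d),
      ‖scoreJac X t x‖ ≤ B * Real.log n / t := by
  obtain ⟨D, hD0, hD⟩ := exists_deriv_smoothTransition_le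
  refine ⟨24 * (2 * D + 1) + 26, by linarith, fun {d n t} hn ht X x => ?_⟩
  have : NeZero n := ⟨by omega⟩
  have hq := pHat_pos ht X x
  have hη := threshold_pos (d := d) hn ht
  have hl := half_le_log_natCast hn
  rcases le_total (pHat X t x) (threshold d n t / 2) with h | h
  · obtain ⟨h1, h2⟩ := scoreWeight_of_le_half hn ht h
    have h3 : scoreJac X t x = 0 := by
      rw [scoreJac, h1, h2]
      ext v
      simp
    have h4 := log_natCast_pos hn
    rw [h3, norm_zero]
    positivity
  have hV := kdeSq_div_le_of_half_threshold_le hn ht h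
  have hG := kdeGrad_sq_le ht X x
  have hV0 := kdeSq_nonneg ht X x
  obtain ⟨hw0, hw1⟩ := scoreWeight_mem X t x
  set q := pHat X t x with hqd
  set V := kdeSq X t x / t with hVd
  set ℓ := Real.log n with hℓ
  have hV0' : 0 ≤ V := by positivity
  have hG2 : ‖kdeGrad X t x‖ ^ 2 ≤ q ^ 2 * (24 * ℓ / t) := by
    refine hG.trans ?_
    rw [div_le_iff₀ ht]
    calc q * V ≤ q * (24 * ℓ * q) := by gcongr
      _ = q ^ 2 * (24 * ℓ / t) * t := by field_simp
  have hH : ‖kdeHess X t x‖ ≤ q * (26 * ℓ / t) := by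
    refine (norm_kdeHess_le ht X x).trans ?_
    have : kdeSq X t x / t ^ 2 = V / t := by rw [hVd, div_div, sq]
    rw [this, ← add_div, mul_div_assoc']
    gcongr
    nlinarith
  have hρ' : |scoreWeightDeriv X t x / q - scoreWeight X t x / q ^ 2| ≤ (2 * D + 1) / q ^ 2 := by
    -- The derivative of the weight is of size `1/η`, but it vanishes once `q ≥ η`; below that, `1/η
    -- ≤ 1/q`.
    have h1 : scoreWeightDeriv X t x / q ≤ 2 * D / q ^ 2 := by
      rcases le_total (threshold d n t) q with h2 | h2
      · rw [(scoreWeight_of_threshold_le hn ht h2).2]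
        simp; positivity
      · rw [div_le_div_iff₀ hq (by positivity)]
        unfold scoreWeightDeriv
        have h3 := (le_abs_self _).trans (hD (2 * pHat X t x / threshold d n t - 1))
        have h4 : 2 / threshold d n t * q ≤ 2 := by
          rw [div_mul_eq_mul_div, div_le_iff₀ hη]; linarith
        calc _ = deriv Real.smoothTransition (2 * pHat X t x / threshold d n t - 1) *
              (2 / threshold d n t * q) * q := by ring
          _ ≤ D * 2 * q := by gcongr
          _ = _ := by ring
    have h2 : 0 ≤ scoreWeightDeriv X t x / q := div_nonneg (scoreWeightDeriv_nonneg hn ht X x) hq.le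
    have h3 : scoreWeight X t x / q ^ 2 ≤ 1 / q ^ 2 := by gcongr
    have h4 : 0 ≤ scoreWeight X t x / q ^ 2 := by positivity
    have h5 : 0 ≤ 2 * D / q ^ 2 := by positivity
    rw [add_div, abs_le]
    constructor <;> linarith
  unfold scoreJac
  refine (norm_add_le _ _).trans ?_
  rw [norm_smul, norm_smul, ContinuousLinearMap.norm_smulRight_apply, innerSL_apply_norm,
    Real.norm_eq_abs, Real.norm_eq_abs, abs_of_nonneg (by positivity), ← sq]
  calc scoreWeight X t x / q * ‖kdeHess X t x‖ +
        |scoreWeightDeriv X t x / q - scoreWeight X t x / q ^ 2| * ‖kdeGrad X t x‖ ^ 2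
      ≤ 1 / q * (q * (26 * ℓ / t)) + (2 * D + 1) / q ^ 2 * (q ^ 2 * (24 * ℓ / t)) := by gcongr
    _ = _ := by field_simp; ring

theorem isSymmetric_scoreJac (X : Fin n → Rd d) (t : ℝ) (x : Rd d) :
    (scoreJac X t x : Rd d →ₗ[ℝ] Rd d).IsSymmetric := by
  intro v w
  have := inner_kdeHess_comm X t x v w
  simp only [scoreJac, ContinuousLinearMap.coe_coe, add_apply,
    smul_apply, inner_add_left, inner_add_right, inner_smul_left,
    inner_smul_right, this, ContinuousLinearMap.smulRight_apply, innerSL_apply_apply, conj_trivial]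
  rw [real_inner_comm (kdeGrad X t x) v]
  ring

theorem trace_scoreJac (ht : t ≠ 0) (X : Fin n → Rd d) (x : Rd d) :
    LinearMap.trace ℝ (Rd d) (scoreJac X t x : Rd d →ₗ[ℝ] Rd d) =
      scoreWeight X t x / pHat X t x * (kdeSq X t x / t ^ 2 - d * pHat X t x / t) +
      (scoreWeightDeriv X t x / pHat X t x - scoreWeight X t x / pHat X t x ^ 2) *
        ‖kdeGrad X t x‖ ^ 2 := by
  have h : ∀ a : Rd d, LinearMap.trace ℝ (Rd d)
      (((innerSL ℝ a).smulRight a : Rd d →L[ℝ] Rd d) : Rd d →ₗ[ℝ] Rd d) = ‖a‖ ^ 2 :=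
    trace_innerSL_smulRight
  unfold scoreJac
  rw [ContinuousLinearMap.toLinearMap_add, ContinuousLinearMap.toLinearMap_smul,
    ContinuousLinearMap.toLinearMap_smul, map_add, map_smul, map_smul, h, trace_kdeHess ht]
  rfl

end ScoreEstimator


/-! ### One Euler step along the heat flow of the density estimator -/

section EulerStep

variable {d n : ℕ} {t h : ℝ} {X : Fin n → Rd d}

/-- Write the ratio of the two kernels as one exponential, using `1 - h/t ≤ exp(-h/t)` for the
normalization, and apply `exp u ≥ 1 + u`. The result is affine in the exponent, so averaging over
the data produces only moments of the estimator. -/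
theorem gaussianKernel_mul_le (hh : 0 < h) (hht : h < t) (a δ : Rd d) (m : ℝ) :
    gaussianKernel t a * (1 + m + d / 2 * (h / t) +
      (‖a‖ ^ 2 / (2 * t) - ‖a - δ‖ ^ 2 / (2 * (t - h)))) ≤
    gaussianKernel (t - h) (a - δ) * Real.exp m := by
  have ht : 0 < t := hh.trans hht
  have hs : 0 < t - h := sub_pos.2 hht
  set Z := (2 * Real.pi * t) ^ ((d : ℝ) / 2) with hZ
  have hZ0 : 0 < Z := by positivity
  have h1 : (2 * Real.pi * (t - h)) ^ ((d : ℝ) / 2) ≤ Z * Real.exp (-(d / 2 * (h / t))) := by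
    have e : 2 * Real.pi * (t - h) = 2 * Real.pi * t * (1 - h / t) := by field_simp
    have h2 : 0 ≤ 1 - h / t := by rw [sub_nonneg, div_le_one ht]; exact hht.le
    rw [e, Real.mul_rpow (by positivity) h2]
    gcongr
    calc (1 - h / t) ^ ((d : ℝ) / 2) ≤ (Real.exp (-(h / t))) ^ ((d : ℝ) / 2) := by
          gcongr
          linarith [Real.add_one_le_exp (-(h / t))]
      _ = _ := by rw [← Real.exp_mul]; ring_nf
  set u := d / 2 * (h / t) with hu
  set y := ‖a‖ ^ 2 / (2 * t) with hy
  set y' := ‖a - δ‖ ^ 2 / (2 * (t - h)) with hy'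
  have e1 : gaussianKernel t a = 1 / Z * Real.exp (-y) := by
    rw [gaussianKernel, ← hZ, neg_div]
  have h3 : 1 / Z * Real.exp u ≤ 1 / (2 * Real.pi * (t - h)) ^ ((d : ℝ) / 2) := by
    rw [div_mul_eq_mul_div, one_mul, div_le_div_iff₀ hZ0 (by positivity)]
    calc Real.exp u * (2 * Real.pi * (t - h)) ^ ((d : ℝ) / 2)
        ≤ Real.exp u * (Z * Real.exp (-u)) := by gcongr
      _ = 1 * Z := by rw [Real.exp_neg]; field_simp
  have e2 : gaussianKernel (t - h) (a - δ) =
      1 / (2 * Real.pi * (t - h)) ^ ((d : ℝ) / 2) * Real.exp (-y') := by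
    rw [gaussianKernel, neg_div]
  rw [e1, e2]
  calc 1 / Z * Real.exp (-y) * (1 + m + u + (y - y'))
      ≤ 1 / Z * Real.exp (-y) * Real.exp (m + u + (y - y')) := by
        gcongr
        linarith [Real.add_one_le_exp (m + u + (y - y'))]
    _ = 1 / Z * Real.exp u * Real.exp (-y') * Real.exp m := by
        rw [mul_assoc, ← Real.exp_add, mul_assoc, mul_assoc, ← Real.exp_add, ← Real.exp_add]
        ring_nf
    _ ≤ _ := by gcongr

/-- The average of `gaussianKernel_mul_le` over the data. Here `δ` will be the displacement of the
Euler step and `exp m` a lower bound for its Jacobian determinant. -/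
theorem pHat_sub_mul_exp_ge (hh : 0 < h) (hht : h < t) (X : Fin n → Rd d) (x δ : Rd d) (m : ℝ) :
    pHat X t x * (1 + m + d / 2 * (h / t)) - kdeSq X t x * (h / (2 * t * (t - h))) +
      t / (t - h) * inner ℝ (kdeGrad X t x) δ - pHat X t x * (‖δ‖ ^ 2 / (2 * (t - h))) ≤
    pHat X (t - h) (x + δ) * Real.exp m := by
  have ht : 0 < t := hh.trans hht
  have hs : 0 < t - h := sub_pos.2 hht
  have key : ∀ i, gaussianKernel t (X i - x) * (1 + m + d / 2 * (h / t)) -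
      gaussianKernel t (X i - x) * ‖X i - x‖ ^ 2 * (h / (2 * t * (t - h))) +
      t / (t - h) * (gaussianKernel t (X i - x) / t * inner ℝ (X i - x) δ) -
      gaussianKernel t (X i - x) * (‖δ‖ ^ 2 / (2 * (t - h))) ≤
      gaussianKernel (t - h) (X i - (x + δ)) * Real.exp m := by
    intro i
    have h1 := gaussianKernel_mul_le hh hht (X i - x) δ m
    rw [← sub_sub]
    refine le_trans (le_of_eq ?_) h1
    generalize X i - x = a
    rw [norm_sub_sq_real]
    field_simp
    ring
  have h2 := mul_le_mul_of_nonneg_left (Finset.sum_le_sum fun i (_ : i ∈ Finset.univ) => key i)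
    (by positivity : 0 ≤ 1 / (n : ℝ))
  refine le_trans (le_of_eq ?_) (h2.trans (le_of_eq ?_))
  · simp only [Finset.sum_sub_distrib, Finset.sum_add_distrib, ← Finset.sum_mul, ← Finset.mul_sum]
    unfold pHat kdeSq kdeGrad
    rw [real_inner_smul_left, sum_inner]
    simp_rw [real_inner_smul_left]
    ring
  · rw [← Finset.sum_mul, pHat, mul_assoc]

/-- The contribution of the region where the score estimator is thresholded. -/
noncomputable def thresholdedDensity (X : Fin n → Rd d) (t : ℝ) (x : Rd d) : ℝ :=
  if pHat X t x < threshold d n t then pHat X t x + kdeSq X t x / t else 0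

/-- The map performed by a single step of the sampler after rescaling. -/
noncomputable def eulerMap (X : Fin n → Rd d) (t h : ℝ) (x : Rd d) : Rd d :=
  x + (h / 2) • scoreZ X t x

theorem hasFDerivAt_eulerMap (hn : 2 ≤ n) (ht : 0 < t) (X : Fin n → Rd d) (x : Rd d) :
    HasFDerivAt (eulerMap X t h) (ContinuousLinearMap.id ℝ (Rd d) + (h / 2) • scoreJac X t x) x :=
  (hasFDerivAt_id x).add ((hasFDerivAt_scoreZ hn ht X x).const_smul (h / 2))

theorem continuous_eulerMap (hn : 2 ≤ n) (ht : 0 < t) (X : Fin n → Rd d) :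
    Continuous (eulerMap X t h) :=
  continuous_iff_continuousAt.2 fun x => (hasFDerivAt_eulerMap hn ht X x).continuousAt

/-- The displacement is a contraction with factor `1/2`, so it cannot cancel `x - y`. -/
theorem injective_eulerMap (hn : 2 ≤ n) (ht : 0 < t) (X : Fin n → Rd d)
    (hM : ∀ x, ‖(h / 2) • scoreJac X t x‖ ≤ 1 / 2) : Function.Injective (eulerMap X t h) := by
  intro x y hxy
  have h1 := Convex.norm_image_sub_le_of_norm_hasFDerivWithin_le (s := Set.univ) (x := x) (y := y)
    (f := fun x => (h / 2) • scoreZ X t x)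
    (fun x _ => ((hasFDerivAt_scoreZ hn ht X x).const_smul (h / 2)).hasFDerivWithinAt)
    (fun x _ => hM x) convex_univ trivial trivial
  have h2 : (h / 2) • scoreZ X t y - (h / 2) • scoreZ X t x = x - y := by
    have : x + (h / 2) • scoreZ X t x = y + (h / 2) • scoreZ X t y := hxy
    rw [sub_eq_sub_iff_add_eq_add, add_comm _ y, ← this]
  simp only [h2] at h1
  rw [norm_sub_rev y x] at h1
  have h3 : ‖x - y‖ = 0 := le_antisymm (by linarith) (norm_nonneg _)
  exact sub_eq_zero.1 (norm_eq_zero.1 h3)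

/-- Dictionary: `q = p̂_t`, `V = kdeSq / t`, `G = t ‖∇p̂_t‖² / q`, `H = h/t`, `c = 1/(1-H)`, `w` and
`w'` are the weight and its derivative, `N` is the squared norm of the Jacobian of the displacement.
First-order terms need not cancel here; the harmful ones are bounded by multiples of `H (q + V)`.
The `w'` term is nonnegative because the threshold function increases, so it is dropped and no bound
on `w'` is needed. -/
theorem le_add_of_thresholded {q V G H w w' N D c P B ℓ : ℝ} (hq : 0 ≤ q) (hV : 0 ≤ V) (hG : 0 ≤ G)
    (hGV : G ≤ V) (hH : 0 ≤ H) (hH1 : H ≤ 1 / 2) (hw0 : 0 ≤ w) (hw1 : w ≤ 1) (hw' : 0 ≤ w')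
    (hD : 0 ≤ D) (hc0 : 0 ≤ c) (hc2 : c ≤ 2)
    (hP : q + (H / 2 * (w * (V - D * q) + (w' * q * G - w * G)) - q * D * N) +
      q * D / 2 * H - V * H * c / 2 + c * H / 2 * w * G - H ^ 2 * w ^ 2 * G * c / 8 ≤ P)
    (hN : q * D * N ≤ q * (D * B ^ 2 * H ^ 2 * ℓ ^ 2)) :
    q ≤ P + q * ((60 + D * B ^ 2) * H ^ 2 * ℓ ^ 2) + (D + 2) * H * (q + V) := by
  have b0 : H ^ 2 * w ^ 2 * G * c ≤ H * V := by
    calc H ^ 2 * w ^ 2 * G * c = H * (H * (w ^ 2 * (G * c))) := by ring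
      _ ≤ H * (1 / 2 * (1 * (V * 2))) := by
        gcongr
        exact pow_le_one₀ hw0 hw1
      _ = H * V := by ring
  have b1 : 0 ≤ H / 2 * (w' * q * G) := by positivity
  have b2 : H / 2 * (w * G) ≤ H / 2 * (1 * V) := by gcongr
  have b3 : H / 2 * (w * (D * q)) ≤ H / 2 * (1 * (D * q)) := by gcongr
  have b4 : V * H * c ≤ V * H * 2 := by gcongr
  have b5 : 0 ≤ c * H / 2 * w * G := by positivity
  have b6 : 0 ≤ H / 2 * (w * V) := by positivity
  have b8 : 0 ≤ D * H * V := by positivity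
  have b9 : 0 ≤ D * H * q := by positivity
  have b10 : 0 ≤ H * q := by positivity
  have b11 : 0 ≤ H * V := by positivity
  have b12 : 0 ≤ q * (60 * H ^ 2 * ℓ ^ 2) := by positivity
  linarith

/-- With `w = 1` and `w' = 0` the first-order terms cancel except for `c - 1 = O(H)`. The remainder
is at most `(5/4) H² V`, and `V ≤ 24 ℓ q ≤ 36 ℓ² q` makes it `45 H² ℓ² q`, within the constant `60`.
-/
theorem le_add_of_unthresholded {q V G H N D c P B ℓ : ℝ} (hq : 0 ≤ q) (hV : 0 ≤ V) (hG : 0 ≤ G)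
    (hGV : G ≤ V) (hH : 0 ≤ H) (hH1 : H ≤ 1 / 2) (hc1 : 1 ≤ c) (hc2 : c ≤ 1 + 2 * H)
    (hl : 0.69 ≤ ℓ) (hVl : V ≤ 24 * ℓ * q)
    (hP : q + (H / 2 * (1 * (V - D * q) + (0 * q * G - 1 * G)) - q * D * N) +
      q * D / 2 * H - V * H * c / 2 + c * H / 2 * 1 * G - H ^ 2 * 1 ^ 2 * G * c / 8 ≤ P)
    (hN : q * D * N ≤ q * (D * B ^ 2 * H ^ 2 * ℓ ^ 2)) :
    q ≤ P + q * ((60 + D * B ^ 2) * H ^ 2 * ℓ ^ 2) := by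
  have b0 : H ^ 2 * (G * c) ≤ H ^ 2 * (V * 2) := by
    have : c ≤ 2 := by linarith
    gcongr
  have b1 : V * H * c ≤ V * H * (1 + 2 * H) := by gcongr
  have b2 : 1 * (H * G) ≤ c * (H * G) := by gcongr
  have b4 : ℓ ≤ 1.5 * ℓ ^ 2 := by nlinarith
  have b3 : H ^ 2 * V ≤ H ^ 2 * (24 * (1.5 * ℓ ^ 2) * q) := by
    refine mul_le_mul_of_nonneg_left (hVl.trans ?_) (by positivity)
    gcongr
  have b12 : 0 ≤ q * H ^ 2 * ℓ ^ 2 := by positivity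
  linarith

/-- Pure algebra: passage to the scale-free variables `V`, `G`, `H`, `c`, in which the cancellation
is visible. -/
theorem normalized_step_bound {q t h Q g w w' N D P : ℝ} (hq : 0 < q) (ht : 0 < t) (hh : 0 < h)
    (hht : h ≤ t / 2)
    (hP : q * (1 + (h / 2 * (w / q * (Q / t ^ 2 - D * q / t) + (w' / q - w / q ^ 2) * g) - D * N) +
        D / 2 * (h / t)) - Q * (h / (2 * t * (t - h))) +
      t / (t - h) * (h / 2 * (w / q) * g) - q * ((h / 2 * (w / q)) ^ 2 * g / (2 * (t - h))) ≤ P) :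
    q + (h / t / 2 * (w * (Q / t - D * q) + (w' * q * (g * t / q) - w * (g * t / q))) - q * D * N) +
      q * D / 2 * (h / t) - Q / t * (h / t) * (1 / (1 - h / t)) / 2 +
      1 / (1 - h / t) * (h / t) / 2 * w * (g * t / q) -
      (h / t) ^ 2 * w ^ 2 * (g * t / q) * (1 / (1 - h / t)) / 8 ≤ P := by
  refine le_trans (le_of_eq ?_) hP
  have h1 : 1 / (1 - h / t) = t / (t - h) := by
    have : t - h ≠ 0 := by linarith
    have : 1 - h / t ≠ 0 := by
      rw [sub_ne_zero]; intro h2; rw [eq_div_iff ht.ne'] at h2; linarith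
    field_simp
  have : t - h ≠ 0 := by linarith
  rw [h1]
  field_simp
  ring

/-- The pointwise form of transport by the Euler map. The continuity equation makes it an equality
to first order where the score is exact. -/
theorem pHat_le_of_eulerMap (hn : 2 ≤ n) (hh : 0 < h) (hht : h ≤ t / 2) {B : ℝ} (X : Fin n → Rd d)
    (x : Rd d) (hJ : ‖scoreJac X t x‖ ≤ B * Real.log n / t)
    (hM : ‖(h / 2) • scoreJac X t x‖ ≤ 1 / 2) :
    pHat X t x ≤ pHat X (t - h) (eulerMap X t h x) *
        (ContinuousLinearMap.id ℝ (Rd d) + (h / 2) • scoreJac X t x).det +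
      pHat X t x * ((60 + d * B ^ 2) * (h / t) ^ 2 * Real.log n ^ 2) +
      (d + 2) * (h / t) * thresholdedDensity X t x := by
  have ht : 0 < t := by linarith
  have hs : t / 2 ≤ t - h := by linarith
  have hs0 : 0 < t - h := by linarith
  have : NeZero n := ⟨by omega⟩
  have hq := pHat_pos ht X x
  have hp := pHat_pos hs0 X (eulerMap X t h x)
  have hl := half_le_log_natCast hn
  have hl0 := log_natCast_pos hn
  have hsym : (((h / 2) • scoreJac X t x : Rd d →L[ℝ] Rd d) : Rd d →ₗ[ℝ] Rd d).IsSymmetric := by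
    rw [ContinuousLinearMap.toLinearMap_smul]
    exact (isSymmetric_scoreJac X t x).smul (by simp)
  have hdet := exp_trace_sub_le_det hsym hM
  rw [ContinuousLinearMap.toLinearMap_smul, map_smul, trace_scoreJac ht.ne', smul_eq_mul] at hdet
  have hM2 : ‖(h / 2) • scoreJac X t x‖ ^ 2 ≤ B ^ 2 * (h / t) ^ 2 * Real.log n ^ 2 := by
    rw [norm_smul, Real.norm_of_nonneg (by positivity)]
    calc (h / 2 * ‖scoreJac X t x‖) ^ 2 ≤ (h / 2 * (B * Real.log n / t)) ^ 2 := by gcongr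
      _ = 1 / 4 * (B ^ 2 * (h / t) ^ 2 * Real.log n ^ 2) := by ring
      _ ≤ _ := by
        have : 0 ≤ B ^ 2 * (h / t) ^ 2 * Real.log n ^ 2 := by positivity
        linarith
  obtain ⟨hw0, hw1⟩ := scoreWeight_mem X t x
  have hw' := scoreWeightDeriv_nonneg hn ht X x
  have hG := kdeGrad_sq_le ht X x
  have hV0 := div_nonneg (kdeSq_nonneg ht X x) ht.le
  -- The free parameter `m` is taken to be the exponent in the determinant bound: the trace of the
  -- Jacobian of the displacement minus its quadratic correction.
  have hmain := (pHat_sub_mul_exp_ge hh (by linarith : h < t) X x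
    ((h / 2) • scoreZ X t x) _).trans (mul_le_mul_of_nonneg_left hdet hp.le)
  have hsq : ∀ c : ℝ, ‖c • kdeGrad X t x‖ ^ 2 = c ^ 2 * ‖kdeGrad X t x‖ ^ 2 := fun c => by
    rw [norm_smul, mul_pow, Real.norm_eq_abs, sq_abs]
  rw [scoreZ_eq hn ht, smul_smul, real_inner_smul_right, real_inner_self_eq_norm_sq, hsq] at hmain
  rw [eulerMap, scoreZ_eq hn ht, smul_smul]
  have hmain2 := normalized_step_bound hq ht hh hht hmain
  have hGV : ‖kdeGrad X t x‖ ^ 2 * t / pHat X t x ≤ kdeSq X t x / t := by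
    rw [div_le_iff₀ hq, ← le_div_iff₀ ht, mul_comm (kdeSq X t x / t)]
    exact hG
  have hG0 : 0 ≤ ‖kdeGrad X t x‖ ^ 2 * t / pHat X t x := by positivity
  have hH0 : 0 ≤ h / t := by positivity
  have hH1 : h / t ≤ 1 / 2 := by rw [div_le_iff₀ ht]; linarith
  have h1H : 0 < 1 - h / t := by linarith
  have hc1 : 1 ≤ 1 / (1 - h / t) := by rw [le_div_iff₀ h1H]; linarith
  have hc2 : 1 / (1 - h / t) ≤ 1 + 2 * (h / t) := by rw [div_le_iff₀ h1H]; nlinarith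
  have hNd : pHat X t x * d * ‖(h / 2) • scoreJac X t x‖ ^ 2 ≤
      pHat X t x * (d * B ^ 2 * (h / t) ^ 2 * Real.log n ^ 2) := by
    rw [mul_assoc]
    refine mul_le_mul_of_nonneg_left ?_ hq.le
    calc d * ‖(h / 2) • scoreJac X t x‖ ^ 2 ≤ d * (B ^ 2 * (h / t) ^ 2 * Real.log n ^ 2) := by
          gcongr
      _ = _ := by ring
  rcases lt_or_ge (pHat X t x) (threshold d n t) with hlt | hge'
  · rw [thresholdedDensity, if_pos hlt]
    exact le_add_of_thresholded hq.le hV0 hG0 hGV hH0 hH1 hw0 hw1 hw' (Nat.cast_nonneg d)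
      (by linarith) (by linarith) hmain2 hNd
  · obtain ⟨hw1', hw0'⟩ := scoreWeight_of_threshold_le hn ht hge'
    have hη := threshold_pos (d := d) hn ht
    have hVl := kdeSq_div_le_of_half_threshold_le hn ht (by linarith :
      threshold d n t / 2 ≤ pHat X t x)
    rw [hw1', hw0'] at hmain2
    rw [hw1', thresholdedDensity, if_neg (not_lt.2 hge'), mul_zero, add_zero]
    exact le_add_of_unthresholded hq.le hV0 hG0 hGV hH0 hH1 hc1 hc2 hl hVl hmain2 hNd

/-- A single Euler step transports the kernel density estimator at time `t` to the one at time
`t - h` up to a second-order error and an error in the thresholded region. -/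
theorem exists_eulerMap_le (d : ℕ) :
    ∃ C : ℝ, 0 < C ∧ ∀ {n : ℕ} {t h : ℝ}, 2 ≤ n → 0 < h → h < t → ∀ (X : Fin n → Rd d)
      (A : Set (Rd d)), MeasurableSet A →
      (lawOfDensity (pHat X t)).map (eulerMap X t h) A ≤ lawOfDensity (pHat X (t - h)) A +
        (ENNReal.ofReal (C * (h / t) ^ 2 * Real.log n ^ 2) +
          ENNReal.ofReal (C * (h / t)) * ∫⁻ x, ENNReal.ofReal (thresholdedDensity X t x)) := by
  obtain ⟨B, hB1, hB⟩ := exists_norm_scoreJac_le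
  refine ⟨60 + d * B ^ 2 + 10 * B ^ 2 + d + 2, by positivity, fun {n t h} hn hh hht X A hA => ?_⟩
  set C := 60 + d * B ^ 2 + 10 * B ^ 2 + d + 2 with hC
  have ht : 0 < t := hh.trans hht
  have : NeZero n := ⟨by omega⟩
  have hpt := isProbabilityMeasure_lawOfDensity_pHat ht X
  have hl := half_le_log_natCast hn
  set H := h / t with hH
  have hH0 : 0 < H := by positivity
  have hFm : Measurable (eulerMap X t h) := (continuous_eulerMap hn ht X).measurable
  -- If either smallness condition fails, the quadratic error alone exceeds one and the bound on a
  -- probability is trivial.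
  by_cases hsmall : H ≤ 1 / 2 ∧ H * B * Real.log n ≤ 1
  swap
  · have : IsProbabilityMeasure ((lawOfDensity (pHat X t)).map (eulerMap X t h)) :=
      Measure.isProbabilityMeasure_map hFm.aemeasurable
    have h1 : 1 ≤ C * H ^ 2 * Real.log n ^ 2 := by
      have hC1 : 60 ≤ C := by rw [hC]; nlinarith [sq_nonneg B, Nat.cast_nonneg (α := ℝ) d]
      have hC2 : B ^ 2 ≤ C := by
        have : 0 ≤ d * B ^ 2 := by positivity
        rw [hC]; nlinarith [sq_nonneg B, Nat.cast_nonneg (α := ℝ) d]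
      rw [not_and_or, not_le, not_le] at hsmall
      rcases hsmall with h2 | h2
      · calc (1 : ℝ) ≤ 60 * (1 / 2) ^ 2 * 0.69 ^ 2 := by norm_num
          _ ≤ _ := by gcongr
      · calc (1 : ℝ) ≤ (H * B * Real.log n) ^ 2 := one_le_pow₀ h2.le
          _ = B ^ 2 * H ^ 2 * Real.log n ^ 2 := by ring
          _ ≤ _ := by gcongr
    refine prob_le_one.trans ((le_trans ?_ le_self_add).trans le_add_self)
    rw [← ENNReal.ofReal_one]
    exact ENNReal.ofReal_le_ofReal h1
  obtain ⟨hs1, hs2⟩ := hsmall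
  have hht2 : h ≤ t / 2 := by rw [hH, div_le_iff₀ ht] at hs1; linarith
  have hs0 : 0 < t - h := by linarith
  have hM : ∀ x, ‖(h / 2) • scoreJac X t x‖ ≤ 1 / 2 := by
    intro x
    rw [norm_smul, Real.norm_of_nonneg (by positivity)]
    calc h / 2 * ‖scoreJac X t x‖ ≤ h / 2 * (B * Real.log n / t) := by
          gcongr; exact hB hn ht X x
      _ = H * B * Real.log n / 2 := by rw [hH]; ring
      _ ≤ 1 / 2 := by linarith
  set F := eulerMap X t h with hF
  set F' := fun x => ContinuousLinearMap.id ℝ (Rd d) + (h / 2) • scoreJac X t x with hF'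
  have hinj : Function.Injective F := injective_eulerMap hn ht X hM
  have hqm := measurable_pHat X t
  rw [Measure.map_apply hFm hA, lawOfDensity, lawOfDensity, withDensity_apply _ (hFm hA),
    withDensity_apply _ hA]
  have hcv := lintegral_image_eq_lintegral_abs_det_fderiv_mul (volume : Measure (Rd d)) (hFm hA)
    (fun x _ => (hasFDerivAt_eulerMap (h := h) hn ht X x).hasFDerivWithinAt) hinj.injOn
    (fun x => ENNReal.ofReal (pHat X (t - h) x))
  have hpt1 : ∀ x, ENNReal.ofReal (pHat X t x) ≤
      ENNReal.ofReal |(F' x).det| * ENNReal.ofReal (pHat X (t - h) (F x)) +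
      (ENNReal.ofReal (pHat X t x) * ENNReal.ofReal (C * H ^ 2 * Real.log n ^ 2) +
      ENNReal.ofReal (C * H) * ENNReal.ofReal (thresholdedDensity X t x)) := by
    intro x
    have hq := pHat_pos ht X x
    have hp := pHat_pos hs0 X (F x)
    have hV := kdeSq_nonneg ht X x
    have hT : 0 ≤ thresholdedDensity X t x := by
      unfold thresholdedDensity; split_ifs <;> positivity
    rw [← ENNReal.ofReal_mul (by positivity), ← ENNReal.ofReal_mul (by positivity),
      ← ENNReal.ofReal_mul (by positivity), ← ENNReal.ofReal_add (by positivity) (by positivity),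
      ← ENNReal.ofReal_add (by positivity) (by positivity)]
    refine ENNReal.ofReal_le_ofReal ?_
    have h1 := pHat_le_of_eulerMap hn hh hht2 X x (hB hn ht X x) (hM x)
    have h2 : pHat X (t - h) (F x) * (F' x).det ≤ |(F' x).det| * pHat X (t - h) (F x) := by
      rw [mul_comm]; gcongr; exact le_abs_self _
    have h3 : pHat X t x * ((60 + d * B ^ 2) * H ^ 2 * Real.log n ^ 2) ≤
        pHat X t x * (C * H ^ 2 * Real.log n ^ 2) := by
      gcongr
      rw [hC]
      have : 0 ≤ 10 * B ^ 2 + d := by positivity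
      linarith
    have h4 : (d + 2) * H * thresholdedDensity X t x ≤ C * H * thresholdedDensity X t x := by
      gcongr
      rw [hC]
      have : 0 ≤ 60 + d * B ^ 2 + 10 * B ^ 2 := by positivity
      linarith
    linarith
  have hqone : ∫⁻ x, ENNReal.ofReal (pHat X t x) = 1 := by
    have := hpt.measure_univ
    rwa [lawOfDensity, withDensity_apply _ .univ, Measure.restrict_univ] at this
  have hTm : Measurable (thresholdedDensity X t) := by
    unfold thresholdedDensity
    refine Measurable.ite (measurableSet_lt hqm measurable_const) ?_ measurable_const
    refine hqm.add (Measurable.div_const ?_ t)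
    unfold kdeSq
    fun_prop
  set r : Rd d → ENNReal := fun x =>
    ENNReal.ofReal (pHat X t x) * ENNReal.ofReal (C * H ^ 2 * Real.log n ^ 2) +
      ENNReal.ofReal (C * H) * ENNReal.ofReal (thresholdedDensity X t x) with hr
  have hrm : Measurable r := by fun_prop
  have hrint : ∫⁻ x, r x = ENNReal.ofReal (C * H ^ 2 * Real.log n ^ 2) +
      ENNReal.ofReal (C * H) * ∫⁻ x, ENNReal.ofReal (thresholdedDensity X t x) := by
    rw [hr, lintegral_add_right _ (by fun_prop), lintegral_mul_const _ (by fun_prop),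
      lintegral_const_mul _ (by fun_prop), hqone, one_mul]
  rw [← hrint]
  calc ∫⁻ x in F ⁻¹' A, ENNReal.ofReal (pHat X t x)
      ≤ ∫⁻ x in F ⁻¹' A, (ENNReal.ofReal |(F' x).det| * ENNReal.ofReal (pHat X (t - h) (F x)) +
          r x) := lintegral_mono hpt1
    _ = (∫⁻ x in F ⁻¹' A, ENNReal.ofReal |(F' x).det| * ENNReal.ofReal (pHat X (t - h) (F x))) +
        ∫⁻ x in F ⁻¹' A, r x := lintegral_add_right _ hrm
    _ ≤ (∫⁻ x in A, ENNReal.ofReal (pHat X (t - h) x)) + ∫⁻ x, r x := by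
        refine add_le_add ?_ (setLIntegral_le_lintegral _ _)
        rw [← hcv]
        -- Surjectivity of `F` is not needed: the image of the preimage is contained in `A`, which
        -- is the right direction for a one-sided bound.
        exact lintegral_mono_set (Set.image_preimage_subset F A)

end EulerStep


/-! ### Subgaussian tails and the cutoff ball -/

section Tails

variable {d n : ℕ} {t σ : ℝ}

/-- The squared norm of a subgaussian vector has an exponential moment. -/
theorem lintegral_exp_sq_norm_le (hd : 1 ≤ d) {P : Measure (Rd d)} (hP : IsSubgaussian σ P) :
    ∫⁻ x, ENNReal.ofReal (Real.exp (‖x‖ ^ 2 / (d * σ ^ 2))) ∂P ≤ 2 := by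
  have hd0 : (0 : ℝ) < d := by exact_mod_cast hd
  have h1 : ∀ x : Rd d, Real.exp (‖x‖ ^ 2 / (d * σ ^ 2)) ≤
      ∑ j : Fin d, (1 / (d : ℝ)) * Real.exp ((inner ℝ x (EuclideanSpace.single j 1) / σ) ^ 2) := by
    intro x
    -- Jensen over the coordinates: the factor `1/d` in the exponent becomes the uniform weight.
    have h2 := convexOn_exp.map_sum_le (t := Finset.univ) (w := fun _ : Fin d => 1 / (d : ℝ))
      (p := fun j => (inner ℝ x (EuclideanSpace.single j (1 : ℝ)) / σ) ^ 2)
      (fun _ _ => by positivity) (by simp [hd0.ne']) (fun _ _ => trivial)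
    simp only [smul_eq_mul] at h2
    refine le_trans (le_of_eq ?_) h2
    congr 1
    rw [EuclideanSpace.real_norm_sq_eq, Finset.sum_div]
    refine Finset.sum_congr rfl fun j _ => ?_
    simp [EuclideanSpace.inner_single_right]
    field_simp
  calc ∫⁻ x, ENNReal.ofReal (Real.exp (‖x‖ ^ 2 / (d * σ ^ 2))) ∂P
      ≤ ∫⁻ x, ∑ j : Fin d, ENNReal.ofReal (1 / (d : ℝ)) * ENNReal.ofReal
        (Real.exp ((inner ℝ x (EuclideanSpace.single j (1 : ℝ)) / σ) ^ 2)) ∂P := by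
        refine lintegral_mono fun x => ?_
        refine (ENNReal.ofReal_le_ofReal (h1 x)).trans (le_of_eq ?_)
        rw [ENNReal.ofReal_sum_of_nonneg fun _ _ => by positivity]
        refine Finset.sum_congr rfl fun j _ => ENNReal.ofReal_mul (by positivity)
    _ = ∑ j : Fin d, ENNReal.ofReal (1 / (d : ℝ)) * ∫⁻ x, ENNReal.ofReal
        (Real.exp ((inner ℝ x (EuclideanSpace.single j (1 : ℝ)) / σ) ^ 2)) ∂P := by
        rw [lintegral_finsetSum _ (fun j _ => by fun_prop)]
        refine Finset.sum_congr rfl fun j _ => lintegral_const_mul _ (by fun_prop)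
    _ ≤ ∑ j : Fin d, ENNReal.ofReal (1 / (d : ℝ)) * 2 := by
        gcongr with j
        exact hP _ (by simp)
    _ = 2 := by
        rw [Finset.sum_const, Finset.card_univ, Fintype.card_fin, nsmul_eq_mul, ← mul_assoc,
          ← ENNReal.ofReal_natCast, ← ENNReal.ofReal_mul (by positivity), mul_one_div_cancel hd0.ne']
        simp

/-- A weighted Gaussian density is bounded by a Gaussian density of twice the variance. -/
theorem gaussianKernel_mul_one_add_le (ht : 0 < t) (z : Rd d) :
    gaussianKernel t z * (1 + ‖z‖ ^ 2 / t) * Real.exp (‖z‖ ^ 2 / (8 * t)) ≤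
      8 * 2 ^ ((d : ℝ) / 2) * gaussianKernel (2 * t) z := by
  have h1 : 1 + ‖z‖ ^ 2 / t ≤ 8 * Real.exp (‖z‖ ^ 2 / (8 * t)) := by
    have h2 := Real.add_one_le_exp (‖z‖ ^ 2 / (8 * t))
    have h3 : ‖z‖ ^ 2 / t = 8 * (‖z‖ ^ 2 / (8 * t)) := by field_simp
    rw [h3]; linarith
  have h4 : (2 * Real.pi * (2 * t)) ^ ((d : ℝ) / 2) =
      2 ^ ((d : ℝ) / 2) * (2 * Real.pi * t) ^ ((d : ℝ) / 2) := by
    rw [← Real.mul_rpow (by norm_num) (by positivity)]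
    ring_nf
  have h5 : Real.exp (-‖z‖ ^ 2 / (2 * t)) * Real.exp (‖z‖ ^ 2 / (8 * t)) *
      Real.exp (‖z‖ ^ 2 / (8 * t)) = Real.exp (-‖z‖ ^ 2 / (2 * (2 * t))) := by
    rw [← Real.exp_add, ← Real.exp_add]
    congr 1
    field_simp
    ring
  have hg := gaussianKernel_pos ht z
  calc gaussianKernel t z * (1 + ‖z‖ ^ 2 / t) * Real.exp (‖z‖ ^ 2 / (8 * t))
      ≤ gaussianKernel t z * (8 * Real.exp (‖z‖ ^ 2 / (8 * t))) * Real.exp (‖z‖ ^ 2 / (8 * t)) := by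
        gcongr
    _ = 8 * 2 ^ ((d : ℝ) / 2) * gaussianKernel (2 * t) z := by
        unfold gaussianKernel
        rw [h4, ← h5]
        field_simp

theorem gaussianKernel_mul_one_add_le' (ht : 0 < t) (z : Rd d) :
    gaussianKernel t z * (1 + ‖z‖ ^ 2 / t) ≤ 8 * 2 ^ ((d : ℝ) / 2) * gaussianKernel (2 * t) z := by
  refine le_trans ?_ (gaussianKernel_mul_one_add_le ht z)
  have := gaussianKernel_pos ht z
  exact le_mul_of_one_le_right (by positivity) (Real.one_le_exp (by positivity))

/-- The radius beyond which a subgaussian vector with added Gaussian noise has mass `O(1 / n)`. -/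
noncomputable def cutoffRadius (d n : ℕ) (σ t : ℝ) : ℝ :=
  √((2 * d * σ ^ 2 + 16 * t) * Real.log n)

/-- Beyond the cutoff, either `y` or `y - x` is large, so the product of their exponential weights
is at least `n`. Inserting it gains `1/n`, at the price of the subgaussian moment of `y` and a
doubled kernel variance. -/
theorem gaussianKernel_tail_le (hd : 1 ≤ d) (hn : 2 ≤ n) (hσ : 0 < σ) (ht : 0 < t) {x : Rd d}
    (hx : cutoffRadius d n σ t < ‖x‖) (y : Rd d) :
    gaussianKernel t (y - x) * (1 + ‖y - x‖ ^ 2 / t) ≤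
      8 * 2 ^ ((d : ℝ) / 2) / n * Real.exp (‖y‖ ^ 2 / (d * σ ^ 2)) *
        gaussianKernel (2 * t) (y - x) := by
  have hd0 : (0 : ℝ) < d := by exact_mod_cast hd
  have hn0 : (0 : ℝ) < n := by positivity
  set A := 2 * d * σ ^ 2 + 16 * t with hA
  have hA0 : 0 < A := by positivity
  have hl := log_natCast_pos hn
  have h1 : A * Real.log n ≤ ‖x‖ ^ 2 := by
    have h2 := pow_le_pow_left₀ (Real.sqrt_nonneg _) hx.le 2
    rwa [Real.sq_sqrt (by positivity)] at h2
  have h2 : ‖x‖ ^ 2 ≤ 2 * ‖y‖ ^ 2 + 2 * ‖y - x‖ ^ 2 := by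
    have h3 : ‖x‖ ≤ ‖y‖ + ‖y - x‖ := by
      calc ‖x‖ = ‖y - (y - x)‖ := by rw [sub_sub_cancel]
        _ ≤ _ := norm_sub_le _ _
    nlinarith [norm_nonneg x, sq_nonneg (‖y‖ - ‖y - x‖)]
  have h3 : Real.log n ≤ ‖y‖ ^ 2 / (d * σ ^ 2) + ‖y - x‖ ^ 2 / (8 * t) := by
    have h4 : Real.log n ≤ (2 * ‖y‖ ^ 2 + 2 * ‖y - x‖ ^ 2) / A := by
      rw [le_div_iff₀ hA0]; linarith
    have h5 : 2 * ‖y‖ ^ 2 / A ≤ ‖y‖ ^ 2 / (d * σ ^ 2) := by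
      rw [div_le_div_iff₀ hA0 (by positivity)]
      have : 0 ≤ ‖y‖ ^ 2 * (16 * t) := by positivity
      rw [hA]; linarith
    have h6 : 2 * ‖y - x‖ ^ 2 / A ≤ ‖y - x‖ ^ 2 / (8 * t) := by
      rw [div_le_div_iff₀ hA0 (by positivity)]
      have : 0 ≤ ‖y - x‖ ^ 2 * (2 * d * σ ^ 2) := by positivity
      rw [hA]; linarith
    rw [add_div] at h4
    linarith
  have h4 : (n : ℝ) ≤ Real.exp (‖y‖ ^ 2 / (d * σ ^ 2)) * Real.exp (‖y - x‖ ^ 2 / (8 * t)) := by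
    rw [← Real.exp_add, ← Real.log_le_iff_le_exp hn0]; exact h3
  have hg := gaussianKernel_pos ht (y - x)
  have h5 := gaussianKernel_mul_one_add_le ht (y - x)
  calc gaussianKernel t (y - x) * (1 + ‖y - x‖ ^ 2 / t)
      = gaussianKernel t (y - x) * (1 + ‖y - x‖ ^ 2 / t) * (1 / n) * n := by field_simp
    _ ≤ gaussianKernel t (y - x) * (1 + ‖y - x‖ ^ 2 / t) * (1 / n) *
        (Real.exp (‖y‖ ^ 2 / (d * σ ^ 2)) * Real.exp (‖y - x‖ ^ 2 / (8 * t))) := by gcongr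
    _ = (1 / n * Real.exp (‖y‖ ^ 2 / (d * σ ^ 2))) * (gaussianKernel t (y - x) *
        (1 + ‖y - x‖ ^ 2 / t) * Real.exp (‖y - x‖ ^ 2 / (8 * t))) := by ring
    _ ≤ (1 / n * Real.exp (‖y‖ ^ 2 / (d * σ ^ 2))) *
        (8 * 2 ^ ((d : ℝ) / 2) * gaussianKernel (2 * t) (y - x)) := by gcongr
    _ = _ := by ring

theorem lintegral_gaussianKernel_tail_le (hd : 1 ≤ d) (hn : 2 ≤ n) (hσ : 0 < σ) (ht : 0 < t)
    (y : Rd d) :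
    ∫⁻ x in (Metric.closedBall 0 (cutoffRadius d n σ t))ᶜ,
      ENNReal.ofReal (gaussianKernel t (y - x) * (1 + ‖y - x‖ ^ 2 / t)) ≤
    ENNReal.ofReal (8 * 2 ^ ((d : ℝ) / 2) / n) *
      ENNReal.ofReal (Real.exp (‖y‖ ^ 2 / (d * σ ^ 2))) := by
  have hm : MeasurableSet (Metric.closedBall (0 : Rd d) (cutoffRadius d n σ t))ᶜ :=
    Metric.isClosed_closedBall.measurableSet.compl
  calc _ ≤ ∫⁻ x in (Metric.closedBall (0 : Rd d) (cutoffRadius d n σ t))ᶜ,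
        ENNReal.ofReal (8 * 2 ^ ((d : ℝ) / 2) / n * Real.exp (‖y‖ ^ 2 / (d * σ ^ 2))) *
        ENNReal.ofReal (gaussianKernel (2 * t) (y - x)) := by
        refine setLIntegral_mono' hm fun x hx => ?_
        rw [← ENNReal.ofReal_mul (by positivity)]
        refine ENNReal.ofReal_le_ofReal (gaussianKernel_tail_le hd hn hσ ht ?_ y)
        simpa using hx
    _ ≤ ∫⁻ x, ENNReal.ofReal (8 * 2 ^ ((d : ℝ) / 2) / n * Real.exp (‖y‖ ^ 2 / (d * σ ^ 2))) *
        ENNReal.ofReal (gaussianKernel (2 * t) (y - x)) := setLIntegral_le_lintegral _ _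
    _ = _ := by
        rw [lintegral_const_mul _ (by fun_prop),
          lintegral_gaussianKernel_sub_left (by positivity), mul_one,
          ENNReal.ofReal_mul (by positivity)]

theorem lintegral_pi_average {P : Measure (Rd d)} [IsProbabilityMeasure P] (hn : 1 ≤ n)
    {f : Rd d → ENNReal} (hf : Measurable f) :
    ∫⁻ X : Fin n → Rd d, ENNReal.ofReal (1 / n) * ∑ i, f (X i) ∂(Measure.pi fun _ => P) =
      ∫⁻ x, f x ∂P := by
  have hn0 : (n : ℝ) ≠ 0 := by positivity
  have hfi : ∀ i, Measurable fun X : Fin n → Rd d => f (X i) := fun i =>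
    hf.comp (measurable_pi_apply i)
  rw [lintegral_const_mul _ (Finset.measurable_fun_sum _ fun i _ => hfi i),
    lintegral_finsetSum _ fun i _ => hfi i]
  have h1 : ∀ i : Fin n, ∫⁻ X : Fin n → Rd d, f (X i) ∂(Measure.pi fun _ => P) =
      ∫⁻ x, f x ∂P := fun i =>
    (measurePreserving_eval (fun _ : Fin n => P) i).lintegral_comp hf
  simp_rw [h1]
  rw [Finset.sum_const, Finset.card_univ, Fintype.card_fin, nsmul_eq_mul, ← mul_assoc,
    ← ENNReal.ofReal_natCast, ← ENNReal.ofReal_mul (by positivity), one_div_mul_cancel hn0]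
  simp

theorem ofReal_pHat_add_kdeSq (ht : 0 < t) (X : Fin n → Rd d) (x : Rd d) :
    ENNReal.ofReal (pHat X t x + kdeSq X t x / t) = ENNReal.ofReal (1 / n) *
      ∑ i, ENNReal.ofReal (gaussianKernel t (X i - x) * (1 + ‖X i - x‖ ^ 2 / t)) := by
  have h := fun i => (gaussianKernel_pos ht (X i - x)).le
  rw [← ENNReal.ofReal_sum_of_nonneg fun i _ => by have := h i; positivity,
    ← ENNReal.ofReal_mul (by positivity)]
  congr 1
  unfold pHat kdeSq
  rw [mul_div_assoc, ← mul_add, Finset.sum_div, ← Finset.sum_add_distrib]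
  congr 1
  refine Finset.sum_congr rfl fun i _ => ?_
  ring

/-- The expected mass of the weighted density estimator outside the cutoff ball. -/
theorem lintegral_lintegral_tail_le (hd : 1 ≤ d) (hn : 2 ≤ n) (hσ : 0 < σ) (ht : 0 < t)
    {P : Measure (Rd d)} [IsProbabilityMeasure P] (hP : IsSubgaussian σ P) :
    ∫⁻ X : Fin n → Rd d, (∫⁻ x in (Metric.closedBall (0 : Rd d) (cutoffRadius d n σ t))ᶜ,
      ENNReal.ofReal (pHat X t x + kdeSq X t x / t)) ∂(Measure.pi fun _ => P) ≤
    ENNReal.ofReal (16 * 2 ^ ((d : ℝ) / 2) / n) := by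
  calc _ ≤ ∫⁻ X : Fin n → Rd d, ENNReal.ofReal (1 / n) * ∑ i,
        ENNReal.ofReal (8 * 2 ^ ((d : ℝ) / 2) / n) *
          ENNReal.ofReal (Real.exp (‖X i‖ ^ 2 / (d * σ ^ 2))) ∂(Measure.pi fun _ => P) := by
        refine lintegral_mono fun X => ?_
        simp_rw [ofReal_pHat_add_kdeSq ht]
        rw [lintegral_const_mul _ (by fun_prop), lintegral_finsetSum _ fun i _ => by fun_prop]
        gcongr with i
        exact lintegral_gaussianKernel_tail_le hd hn hσ ht (X i)
    _ = ∫⁻ y, ENNReal.ofReal (8 * 2 ^ ((d : ℝ) / 2) / n) *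
          ENNReal.ofReal (Real.exp (‖y‖ ^ 2 / (d * σ ^ 2))) ∂P :=
        lintegral_pi_average (by omega) (f := fun y => ENNReal.ofReal (8 * 2 ^ ((d : ℝ) / 2) / n) *
          ENNReal.ofReal (Real.exp (‖y‖ ^ 2 / (d * σ ^ 2)))) (by fun_prop)
    _ ≤ ENNReal.ofReal (8 * 2 ^ ((d : ℝ) / 2) / n) * 2 := by
        rw [lintegral_const_mul _ (by fun_prop)]
        gcongr
        exact lintegral_exp_sq_norm_le hd hP
    _ = _ := by
        rw [show (2 : ENNReal) = ENNReal.ofReal 2 by simp, ← ENNReal.ofReal_mul (by positivity)]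
        congr 1
        ring

theorem volume_closedBall_cutoffRadius_eq (hn : 2 ≤ n) (ht : 0 ≤ t) :
    volume (Metric.closedBall (0 : Rd d) (cutoffRadius d n σ t)) =
      ENNReal.ofReal (((2 * d * σ ^ 2 + 16 * t) * Real.log n) ^ ((d : ℝ) / 2)) *
        volume (Metric.ball (0 : Rd d) 1) := by
  have hl := log_natCast_pos hn
  rw [cutoffRadius, Measure.addHaar_closedBall _ _ (Real.sqrt_nonneg _), finrank_euclideanSpace, Fintype.card_fin]
  congr 2
  rw [Real.sqrt_eq_rpow, ← Real.rpow_natCast, ← Real.rpow_mul (by positivity)]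
  ring_nf

end Tails


/-! ### Exponents of the bandwidth -/

section Rates

variable {d n : ℕ} {β : ℝ}

theorem natCast_rpow_neg_le_one (hn : 1 ≤ n) {s : ℝ} (hs : 0 ≤ s) : (n : ℝ) ^ (-s) ≤ 1 :=
  Real.rpow_le_one_of_one_le_of_nonpos (by exact_mod_cast hn) (by linarith)

/-- The variance at bandwidth `τ = n^{-2/(d+2β)}` is of order `ρ²`. Together with
`bandwidth_rpow_half_smoothness`, where the bias is `ρ`, this is the bias–variance balance. -/
theorem bandwidth_rpow_half_dim (hβ : 0 < β) (hn : 1 ≤ n) :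
    1 / (n * ((n : ℝ) ^ (-(2 / (d + 2 * β)))) ^ ((d : ℝ) / 2)) =
      (n : ℝ) ^ (-(β / (d + 2 * β))) * (n : ℝ) ^ (-(β / (d + 2 * β))) := by
  have hn0 : (0 : ℝ) < n := by exact_mod_cast hn
  have hD : (d : ℝ) + 2 * β ≠ 0 := by positivity
  rw [← Real.rpow_mul hn0.le, ← Real.rpow_add hn0]
  conv_lhs => rw [← Real.rpow_one_add' hn0.le (by
    have : 1 + -(2 / ((d : ℝ) + 2 * β)) * (d / 2) = 2 * β / (d + 2 * β) := by field_simp; ring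
    rw [this]; positivity)]
  rw [one_div, ← Real.rpow_neg hn0.le]
  congr 1
  field_simp
  ring

theorem bandwidth_rpow_half_smoothness (n : ℕ) :
    ((n : ℝ) ^ (-(2 / (d + 2 * β)))) ^ (β / 2) = (n : ℝ) ^ (-(β / (d + 2 * β))) := by
  rw [← Real.rpow_mul (Nat.cast_nonneg n)]
  congr 1
  ring

theorem one_div_natCast_le_rate (hβ : 0 < β) (hn : 1 ≤ n) :
    1 / (n : ℝ) ≤ (n : ℝ) ^ (-(β / (d + 2 * β))) := by
  have hn0 : (1 : ℝ) ≤ n := by exact_mod_cast hn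
  rw [one_div, ← Real.rpow_neg_one]
  refine Real.rpow_le_rpow_of_exponent_le hn0 (neg_le_neg ?_)
  rw [div_le_one (by positivity)]
  have : (0 : ℝ) ≤ d := Nat.cast_nonneg d
  linarith

theorem exists_log_rpow_le {s r : ℝ} (hs : 0 < s) (hr : 0 < r) :
    ∃ C : ℝ, 0 < C ∧ ∀ n : ℕ, 1 ≤ n → Real.log n ^ s ≤ C * (n : ℝ) ^ r := by
  refine ⟨(1 / (r / s)) ^ s, by positivity, fun n hn => ?_⟩
  have hn0 : (0 : ℝ) ≤ n := Nat.cast_nonneg n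
  have h := Real.log_natCast_le_rpow_div n (ε := r / s) (by positivity)
  calc Real.log n ^ s ≤ ((n : ℝ) ^ (r / s) / (r / s)) ^ s := by
        gcongr
    _ = (1 / (r / s) * (n : ℝ) ^ (r / s)) ^ s := by ring_nf
    _ = _ := by
        rw [Real.mul_rpow (by positivity) (by positivity), ← Real.rpow_mul hn0,
          div_mul_cancel₀ _ hs.ne']

end Rates

/-! ### Mass of the thresholded region -/

section ThresholdedRegion

variable {d n : ℕ} {t σ : ℝ}

theorem thresholdedDensity_le (hn : 2 ≤ n) (ht : 0 < t) (X : Fin n → Rd d) (x : Rd d) :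
    thresholdedDensity X t x ≤
      16 * Real.log n ^ 2 / (n * (2 * Real.pi * t) ^ ((d : ℝ) / 2)) := by
  have hl := half_le_log_natCast hn
  have hn0 : (0 : ℝ) < n := by positivity
  unfold thresholdedDensity
  split_ifs with h
  swap
  · positivity
  have h1 := kdeSq_div_le (by omega : 1 ≤ n) ht X x
  have e : threshold d n t = Real.log n * (1 / (n * (2 * Real.pi * t) ^ ((d : ℝ) / 2))) := by
    unfold threshold; ring
  rw [e] at h
  have e2 : 16 * Real.log n ^ 2 / (n * (2 * Real.pi * t) ^ ((d : ℝ) / 2)) =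
    16 * Real.log n ^ 2 * (1 / (n * (2 * Real.pi * t) ^ ((d : ℝ) / 2))) := by ring
  have e3 : 4 / (n * (2 * Real.pi * t) ^ ((d : ℝ) / 2)) =
    4 * (1 / (n * (2 * Real.pi * t) ^ ((d : ℝ) / 2))) := by ring
  rw [e2]
  rw [e3] at h1
  set y := 1 / (n * (2 * Real.pi * t) ^ ((d : ℝ) / 2)) with hy
  have hy0 : 0 < y := by positivity
  have h2 : 4 * Real.log n * pHat X t x ≤ 4 * Real.log n * (Real.log n * y) := by gcongr
  have h3 : Real.log n + 4 + 4 * Real.log n ^ 2 ≤ 16 * Real.log n ^ 2 := by nlinarith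
  have h4 : (Real.log n + 4 + 4 * Real.log n ^ 2) * y ≤ 16 * Real.log n ^ 2 * y := by gcongr
  linarith

theorem thresholdedDensity_le_add (ht : 0 < t) (X : Fin n → Rd d) (x : Rd d) :
    thresholdedDensity X t x ≤ pHat X t x + kdeSq X t x / t := by
  unfold thresholdedDensity
  split_ifs
  · exact le_rfl
  · have h1 := kdeSq_nonneg ht X x
    have h2 : 0 ≤ pHat X t x := by
      unfold pHat
      exact mul_nonneg (by positivity)
        (Finset.sum_nonneg fun i _ => (gaussianKernel_pos ht _).le)
    positivity

/-- The thresholded region has negligible expected mass, uniformly over noise levels above the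
bandwidth. -/
theorem exists_lintegral_thresholdedDensity_le (hd : 1 ≤ d) {β : ℝ} (hβ : 0 < β) (hσ : 0 < σ) :
    ∃ C : ℝ, 0 < C ∧ ∀ P : Measure (Rd d), IsProbabilityMeasure P → IsSubgaussian σ P →
      ∀ n : ℕ, 2 ≤ n → ∀ t : ℝ, (n : ℝ) ^ (-(2 / (d + 2 * β))) ≤ t →
      ∫⁻ X : Fin n → Rd d, (∫⁻ x, ENNReal.ofReal (thresholdedDensity X t x))
        ∂(Measure.pi fun _ => P) ≤ ENNReal.ofReal (C * (n : ℝ) ^ (-(β / (d + 2 * β)))) := by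
  obtain ⟨L, hL0, hL⟩ := exists_log_rpow_le (s := 2 + d / 2) (r := β / (d + 2 * β))
    (by positivity) (by positivity)
  set v := (volume (Metric.ball (0 : Rd d) 1)).toReal with hv
  have hvol : volume (Metric.ball (0 : Rd d) 1) = ENNReal.ofReal v :=
    (ENNReal.ofReal_toReal measure_ball_lt_top.ne).symm
  set D := 2 * d * σ ^ 2 + 16 with hD
  have hv0 : 0 ≤ v := ENNReal.toReal_nonneg
  have hD0 : 0 < D := by positivity
  refine ⟨16 * D ^ ((d : ℝ) / 2) * v * L + 16 * 2 ^ ((d : ℝ) / 2), by positivity,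
    fun P hPp hP n hn t htτ => ?_⟩
  have hn0 : (0 : ℝ) < n := by positivity
  set τ := (n : ℝ) ^ (-(2 / (d + 2 * β))) with hτ
  have hτ0 : 0 < τ := by positivity
  have hτ1 : τ ≤ 1 := natCast_rpow_neg_le_one (by omega) (by positivity)
  have ht : 0 < t := hτ0.trans_le htτ
  have hl := log_natCast_pos hn
  set ρ := (n : ℝ) ^ (-(β / (d + 2 * β))) with hρ
  have hρ0 : 0 < ρ := by positivity
  set R := cutoffRadius d n σ t with hR
  have hb : MeasurableSet (Metric.closedBall (0 : Rd d) R) :=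
    Metric.isClosed_closedBall.measurableSet
  set M := 16 * Real.log n ^ 2 / (n * (2 * Real.pi * t) ^ ((d : ℝ) / 2)) with hM
  have hM0 : 0 ≤ M := by positivity
  have h1 : ∀ X : Fin n → Rd d, ∫⁻ x, ENNReal.ofReal (thresholdedDensity X t x) ≤
      ENNReal.ofReal M * volume (Metric.closedBall (0 : Rd d) R) +
      ∫⁻ x in (Metric.closedBall (0 : Rd d) R)ᶜ,
        ENNReal.ofReal (pHat X t x + kdeSq X t x / t) := by
    intro X
    rw [← lintegral_add_compl _ hb]
    refine add_le_add ?_ ?_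
    · rw [← setLIntegral_const]
      exact lintegral_mono fun x => ENNReal.ofReal_le_ofReal (thresholdedDensity_le hn ht X x)
    · exact lintegral_mono fun x => ENNReal.ofReal_le_ofReal (thresholdedDensity_le_add ht X x)
  have h2 : M * (((2 * d * σ ^ 2 + 16 * t) * Real.log n) ^ ((d : ℝ) / 2) * v) ≤
      16 * D ^ ((d : ℝ) / 2) * v * L * ρ := by
    -- The ball's volume grows with `t` and the kernel normalization shrinks with it; their ratio is
    -- worst at `t = τ`, which gives uniformity in `t ≥ τ`.
    have h3 : (2 * d * σ ^ 2 + 16 * t) * Real.log n ≤ 2 * Real.pi * t * (D * Real.log n / τ) := by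
      have h4 : 2 * d * σ ^ 2 + 16 * t ≤ t * (D / τ) := by
        have h5 : 2 * d * σ ^ 2 ≤ t * (2 * d * σ ^ 2 / τ) := by
          rw [mul_div_assoc', le_div_iff₀ hτ0, mul_comm t]
          gcongr
        have h6 : 16 * t ≤ t * (16 / τ) := by
          rw [mul_comm]
          gcongr
          rw [le_div_iff₀ hτ0]; linarith
        rw [hD, add_div, mul_add]
        linarith
      calc (2 * d * σ ^ 2 + 16 * t) * Real.log n ≤ t * (D / τ) * Real.log n := by gcongr
        _ = 1 * (t * (D * Real.log n / τ)) := by ring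
        _ ≤ (2 * Real.pi) * (t * (D * Real.log n / τ)) := by
          gcongr
          linarith [Real.pi_gt_three]
        _ = _ := by ring
    calc M * (((2 * d * σ ^ 2 + 16 * t) * Real.log n) ^ ((d : ℝ) / 2) * v)
        ≤ M * ((2 * Real.pi * t * (D * Real.log n / τ)) ^ ((d : ℝ) / 2) * v) := by gcongr
      _ = 16 * D ^ ((d : ℝ) / 2) * v * (Real.log n ^ ((d : ℝ) / 2) * Real.log n ^ 2) *
          (1 / (n * τ ^ ((d : ℝ) / 2))) := by
        rw [Real.mul_rpow (x := 2 * Real.pi * t) (by positivity) (by positivity),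
          Real.div_rpow (by positivity) (by positivity),
          Real.mul_rpow (x := D) (by positivity) (by positivity), hM]
        field_simp
      _ = 16 * D ^ ((d : ℝ) / 2) * v * Real.log n ^ (2 + (d : ℝ) / 2) * (ρ * ρ) := by
        rw [bandwidth_rpow_half_dim hβ (by omega), add_comm (2 : ℝ), Real.rpow_add hl,
          Real.rpow_two]
      -- The bound is `ρ²` up to logarithms, so one factor `ρ` is spent to absorb all powers of `log
      -- n`.
      _ ≤ 16 * D ^ ((d : ℝ) / 2) * v * (L * (n : ℝ) ^ (β / (d + 2 * β))) * (ρ * ρ) := by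
        gcongr
        exact hL n (by omega)
      _ = 16 * D ^ ((d : ℝ) / 2) * v * L * ρ * ((n : ℝ) ^ (β / (d + 2 * β)) * ρ) := by ring
      _ = _ := by
        rw [hρ, ← Real.rpow_add hn0, add_neg_cancel, Real.rpow_zero, mul_one]
  have h3 : 16 * 2 ^ ((d : ℝ) / 2) / n ≤ 16 * 2 ^ ((d : ℝ) / 2) * ρ := by
    rw [div_eq_mul_one_div]
    gcongr
    exact one_div_natCast_le_rate hβ (by omega)
  calc _ ≤ ∫⁻ X : Fin n → Rd d, (ENNReal.ofReal M * volume (Metric.closedBall (0 : Rd d) R) +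
      ∫⁻ x in (Metric.closedBall (0 : Rd d) R)ᶜ,
        ENNReal.ofReal (pHat X t x + kdeSq X t x / t)) ∂(Measure.pi fun _ => P) :=
        lintegral_mono h1
    _ = ENNReal.ofReal M * volume (Metric.closedBall (0 : Rd d) R) +
        ∫⁻ X : Fin n → Rd d, (∫⁻ x in (Metric.closedBall (0 : Rd d) R)ᶜ,
        ENNReal.ofReal (pHat X t x + kdeSq X t x / t)) ∂(Measure.pi fun _ => P) := by
        rw [lintegral_add_left measurable_const]
        simp
    _ ≤ ENNReal.ofReal (16 * D ^ ((d : ℝ) / 2) * v * L * ρ) +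
        ENNReal.ofReal (16 * 2 ^ ((d : ℝ) / 2) * ρ) := by
        refine add_le_add ?_ ?_
        · rw [hR, volume_closedBall_cutoffRadius_eq hn ht.le, hvol,
            ← ENNReal.ofReal_mul (by positivity), ← ENNReal.ofReal_mul hM0]
          exact ENNReal.ofReal_le_ofReal h2
        · exact (lintegral_lintegral_tail_le hd hn hσ ht hP).trans (ENNReal.ofReal_le_ofReal h3)
    _ = _ := by
        rw [← ENNReal.ofReal_add (by positivity) (by positivity)]
        ring_nf

end ThresholdedRegion


/-! ### Bias of Gaussian smoothing for Hölder densities -/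

section Bias

variable {d : ℕ} {β L t : ℝ} {p : Rd d → ℝ}

theorem abs_fderiv_sub_le {p : Rd d → ℝ} {x y : Rd d} {M : ℝ}
    (h : ∀ i : Fin d, |partialDeriv (fun _ : Fin 1 => i) p x -
      partialDeriv (fun _ : Fin 1 => i) p y| ≤ M) (v : Rd d) :
    |fderiv ℝ p x v - fderiv ℝ p y v| ≤ d * M * ‖v‖ := by
  have h1 : ∀ z : Rd d, fderiv ℝ p z v =
      ∑ i, v i * partialDeriv (fun _ : Fin 1 => i) p z := fun z => by
    conv_lhs => rw [← (EuclideanSpace.basisFun (Fin d) ℝ).sum_repr v]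
    rw [map_sum]
    refine Finset.sum_congr rfl fun i _ => ?_
    rw [partialDeriv, iteratedFDeriv_one_apply, map_smul]
    simp
  rw [h1, h1, ← Finset.sum_sub_distrib]
  calc |∑ i, (v i * partialDeriv (fun _ : Fin 1 => i) p x -
        v i * partialDeriv (fun _ : Fin 1 => i) p y)|
      ≤ ∑ i : Fin d, ‖v‖ * M := by
        refine (Finset.abs_sum_le_sum_abs _ _).trans (Finset.sum_le_sum fun i _ => ?_)
        rw [← mul_sub, abs_mul]
        gcongr
        · exact PiLp.norm_apply_le v i
        · exact h i
    _ = _ := by simp; ring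

/-- The symmetric second difference of a `β`-Hölder function, `β ≤ 2`. -/
theorem abs_second_difference_le (hd : 1 ≤ d) (hβ : 0 < β) (hβ2 : β ≤ 2) (hL : 0 < L)
    (hp : IsHolderSmooth β L p) (x z : Rd d) :
    |p (x + z) + p (x - z) - 2 * p x| ≤ 4 * d * L * ‖z‖ ^ β := by
  have hd0 : (1 : ℝ) ≤ d := by exact_mod_cast hd
  rcases le_or_gt β 1 with h1 | h1
  · have hm : strictFloor β = 0 := by
      have : ⌈β⌉₊ ≤ 1 := Nat.ceil_le.2 (by simpa using h1)
      unfold strictFloor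
      omega
    have h2 := fun x x' => hp.2 0 (by omega) (fun i => i.elim0) x x'
    simp only [partialDeriv, iteratedFDeriv_zero_apply, hm, Nat.cast_zero, sub_zero] at h2
    have h3 := h2 (x + z) x
    have h4 := h2 (x - z) x
    simp only [add_sub_cancel_left, sub_sub_cancel_left, norm_neg] at h3 h4
    have h5 : 0 ≤ L * ‖z‖ ^ β := by positivity
    calc |p (x + z) + p (x - z) - 2 * p x|
        = |(p (x + z) - p x) + (p (x - z) - p x)| := by ring_nf
      _ ≤ 2 * (L * ‖z‖ ^ β) := (abs_add_le _ _).trans (by linarith)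
      _ ≤ 4 * d * (L * ‖z‖ ^ β) := by nlinarith
      _ = _ := by ring
  · have hm : strictFloor β = 1 := by
      have h2 : ⌈β⌉₊ ≤ 2 := Nat.ceil_le.2 (by simpa using hβ2)
      have h3 : 1 < ⌈β⌉₊ := Nat.lt_ceil.2 (by simpa using h1)
      unfold strictFloor
      omega
    have hdiff : Differentiable ℝ p := by
      have h2 := hp.1 0 (by omega)
      rw [iteratedFDeriv_zero_eq_comp] at h2
      exact (LinearIsometryEquiv.comp_differentiable_iff _).1 h2
    -- For `1 < β ≤ 2` the mean value inequality is applied to the symmetrized function, whose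
    -- derivative is a difference of gradients at distance `2 s ‖z‖`. This gains the exponent `β -
    -- 1`.
    set g : ℝ → ℝ := fun s => p (x + s • z) + p (x - s • z) with hg
    set g' : ℝ → ℝ := fun s => fderiv ℝ p (x + s • z) z - fderiv ℝ p (x - s • z) z with hg'
    have hgd : ∀ s, HasDerivAt g (g' s) s := by
      intro s
      have hs : HasDerivAt (fun s : ℝ => s • z) z s := by
        simpa using (hasDerivAt_id s).smul_const z
      have h3 := (hdiff (x + s • z)).hasFDerivAt.comp_hasDerivAt s (hs.const_add x)
      have h4 := (hdiff (x - s • z)).hasFDerivAt.comp_hasDerivAt s (hs.const_sub x)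
      have h5 := h3.add h4
      rw [map_neg, ← sub_eq_add_neg] at h5
      exact h5
    have hb : ∀ s ∈ Set.Ico (0 : ℝ) 1, ‖g' s‖ ≤ 4 * d * L * ‖z‖ ^ β := by
      intro s hs
      have h3 : ‖(x + s • z) - (x - s • z)‖ ≤ 2 * ‖z‖ := by
        have : (x + s • z) - (x - s • z) = (2 * s) • z := by
          rw [mul_smul, two_smul]; abel
        rw [this, norm_smul, Real.norm_of_nonneg (by linarith [hs.1])]
        gcongr
        linarith [hs.2]
      have h4 : ∀ i : Fin d, |partialDeriv (fun _ : Fin 1 => i) p (x + s • z) -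
          partialDeriv (fun _ : Fin 1 => i) p (x - s • z)| ≤ L * (2 * ‖z‖) ^ (β - 1) := by
        intro i
        have h5 := hp.2 1 (by omega) (fun _ => i) (x + s • z) (x - s • z)
        rw [hm, Nat.cast_one] at h5
        refine h5.trans ?_
        gcongr
      refine (abs_fderiv_sub_le h4 z).trans ?_
      have h5 : (2 * ‖z‖) ^ (β - 1) * ‖z‖ ≤ 4 * ‖z‖ ^ β := by
        rw [Real.mul_rpow (by norm_num) (norm_nonneg _), mul_assoc]
        have h6 : ‖z‖ ^ (β - 1) * ‖z‖ = ‖z‖ ^ β := by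
          conv_lhs => rw [← Real.rpow_add_one' (norm_nonneg _) (by simpa using hβ.ne')]
          simp
        rw [h6]
        gcongr
        calc (2 : ℝ) ^ (β - 1) ≤ 2 ^ (2 : ℝ) :=
              Real.rpow_le_rpow_of_exponent_le (by norm_num) (by linarith)
          _ = 4 := by norm_num
      calc d * (L * (2 * ‖z‖) ^ (β - 1)) * ‖z‖ = d * L * ((2 * ‖z‖) ^ (β - 1) * ‖z‖) := by ring
        _ ≤ d * L * (4 * ‖z‖ ^ β) := by gcongr
        _ = _ := by ring
    have h3 := norm_image_sub_le_of_norm_deriv_le_segment_01'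
      (fun s _ => (hgd s).hasDerivWithinAt) hb
    simp only [hg, one_smul, zero_smul, add_zero, sub_zero] at h3
    rwa [Real.norm_eq_abs, show p (x + z) + p (x - z) - (p x + p x) =
      p (x + z) + p (x - z) - 2 * p x by ring] at h3

/-- The density of `P ∗ N(0, t I)`. -/
noncomputable def smoothedDensity (P : Measure (Rd d)) (t : ℝ) (x : Rd d) : ℝ :=
  ∫ y, gaussianKernel t (y - x) ∂P

theorem integrable_of_isDensity (hp : IsDensity p) : Integrable p := by
  have h := hp.2.2.measure_univ
  rw [lawOfDensity, withDensity_apply _ .univ, Measure.restrict_univ] at h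
  refine ⟨hp.1.aestronglyMeasurable, ?_⟩
  rw [hasFiniteIntegral_iff_ofReal (Filter.Eventually.of_forall hp.2.1), h]
  simp

theorem smoothedDensity_eq (hp : IsDensity p) (t : ℝ) (x : Rd d) :
    smoothedDensity (lawOfDensity p) t x = ∫ z, gaussianKernel t z * p (x + z) := by
  rw [smoothedDensity, lawOfDensity, integral_withDensity_eq_integral_toReal_smul
    hp.1.ennreal_ofReal (by simp), ← integral_add_left_eq_self _ x]
  refine integral_congr_ae (Filter.Eventually.of_forall fun z => ?_)
  simp only [add_sub_cancel_left, smul_eq_mul]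
  rw [ENNReal.toReal_ofReal (hp.2.1 _), mul_comm]

/-- Scaling by `√t` and `r^{β/2} ≤ 1 + r`. The fractional moment becomes a quadratic weight, which a
kernel of doubled variance absorbs. -/
theorem norm_rpow_le (ht : 0 < t) (hβ : 0 < β) (hβ2 : β ≤ 2) (z : Rd d) :
    ‖z‖ ^ β ≤ t ^ (β / 2) * (1 + ‖z‖ ^ 2 / t) := by
  have h1 : ‖z‖ ^ β = t ^ (β / 2) * (‖z‖ ^ 2 / t) ^ (β / 2) := by
    rw [← Real.mul_rpow ht.le (by positivity), mul_div_cancel₀ _ ht.ne', ← Real.rpow_natCast,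
      ← Real.rpow_mul (norm_nonneg _)]
    congr 1
    push_cast
    ring
  rw [h1]
  gcongr
  rcases le_total (‖z‖ ^ 2 / t) 1 with h | h
  · have : (‖z‖ ^ 2 / t) ^ (β / 2) ≤ 1 := Real.rpow_le_one (by positivity) h (by positivity)
    have : 0 ≤ ‖z‖ ^ 2 / t := by positivity
    linarith
  · have : (‖z‖ ^ 2 / t) ^ (β / 2) ≤ (‖z‖ ^ 2 / t) ^ (1 : ℝ) :=
      Real.rpow_le_rpow_of_exponent_le h (by linarith)
    rw [Real.rpow_one] at this
    linarith

/-- The kernel is even, so the bias is half the average of the symmetric second difference. This is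
why no higher-order kernel is needed for `β ≤ 2`. -/
theorem abs_smoothedDensity_sub_le (hd : 1 ≤ d) (hβ : 0 < β) (hβ2 : β ≤ 2) (hL : 0 < L)
    (ht : 0 < t) (hp : IsDensity p) (hps : IsHolderSmooth β L p) (x : Rd d) :
    |smoothedDensity (lawOfDensity p) t x - p x| ≤
      16 * d * L * 2 ^ ((d : ℝ) / 2) * t ^ (β / 2) := by
  have hpi := integrable_of_isDensity hp
  have hb : ∀ᵐ z : Rd d, ‖gaussianKernel t z‖ ≤ 1 / (2 * Real.pi * t) ^ ((d : ℝ) / 2) :=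
    Filter.Eventually.of_forall fun z => by
      rw [Real.norm_of_nonneg (gaussianKernel_pos ht z).le]
      exact gaussianKernel_le ht z
  have hgm : AEStronglyMeasurable (gaussianKernel (d := d) t) :=
    (measurable_gaussianKernel t).aestronglyMeasurable
  have i1 : Integrable fun z => gaussianKernel t z * p (x + z) :=
    (hpi.comp_add_left x).bdd_mul hgm hb
  have i2 : Integrable fun z => gaussianKernel t z * p (x - z) :=
    (hpi.comp_sub_left x).bdd_mul hgm hb
  have i4 : Integrable fun z => gaussianKernel t z * p (x + z) + gaussianKernel t z * p (x - z) :=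
    i1.add i2
  have i3 : Integrable fun z : Rd d => gaussianKernel t z * (2 * p x) :=
    (integrable_gaussianKernel ht).mul_const _
  have e2 : ∫ z, gaussianKernel t z * p (x - z) = ∫ z, gaussianKernel t z * p (x + z) := by
    rw [← integral_neg_eq_self]
    simp [gaussianKernel_neg]
  have e3 : 2 * (smoothedDensity (lawOfDensity p) t x - p x) =
      ∫ z, gaussianKernel t z * (p (x + z) + p (x - z) - 2 * p x) := by
    simp_rw [mul_sub, mul_add]
    rw [integral_sub i4 i3, integral_add i1 i2, e2, smoothedDensity_eq hp]
    rw [integral_mul_const, integral_gaussianKernel ht]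
    ring
  have e4 : ‖∫ z, gaussianKernel t z * (p (x + z) + p (x - z) - 2 * p x)‖ ≤
      ∫ z : Rd d, 4 * d * L * t ^ (β / 2) * (8 * 2 ^ ((d : ℝ) / 2)) * gaussianKernel (2 * t) z := by
    refine norm_integral_le_of_norm_le
      ((integrable_gaussianKernel (by positivity)).const_mul _)
      (Filter.Eventually.of_forall fun z => ?_)
    have hg := gaussianKernel_pos ht z
    rw [norm_mul, Real.norm_of_nonneg hg.le, Real.norm_eq_abs]
    calc gaussianKernel t z * |p (x + z) + p (x - z) - 2 * p x|
        ≤ gaussianKernel t z * (4 * d * L * (t ^ (β / 2) * (1 + ‖z‖ ^ 2 / t))) := by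
          gcongr
          refine (abs_second_difference_le hd hβ hβ2 hL hps x z).trans ?_
          gcongr
          exact norm_rpow_le ht hβ hβ2 z
      _ = 4 * d * L * t ^ (β / 2) * (gaussianKernel t z * (1 + ‖z‖ ^ 2 / t)) := by ring
      _ ≤ 4 * d * L * t ^ (β / 2) * (8 * 2 ^ ((d : ℝ) / 2) * gaussianKernel (2 * t) z) :=
          mul_le_mul_of_nonneg_left (gaussianKernel_mul_one_add_le' ht z) (by positivity)
      _ = _ := by ring
  rw [← e3, integral_const_mul, integral_gaussianKernel (by positivity), norm_mul,
    Real.norm_eq_abs, Real.norm_eq_abs, abs_two] at e4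
  linarith

end Bias


/-! ### Integrated risk of the kernel density estimator -/

section KernelDensityRisk

variable {d n : ℕ} {β L t σ : ℝ} {P : Measure (Rd d)}

theorem integrable_gaussianKernel_sub [IsProbabilityMeasure P] (ht : 0 < t) (x : Rd d) :
    Integrable (fun y => gaussianKernel t (y - x)) P :=
  Integrable.of_bound (Measurable.aestronglyMeasurable (by fun_prop))
    (1 / (2 * Real.pi * t) ^ ((d : ℝ) / 2)) (Filter.Eventually.of_forall fun y => by
      rw [Real.norm_of_nonneg (gaussianKernel_pos ht _).le]
      exact gaussianKernel_le ht _)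

theorem smoothedDensity_nonneg (ht : 0 < t) (x : Rd d) : 0 ≤ smoothedDensity P t x :=
  integral_nonneg fun _ => (gaussianKernel_pos ht _).le

theorem ofReal_smoothedDensity [IsProbabilityMeasure P] (ht : 0 < t) (x : Rd d) :
    ENNReal.ofReal (smoothedDensity P t x) = ∫⁻ y, ENNReal.ofReal (gaussianKernel t (y - x)) ∂P :=
  ofReal_integral_eq_lintegral_ofReal (integrable_gaussianKernel_sub ht x)
    (Filter.Eventually.of_forall fun _ => (gaussianKernel_pos ht _).le)

theorem measurable_gaussianKernel_sub_uncurry (t : ℝ) :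
    Measurable (Function.uncurry fun x y : Rd d => ENNReal.ofReal (gaussianKernel t (y - x))) := by
  unfold Function.uncurry
  fun_prop

theorem measurable_ofReal_smoothedDensity [IsProbabilityMeasure P] (ht : 0 < t) :
    Measurable fun x => ENNReal.ofReal (smoothedDensity P t x) := by
  simp_rw [ofReal_smoothedDensity ht]
  exact (measurable_gaussianKernel_sub_uncurry t).lintegral_prod_right'

theorem measurable_smoothedDensity [IsProbabilityMeasure P] (ht : 0 < t) :
    Measurable fun x => smoothedDensity P t x := by
  have h := (measurable_ofReal_smoothedDensity (P := P) ht).ennreal_toReal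
  simpa only [ENNReal.toReal_ofReal (smoothedDensity_nonneg ht _)] using h

theorem lintegral_smoothedDensity [IsProbabilityMeasure P] (ht : 0 < t) :
    ∫⁻ x, ENNReal.ofReal (smoothedDensity P t x) = 1 := by
  simp_rw [ofReal_smoothedDensity ht]
  rw [lintegral_lintegral_swap (measurable_gaussianKernel_sub_uncurry t).aemeasurable]
  simp_rw [lintegral_gaussianKernel_sub_left ht]
  simp

/-- The kernel density estimator has variance of order `1 / (n t^{d/2})`. -/
theorem lintegral_sq_pHat_sub_le [IsProbabilityMeasure P] (hn : 1 ≤ n) (ht : 0 < t) (x : Rd d) :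
    ∫⁻ X : Fin n → Rd d, ENNReal.ofReal ((pHat X t x - smoothedDensity P t x) ^ 2)
      ∂(Measure.pi fun _ => P) ≤
    ENNReal.ofReal (1 / (n * (2 * Real.pi * t) ^ ((d : ℝ) / 2)) * smoothedDensity P t x) := by
  have hn0 : (0 : ℝ) < n := by exact_mod_cast hn
  set Z := (2 * Real.pi * t) ^ ((d : ℝ) / 2) with hZ
  have hZ0 : 0 < Z := by positivity
  set s := smoothedDensity P t x with hs
  set g : Rd d → ℝ := fun y => gaussianKernel t (y - x) with hg
  have hgm : Measurable g := by fun_prop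
  have hgb : ∀ y, ‖g y‖ ≤ 1 / Z := fun y => by
    rw [Real.norm_of_nonneg (gaussianKernel_pos ht _).le]
    exact gaussianKernel_le ht _
  set g1 : Rd d → ℝ := fun y => 1 / (n : ℝ) * g y with hg1
  have hg1m : Measurable g1 := by fun_prop
  have hmem : MemLp g1 2 P := by
    refine MemLp.of_bound hg1m.aestronglyMeasurable (1 / n * (1 / Z))
      (Filter.Eventually.of_forall fun y => ?_)
    rw [norm_mul, Real.norm_of_nonneg (by positivity)]
    gcongr
    exact hgb y
  have hvar := variance_sum_pi (μ := fun _ : Fin n => P) (X := fun _ => g1) fun _ => hmem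
  have e' : (fun X : Fin n → Rd d => pHat X t x) = fun X => ∑ i, g1 (X i) := by
    funext X
    rw [← Finset.mul_sum]
    rfl
  have e : (∑ i, fun X : Fin n → Rd d => g1 (X i)) = fun X => pHat X t x := by
    rw [e']
    funext X
    rw [Finset.sum_apply]
  rw [e] at hvar
  have hpm : Measurable fun X : Fin n → Rd d => pHat X t x := by
    rw [e']
    exact Finset.measurable_fun_sum _ fun i _ => hg1m.comp (measurable_pi_apply i)
  have hmean : ∫ X : Fin n → Rd d, pHat X t x ∂(Measure.pi fun _ => P) = s := by
    rw [e']
    have hi : ∀ i : Fin n, Integrable (fun X : Fin n → Rd d => g1 (X i)) (Measure.pi fun _ => P) :=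
      fun i => (measurePreserving_eval (fun _ : Fin n => P) i).integrable_comp_of_integrable
        (hmem.integrable one_le_two)
    rw [integral_finsetSum _ fun i _ => hi i]
    have hi2 : ∀ i : Fin n, ∫ X : Fin n → Rd d, g1 (X i) ∂(Measure.pi fun _ => P) =
        ∫ y, g1 y ∂P := fun i =>
      integral_comp_eval (μ := fun _ : Fin n => P) hg1m.aestronglyMeasurable
    simp_rw [hi2]
    rw [Finset.sum_const, Finset.card_univ, Fintype.card_fin, nsmul_eq_mul, hg1,
      integral_const_mul, ← mul_assoc, mul_one_div_cancel hn0.ne', one_mul]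
    rfl
  have hv1 : Var[g1; P] ≤ 1 / (n : ℝ) ^ 2 * (1 / Z * s) := by
    rw [hg1, variance_const_mul, one_div_pow]
    gcongr
    refine (variance_le_expectation_sq hgm.aestronglyMeasurable).trans ?_
    rw [hs, smoothedDensity, ← integral_const_mul]
    refine integral_mono_of_nonneg (Filter.Eventually.of_forall fun y => sq_nonneg _)
      ((integrable_gaussianKernel_sub ht x).const_mul _) (Filter.Eventually.of_forall fun y => ?_)
    have h1 := gaussianKernel_pos ht (y - x)
    have h2 := gaussianKernel_le ht (y - x)
    simp only [Pi.pow_apply, sq, hg]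
    gcongr
  have hmemS : MemLp (fun X : Fin n → Rd d => pHat X t x) 2 (Measure.pi fun _ => P) := by
    refine MemLp.of_bound hpm.aestronglyMeasurable (1 / Z) (Filter.Eventually.of_forall fun X => ?_)
    unfold pHat
    rw [norm_mul, Real.norm_of_nonneg (by positivity), one_div_mul_eq_div, div_le_iff₀ hn0]
    calc ‖∑ i, gaussianKernel t (X i - x)‖ ≤ ∑ i : Fin n, 1 / Z :=
          (norm_sum_le _ _).trans (Finset.sum_le_sum fun i _ => hgb (X i))
      _ = _ := by simp; ring
  have hvint := variance_eq_integral (μ := Measure.pi fun _ : Fin n => P) hpm.aemeasurable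
  rw [hmean, hvar] at hvint
  rw [← ofReal_integral_eq_lintegral_ofReal]
  · rw [← hvint]
    refine ENNReal.ofReal_le_ofReal ?_
    rw [Finset.sum_const, Finset.card_univ, Fintype.card_fin, nsmul_eq_mul]
    calc (n : ℝ) * Var[g1; P] ≤ n * (1 / (n : ℝ) ^ 2 * (1 / Z * s)) := by gcongr
      _ = _ := by field_simp
  · exact (hmemS.sub (memLp_const s)).integrable_sq
  · exact Filter.Eventually.of_forall fun X => sq_nonneg _

/-- The `L¹` risk of the kernel density estimator with bandwidth of the optimal order. -/
theorem exists_lintegral_pHat_sub_le (hd : 1 ≤ d) (hβ : 0 < β) (hβ2 : β ≤ 2) (hL : 0 < L)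
    (hσ : 0 < σ) (B : ℝ) (hB : 1 ≤ B) :
    ∃ C : ℝ, 0 < C ∧ ∀ p : Rd d → ℝ, IsDensity p → IsSubgaussian σ (lawOfDensity p) →
      IsHolderSmooth β L p → ∀ n : ℕ, 2 ≤ n → ∀ t : ℝ, (n : ℝ) ^ (-(2 / (d + 2 * β))) ≤ t →
      t ≤ B * (n : ℝ) ^ (-(2 / (d + 2 * β))) →
      ∫⁻ X : Fin n → Rd d, (∫⁻ x, ENNReal.ofReal (pHat X t x - p x))
        ∂(Measure.pi fun _ => lawOfDensity p) ≤
      ENNReal.ofReal (C * (n : ℝ) ^ (-(β / (d + 2 * β))) * Real.log n ^ ((d : ℝ) / 2)) := by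
  set v := (volume (Metric.ball (0 : Rd d) 1)).toReal with hv
  have hvol : volume (Metric.ball (0 : Rd d) 1) = ENNReal.ofReal v :=
    (ENNReal.ofReal_toReal measure_ball_lt_top.ne).symm
  have hv0 : 0 ≤ v := ENNReal.toReal_nonneg
  set D := 2 * d * σ ^ 2 + 16 * B with hD
  have hD0 : 0 < D := by positivity
  set E := 16 * d * L * 2 ^ ((d : ℝ) / 2) * B ^ (β / 2) with hE
  have hE0 : 0 ≤ E := by positivity
  -- A lower bound for `(log n)^{d/2}`; dividing by it lets the terms without logarithm join the
  -- final rate.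
  set c := (0.69 : ℝ) ^ ((d : ℝ) / 2) with hc
  have hc0 : 0 < c := by positivity
  refine ⟨(1 + E) * (D ^ ((d : ℝ) / 2) * v) + (1 + 16 * 2 ^ ((d : ℝ) / 2)) / c, by positivity,
    fun p hp hsg hps n hn t htτ htB => ?_⟩
  have hPp := hp.2.2
  set P := lawOfDensity p with hP
  have hn0 : (0 : ℝ) < n := by positivity
  set τ := (n : ℝ) ^ (-(2 / (d + 2 * β))) with hτ
  have hτ0 : 0 < τ := by positivity
  have hτ1 : τ ≤ 1 := natCast_rpow_neg_le_one (by omega) (by positivity)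
  have ht : 0 < t := hτ0.trans_le htτ
  have hl := log_natCast_pos hn
  have hl2 := half_le_log_natCast hn
  set ρ := (n : ℝ) ^ (-(β / (d + 2 * β))) with hρ
  have hρ0 : 0 < ρ := by positivity
  set R := cutoffRadius d n σ t with hR
  have hb : MeasurableSet (Metric.closedBall (0 : Rd d) R) :=
    Metric.isClosed_closedBall.measurableSet
  set s := smoothedDensity P t with hs
  set M := 1 / (n * (2 * Real.pi * t) ^ ((d : ℝ) / 2)) with hM
  have hM0 : 0 < M := by positivity
  have hMρ : M ≤ ρ * ρ := by
    rw [hρ, ← bandwidth_rpow_half_dim hβ (by omega)]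
    have : τ ≤ 2 * Real.pi * t := by nlinarith [Real.pi_gt_three]
    rw [hM]
    gcongr
  have hbias : ∀ x, |s x - p x| ≤ E * ρ := by
    intro x
    refine (abs_smoothedDensity_sub_le hd hβ hβ2 hL ht hp hps x).trans ?_
    rw [hρ, ← bandwidth_rpow_half_smoothness, hE, mul_assoc _ (B ^ (β / 2)),
      ← Real.mul_rpow (by positivity) (by positivity)]
    gcongr
  have hsm : Measurable s := measurable_smoothedDensity ht
  have h1 : ∀ X : Fin n → Rd d, ∫⁻ x, ENNReal.ofReal (pHat X t x - p x) ≤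
      ((∫⁻ x in Metric.closedBall (0 : Rd d) R, ENNReal.ofReal ((pHat X t x - s x) ^ 2 / ρ)) +
      ENNReal.ofReal ((1 + E) * ρ) * volume (Metric.closedBall (0 : Rd d) R)) +
      ∫⁻ x in (Metric.closedBall (0 : Rd d) R)ᶜ,
        ENNReal.ofReal (pHat X t x + kdeSq X t x / t) := by
    intro X
    rw [← lintegral_add_compl _ hb]
    refine add_le_add ?_ (lintegral_mono fun x => ENNReal.ofReal_le_ofReal ?_)
    · rw [← setLIntegral_const, ← lintegral_add_right _ measurable_const]
      refine lintegral_mono fun x => ?_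
      rw [← ENNReal.ofReal_add (by positivity) (by positivity)]
      refine ENNReal.ofReal_le_ofReal ?_
      have h2 := (le_abs_self _).trans (hbias x)
      -- This replaces the square root of the variance. The variance is at most `ρ² s(x)` and `s`
      -- integrates to one, so the first term contributes `ρ` in total; only the constant `ρ` is
      -- multiplied by the volume of the ball, whence `(log n)^{d/2}`.
      have h3 : pHat X t x - s x ≤ (pHat X t x - s x) ^ 2 / ρ + ρ := by
        rw [← sub_le_iff_le_add, le_div_iff₀ hρ0]
        nlinarith [sq_nonneg (pHat X t x - s x - ρ), sq_nonneg (pHat X t x - s x), sq_nonneg ρ]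
      linarith
    · have h2 := hp.2.1 x
      have h3 := kdeSq_nonneg ht X x
      have : 0 ≤ kdeSq X t x / t := by positivity
      linarith
  have hjm : Measurable fun z : (Fin n → Rd d) × Rd d =>
      ENNReal.ofReal ((pHat z.1 t z.2 - s z.2) ^ 2 / ρ) := by
    have h2 : Measurable fun z : (Fin n → Rd d) × Rd d => pHat z.1 t z.2 - s z.2 :=
      (measurable_pHat_uncurry t).sub (hsm.comp measurable_snd)
    exact ((h2.pow_const 2).div_const ρ).ennreal_ofReal
  have h2 : ∫⁻ X : Fin n → Rd d, (∫⁻ x in Metric.closedBall (0 : Rd d) R,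
      ENNReal.ofReal ((pHat X t x - s x) ^ 2 / ρ)) ∂(Measure.pi fun _ => P) ≤
      ENNReal.ofReal ρ := by
    rw [lintegral_lintegral_swap hjm.aemeasurable]
    calc _ ≤ ∫⁻ x in Metric.closedBall (0 : Rd d) R,
          ENNReal.ofReal (1 / ρ) * ENNReal.ofReal (M * s x) := by
          refine lintegral_mono fun x => ?_
          have e : ∀ X : Fin n → Rd d, ENNReal.ofReal ((pHat X t x - s x) ^ 2 / ρ) =
              ENNReal.ofReal ((pHat X t x - s x) ^ 2) * ENNReal.ofReal (1 / ρ) := fun X => by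
            rw [← ENNReal.ofReal_mul (sq_nonneg _), mul_one_div]
          simp_rw [e]
          rw [lintegral_mul_const' _ _ ENNReal.ofReal_ne_top, mul_comm]
          exact mul_le_mul_right (lintegral_sq_pHat_sub_le (by omega) ht x) _
      _ ≤ ∫⁻ x, ENNReal.ofReal (1 / ρ * M) * ENNReal.ofReal (s x) := by
          refine (setLIntegral_le_lintegral _ _).trans (lintegral_mono fun x => le_of_eq ?_)
          rw [ENNReal.ofReal_mul hM0.le, ← mul_assoc, ← ENNReal.ofReal_mul (by positivity)]
      _ = ENNReal.ofReal (1 / ρ * M) := by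
          rw [lintegral_const_mul _ (by fun_prop), lintegral_smoothedDensity ht, mul_one]
      _ ≤ ENNReal.ofReal ρ := by
          refine ENNReal.ofReal_le_ofReal ?_
          rw [one_div_mul_eq_div, div_le_iff₀ hρ0]
          exact hMρ
  have h3 : (1 + E) * ρ * (((2 * d * σ ^ 2 + 16 * t) * Real.log n) ^ ((d : ℝ) / 2) * v) ≤
      (1 + E) * (D ^ ((d : ℝ) / 2) * v) * ρ * Real.log n ^ ((d : ℝ) / 2) := by
    have h4 : ((2 * d * σ ^ 2 + 16 * t) * Real.log n) ^ ((d : ℝ) / 2) ≤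
        D ^ ((d : ℝ) / 2) * Real.log n ^ ((d : ℝ) / 2) := by
      rw [← Real.mul_rpow hD0.le hl.le]
      gcongr
      rw [hD]
      gcongr
      calc t ≤ B * τ := htB
        _ ≤ B * 1 := by gcongr
        _ = B := mul_one B
    calc _ ≤ (1 + E) * ρ * (D ^ ((d : ℝ) / 2) * Real.log n ^ ((d : ℝ) / 2) * v) := by gcongr
      _ = _ := by ring
  have h4 : 1 ≤ Real.log n ^ ((d : ℝ) / 2) / c := by
    rw [le_div_iff₀ hc0, one_mul, hc]
    gcongr
  have h5 : ρ + 16 * 2 ^ ((d : ℝ) / 2) / n ≤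
      (1 + 16 * 2 ^ ((d : ℝ) / 2)) / c * ρ * Real.log n ^ ((d : ℝ) / 2) := by
    have h6 : 16 * 2 ^ ((d : ℝ) / 2) / n ≤ 16 * 2 ^ ((d : ℝ) / 2) * ρ := by
      rw [div_eq_mul_one_div]
      gcongr
      exact one_div_natCast_le_rate hβ (by omega)
    calc ρ + 16 * 2 ^ ((d : ℝ) / 2) / n ≤ (1 + 16 * 2 ^ ((d : ℝ) / 2)) * ρ * 1 := by linarith
      _ ≤ (1 + 16 * 2 ^ ((d : ℝ) / 2)) * ρ * (Real.log n ^ ((d : ℝ) / 2) / c) := by gcongr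
      _ = _ := by ring
  calc _ ≤ ∫⁻ X : Fin n → Rd d, (((∫⁻ x in Metric.closedBall (0 : Rd d) R,
        ENNReal.ofReal ((pHat X t x - s x) ^ 2 / ρ)) +
      ENNReal.ofReal ((1 + E) * ρ) * volume (Metric.closedBall (0 : Rd d) R)) +
      ∫⁻ x in (Metric.closedBall (0 : Rd d) R)ᶜ,
        ENNReal.ofReal (pHat X t x + kdeSq X t x / t)) ∂(Measure.pi fun _ => P) :=
        lintegral_mono h1
    _ = (∫⁻ X : Fin n → Rd d, (∫⁻ x in Metric.closedBall (0 : Rd d) R,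
        ENNReal.ofReal ((pHat X t x - s x) ^ 2 / ρ)) ∂(Measure.pi fun _ => P)) +
      ENNReal.ofReal ((1 + E) * ρ) * volume (Metric.closedBall (0 : Rd d) R) +
      ∫⁻ X : Fin n → Rd d, (∫⁻ x in (Metric.closedBall (0 : Rd d) R)ᶜ,
        ENNReal.ofReal (pHat X t x + kdeSq X t x / t)) ∂(Measure.pi fun _ => P) := by
        have hjm2 : Measurable fun X : Fin n → Rd d => ∫⁻ x in Metric.closedBall (0 : Rd d) R,
            ENNReal.ofReal ((pHat X t x - s x) ^ 2 / ρ) := hjm.lintegral_prod_right'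
        have hjm3 : Measurable fun X : Fin n → Rd d => (∫⁻ x in Metric.closedBall (0 : Rd d) R,
            ENNReal.ofReal ((pHat X t x - s x) ^ 2 / ρ)) +
            ENNReal.ofReal ((1 + E) * ρ) * volume (Metric.closedBall (0 : Rd d) R) :=
          hjm2.add_const _
        rw [lintegral_add_left hjm3, lintegral_add_left hjm2]
        simp
    _ ≤ ENNReal.ofReal ρ +
        ENNReal.ofReal ((1 + E) * (D ^ ((d : ℝ) / 2) * v) * ρ * Real.log n ^ ((d : ℝ) / 2)) +
        ENNReal.ofReal (16 * 2 ^ ((d : ℝ) / 2) / n) := by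
        refine add_le_add (add_le_add h2 ?_) (lintegral_lintegral_tail_le hd hn hσ ht hsg)
        rw [hR, volume_closedBall_cutoffRadius_eq hn ht.le, hvol,
            ← ENNReal.ofReal_mul (by positivity), ← ENNReal.ofReal_mul (by positivity)]
        exact ENNReal.ofReal_le_ofReal h3
    _ ≤ _ := by
        rw [← ENNReal.ofReal_add (by positivity) (by positivity),
          ← ENNReal.ofReal_add (by positivity) (by positivity)]
        refine ENNReal.ofReal_le_ofReal ?_
        linarith

end KernelDensityRisk


/-! ### Initialization at a high noise level -/

section Initialization

variable {d n : ℕ} {t T σ : ℝ}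

/-- Again `exp u ≥ 1 + u`; as `t ≤ T`, the normalizing constants compare in the right direction. The
difference of exponents is small because both the shift `a` and `T - t ≤ 1` are small on the scale
`√T`. -/
theorem gaussianKernel_le_add (hT : 2 ≤ T) (ht1 : T - 1 ≤ t) (ht2 : t ≤ T) (a x : Rd d) :
    gaussianKernel T x ≤ gaussianKernel t (a - x) +
      2 / √T * (1 + ‖a‖ ^ 2) * (gaussianKernel T x * (1 + ‖x‖ ^ 2 / T)) := by
  have hT0 : 0 < T := by linarith
  have ht0 : 0 < t := by linarith
  have hg := gaussianKernel_pos hT0 x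
  set S := √T with hS
  have hS1 : 1 ≤ S := by rw [hS, Real.one_le_sqrt]; linarith
  have hS0 : 0 < S := by linarith
  have hTS : T = S ^ 2 := (Real.sq_sqrt hT0.le).symm
  have h1 : gaussianKernel T x * (1 - (‖a - x‖ ^ 2 / (2 * t) - ‖x‖ ^ 2 / (2 * T))) ≤
      gaussianKernel t (a - x) := by
    calc gaussianKernel T x * (1 - (‖a - x‖ ^ 2 / (2 * t) - ‖x‖ ^ 2 / (2 * T)))
        ≤ gaussianKernel T x * Real.exp (-(‖a - x‖ ^ 2 / (2 * t) - ‖x‖ ^ 2 / (2 * T))) := by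
          gcongr
          linarith [Real.add_one_le_exp (-(‖a - x‖ ^ 2 / (2 * t) - ‖x‖ ^ 2 / (2 * T)))]
      _ = 1 / (2 * Real.pi * T) ^ ((d : ℝ) / 2) * Real.exp (-‖a - x‖ ^ 2 / (2 * t)) := by
          unfold gaussianKernel
          rw [mul_assoc, ← Real.exp_add]
          ring_nf
      _ ≤ gaussianKernel t (a - x) := by
          unfold gaussianKernel
          gcongr
  have h2 : ‖a - x‖ ^ 2 / (2 * t) - ‖x‖ ^ 2 / (2 * T) ≤
      2 / S * (1 + ‖a‖ ^ 2) * (1 + ‖x‖ ^ 2 / T) := by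
    have hax : ‖a - x‖ ^ 2 ≤ ‖x‖ ^ 2 + 2 * ‖x‖ * ‖a‖ + ‖a‖ ^ 2 := by
      have := norm_sub_le a x
      nlinarith [norm_nonneg (a - x), norm_nonneg a, norm_nonneg x]
    set y := ‖x‖ with hy
    set b := ‖a‖ with hb
    have hy0 : 0 ≤ y := norm_nonneg _
    have hb0 : 0 ≤ b := norm_nonneg _
    have htT : T / 2 ≤ t := by linarith
    have k0 : ‖a - x‖ ^ 2 / (2 * t) - y ^ 2 / (2 * T) ≤
        y ^ 2 * (T - t) / (2 * t * T) + y * b / t + b ^ 2 / (2 * t) := by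
      have : ‖a - x‖ ^ 2 / (2 * t) ≤ (y ^ 2 + 2 * y * b + b ^ 2) / (2 * t) := by gcongr
      refine (sub_le_sub_right this _).trans (le_of_eq ?_)
      field_simp
      ring
    have k1 : y ^ 2 * (T - t) / (2 * t * T) ≤ y ^ 2 / T / S := by
      rw [div_div, div_le_div_iff₀ (by positivity) (by positivity)]
      have e1 : S ≤ T := by rw [hTS]; nlinarith
      calc y ^ 2 * (T - t) * (T * S) ≤ y ^ 2 * 1 * (T * T) := by gcongr; linarith
        _ ≤ y ^ 2 * 1 * (T * (2 * t)) := by gcongr; linarith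
        _ = _ := by ring
    -- The cross term decides the order `1/√T`: after `t ≥ T/2` it is `2 (y/√T) b / √T`, and AM–GM
    -- separates the factors.
    have k2 : y * b / t ≤ (y ^ 2 / T + b ^ 2) / S := by
      have e1 : y * b / t ≤ y * b / (T / 2) := by gcongr
      refine e1.trans ?_
      rw [hTS, div_le_div_iff₀ (by positivity) hS0]
      have e2 : (y ^ 2 / S ^ 2 + b ^ 2) * (S ^ 2 / 2) = (y ^ 2 + b ^ 2 * S ^ 2) / 2 := by
        field_simp
      rw [e2]
      nlinarith [sq_nonneg (y - b * S)]
    have k3 : b ^ 2 / (2 * t) ≤ b ^ 2 / S := by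
      gcongr
      have e1 : S ≤ T := by rw [hTS]; nlinarith
      linarith
    have k4 : 2 / S * (1 + b ^ 2) * (1 + y ^ 2 / T) =
        2 / S + 2 * (y ^ 2 / T / S) + 2 * (b ^ 2 / S) + 2 / S * b ^ 2 * (y ^ 2 / T) := by
      field_simp
      ring
    have k5 : 0 ≤ 2 / S := by positivity
    have k6 : 0 ≤ 2 / S * b ^ 2 * (y ^ 2 / T) := by positivity
    have k7 : (y ^ 2 / T + b ^ 2) / S = y ^ 2 / T / S + b ^ 2 / S := add_div _ _ _
    rw [k7] at k2
    rw [k4]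
    linarith
  calc gaussianKernel T x = gaussianKernel T x * (1 - (‖a - x‖ ^ 2 / (2 * t) - ‖x‖ ^ 2 / (2 * T))) +
        gaussianKernel T x * (‖a - x‖ ^ 2 / (2 * t) - ‖x‖ ^ 2 / (2 * T)) := by ring
    _ ≤ gaussianKernel t (a - x) +
        gaussianKernel T x * (2 / S * (1 + ‖a‖ ^ 2) * (1 + ‖x‖ ^ 2 / T)) := by gcongr
    _ = _ := by ring

/-- At a high noise level the kernel density estimator is close to a centered Gaussian. -/
theorem lawOfDensity_gaussianKernel_le (hn : 1 ≤ n) (hT : 2 ≤ T) (ht1 : T - 1 ≤ t) (ht2 : t ≤ T)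
    (X : Fin n → Rd d) (A : Set (Rd d)) (hA : MeasurableSet A) :
    lawOfDensity (gaussianKernel T) A ≤ lawOfDensity (pHat X t) A +
      ENNReal.ofReal (16 * 2 ^ ((d : ℝ) / 2) / √T) *
        (ENNReal.ofReal (1 / n) * ∑ i, ENNReal.ofReal (1 + ‖X i‖ ^ 2)) := by
  have hn0 : (0 : ℝ) < n := by exact_mod_cast hn
  have hT0 : 0 < T := by linarith
  have ht0 : 0 < t := by linarith
  set m := 1 / (n : ℝ) * ∑ i, (1 + ‖X i‖ ^ 2) with hm
  have hm0 : 0 ≤ m := by positivity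
  have hsum : ENNReal.ofReal (1 / n) * ∑ i, ENNReal.ofReal (1 + ‖X i‖ ^ 2) = ENNReal.ofReal m := by
    rw [hm, ENNReal.ofReal_mul (by positivity),
      ENNReal.ofReal_sum_of_nonneg fun _ _ => by positivity]
  have hpt : ∀ x, gaussianKernel T x ≤ pHat X t x +
      16 * 2 ^ ((d : ℝ) / 2) / √T * m * gaussianKernel (2 * T) x := by
    intro x
    have h1 : ∀ i, gaussianKernel T x ≤ gaussianKernel t (X i - x) +
        2 / √T * (1 + ‖X i‖ ^ 2) * (8 * 2 ^ ((d : ℝ) / 2) * gaussianKernel (2 * T) x) := fun i =>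
      (gaussianKernel_le_add hT ht1 ht2 (X i) x).trans (add_le_add_right
        (mul_le_mul_of_nonneg_left (gaussianKernel_mul_one_add_le' hT0 x) (by positivity)) _)
    have h2 := mul_le_mul_of_nonneg_left (Finset.sum_le_sum fun i (_ : i ∈ Finset.univ) => h1 i)
      (by positivity : 0 ≤ 1 / (n : ℝ))
    rw [Finset.sum_const, Finset.card_univ, Fintype.card_fin, nsmul_eq_mul, ← mul_assoc,
      one_div_mul_cancel hn0.ne', one_mul, Finset.sum_add_distrib, mul_add, ← Finset.sum_mul,
      ← Finset.mul_sum] at h2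
    refine h2.trans (le_of_eq ?_)
    rw [hm, pHat]
    ring
  rw [hsum, lawOfDensity, lawOfDensity, withDensity_apply _ hA, withDensity_apply _ hA]
  have hg : ∀ x : Rd d, 0 ≤ gaussianKernel (2 * T) x := fun x =>
    (gaussianKernel_pos (by positivity) x).le
  calc ∫⁻ x in A, ENNReal.ofReal (gaussianKernel T x)
      ≤ ∫⁻ x in A, (ENNReal.ofReal (pHat X t x) + ENNReal.ofReal (16 * 2 ^ ((d : ℝ) / 2) / √T * m) *
          ENNReal.ofReal (gaussianKernel (2 * T) x)) := by
        refine lintegral_mono fun x => ?_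
        have h1 : 0 ≤ pHat X t x := mul_nonneg (by positivity)
          (Finset.sum_nonneg fun i _ => (gaussianKernel_pos ht0 _).le)
        rw [← ENNReal.ofReal_mul (by positivity), ← ENNReal.ofReal_add h1
          (mul_nonneg (by positivity) (hg x))]
        exact ENNReal.ofReal_le_ofReal (hpt x)
    _ = (∫⁻ x in A, ENNReal.ofReal (pHat X t x)) +
        ∫⁻ x in A, ENNReal.ofReal (16 * 2 ^ ((d : ℝ) / 2) / √T * m) *
          ENNReal.ofReal (gaussianKernel (2 * T) x) := lintegral_add_right _ (by fun_prop)
    _ ≤ _ := by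
        gcongr
        refine (setLIntegral_le_lintegral _ _).trans ?_
        rw [lintegral_const_mul _ (by fun_prop), lintegral_gaussianKernel (by positivity), mul_one,
          ENNReal.ofReal_mul (by positivity)]

theorem lintegral_one_add_sq_norm_le (hd : 1 ≤ d) (hσ : 0 < σ) {P : Measure (Rd d)}
    (hP : IsSubgaussian σ P) :
    ∫⁻ x, ENNReal.ofReal (1 + ‖x‖ ^ 2) ∂P ≤ ENNReal.ofReal (2 * (1 + d * σ ^ 2)) := by
  have hd0 : (0 : ℝ) < d := by exact_mod_cast hd
  calc ∫⁻ x, ENNReal.ofReal (1 + ‖x‖ ^ 2) ∂P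
      ≤ ∫⁻ x, ENNReal.ofReal (1 + d * σ ^ 2) *
          ENNReal.ofReal (Real.exp (‖x‖ ^ 2 / (d * σ ^ 2))) ∂P := by
        refine lintegral_mono fun x => ?_
        rw [← ENNReal.ofReal_mul (by positivity)]
        refine ENNReal.ofReal_le_ofReal ?_
        have h1 := Real.add_one_le_exp (‖x‖ ^ 2 / (d * σ ^ 2))
        have h2 : ‖x‖ ^ 2 = d * σ ^ 2 * (‖x‖ ^ 2 / (d * σ ^ 2)) := by field_simp
        have h3 : 0 ≤ ‖x‖ ^ 2 / (d * σ ^ 2) := by positivity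
        have h4 : 0 ≤ d * σ ^ 2 := by positivity
        calc 1 + ‖x‖ ^ 2 = 1 + d * σ ^ 2 * (‖x‖ ^ 2 / (d * σ ^ 2)) := by rw [← h2]
          _ ≤ (1 + d * σ ^ 2) * (‖x‖ ^ 2 / (d * σ ^ 2) + 1) := by linarith
          _ ≤ _ := by gcongr
    _ ≤ ENNReal.ofReal (1 + d * σ ^ 2) * 2 := by
        rw [lintegral_const_mul _ (by fun_prop)]
        gcongr
        exact lintegral_exp_sq_norm_le hd hP
    _ = _ := by
        rw [show (2 : ENNReal) = ENNReal.ofReal 2 by simp, ← ENNReal.ofReal_mul (by positivity),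
          mul_comm]

end Initialization

/-! ### Measurability and rescaling of the sampler -/

section Sampler

variable {d n K : ℕ} {c₀ c₁ τ : ℝ}

theorem measurable_softThreshold (η : ℝ) : Measurable fun x => softThreshold x η := by
  unfold softThreshold
  refine Measurable.ite (measurableSet_le measurable_const measurable_id) measurable_const ?_
  refine Measurable.ite (measurableSet_le measurable_id measurable_const) measurable_const ?_
  fun_prop

theorem measurable_scoreZ_uncurry (t : ℝ) :
    Measurable fun z : (Fin n → Rd d) × Rd d => scoreZ z.1 t z.2 := by
  unfold scoreZ
  simp_rw [gradient_pHat]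
  have h1 := measurable_pHat_uncurry (n := n) (d := d) t
  exact (((measurable_softThreshold _).comp h1).div h1).smul (measurable_kdeGrad_uncurry t)

theorem measurable_comp_const_smul {F : (Fin n → Rd d) → Rd d → Rd d}
    (hF : Measurable fun z : (Fin n → Rd d) × Rd d => F z.1 z.2) (a : ℝ) :
    Measurable fun z : (Fin n → Rd d) × Rd d => F z.1 (a • z.2) :=
  hF.comp (measurable_fst.prodMk (measurable_snd.const_smul a))

theorem measurable_scoreX_uncurry (k : ℕ) :
    Measurable fun z : (Fin n → Rd d) × Rd d => scoreX z.1 K c₀ c₁ τ k z.2 := by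
  unfold scoreX
  generalize noiseTime K c₀ c₁ τ k = t
  generalize 1 / √(alphaBar K c₀ c₁ k) = a
  exact (measurable_comp_const_smul (F := fun X x => scoreZ X t x) (measurable_scoreZ_uncurry t)
    a).const_smul a

theorem measurable_reverseStep_uncurry (k : ℕ) :
    Measurable fun z : (Fin n → Rd d) × Rd d => reverseStep z.1 K c₀ c₁ τ k z.2 := by
  unfold reverseStep
  have h1 := measurable_scoreX_uncurry (n := n) (d := d) (K := K) (c₀ := c₀) (c₁ := c₁)
    (τ := τ) k
  exact (measurable_snd.add (h1.const_smul ((1 - alpha K c₀ c₁ k) / 2))).const_smul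
    (1 / √(alpha K c₀ c₁ k))

theorem measurable_runToOne_uncurry : ∀ k : ℕ,
    Measurable fun z : (Fin n → Rd d) × Rd d => runToOne z.1 K c₀ c₁ τ k z.2
  | 0 => measurable_snd
  | 1 => measurable_snd
  | k + 2 => (measurable_runToOne_uncurry (k + 1)).comp
      (measurable_fst.prodMk (measurable_reverseStep_uncurry (k + 2)))

theorem measurable_samplerOutput_uncurry :
    Measurable fun z : (Fin n → Rd d) × Rd d => samplerOutput z.1 K c₀ c₁ τ z.2 :=
  (measurable_runToOne_uncurry K).const_smul (1 / √(alpha K c₀ c₁ 1))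

theorem measurable_samplerOutput (X : Fin n → Rd d) :
    Measurable (samplerOutput X K c₀ c₁ τ) :=
  measurable_samplerOutput_uncurry.comp (measurable_const.prodMk measurable_id)

theorem isProbabilityMeasure_outputLaw (X : Fin n → Rd d) :
    IsProbabilityMeasure (outputLaw X K c₀ c₁ τ) :=
  Measure.isProbabilityMeasure_map (measurable_samplerOutput X).aemeasurable

theorem stronglyMeasurable_tvDist_outputLaw (ν : Measure (Rd d)) [IsProbabilityMeasure ν] :
    StronglyMeasurable fun X : Fin n → Rd d => tvDist (outputLaw X K c₀ c₁ τ) ν := by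
  have hf := measurable_samplerOutput_uncurry (n := n) (d := d) (K := K) (c₀ := c₀) (c₁ := c₁)
    (τ := τ)
  -- The conditional law given the data, written as a Markov kernel, so that
  -- `stronglyMeasurable_tvDist` applies.
  set κ : Kernel (Fin n → Rd d) (Rd d) :=
    (Kernel.id ×ₖ Kernel.const (Fin n → Rd d) (stdGaussian (Rd d))).map
      fun z : (Fin n → Rd d) × Rd d => samplerOutput z.1 K c₀ c₁ τ z.2 with hκ
  have : IsMarkovKernel κ := Kernel.IsMarkovKernel.map _ hf
  have h : ∀ X, κ X = outputLaw X K c₀ c₁ τ := by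
    intro X
    rw [hκ, Kernel.map_apply _ hf, Kernel.prod_apply, Kernel.id_apply, Kernel.const_apply,
      Measure.dirac_prod, Measure.map_map hf measurable_prodMk_left]
    rfl
  simp_rw [← h]
  exact stronglyMeasurable_tvDist κ ν

/-- The sampler in the variance-exploding parametrization `z = y / √ᾱ`. -/
noncomputable def rescaledRun (X : Fin n → Rd d) (K : ℕ) (c₀ c₁ τ : ℝ) : ℕ → Rd d → Rd d
  | 0, z => z
  | 1, z => z
  | k + 2, z => rescaledRun X K c₀ c₁ τ (k + 1) (eulerMap X (noiseTime K c₀ c₁ τ (k + 2))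
      (noiseTime K c₀ c₁ τ (k + 2) - noiseTime K c₀ c₁ τ (k + 1)) z)

/-- The factors `√ᾱ` cancel since `h = t_{k+2} - t_{k+1} = (1 - α_{k+2}) / ᾱ_{k+2}`, and the shift
`τ` drops out of the difference. -/
theorem reverseStep_smul (X : Fin n → Rd d) {k : ℕ} (h1 : 0 < alphaBar K c₀ c₁ (k + 1))
    (h2 : 0 < alphaBar K c₀ c₁ (k + 2)) (z : Rd d) :
    reverseStep X K c₀ c₁ τ (k + 2) (√(alphaBar K c₀ c₁ (k + 2)) • z) =
      √(alphaBar K c₀ c₁ (k + 1)) • eulerMap X (noiseTime K c₀ c₁ τ (k + 2))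
        (noiseTime K c₀ c₁ τ (k + 2) - noiseTime K c₀ c₁ τ (k + 1)) z := by
  rw [reverseStep, scoreX, eulerMap, alpha, Nat.add_succ_sub_one]
  set a := alphaBar K c₀ c₁ (k + 1) with ha
  set b := alphaBar K c₀ c₁ (k + 2) with hb
  have hsb : √b ≠ 0 := (Real.sqrt_pos.2 h2).ne'
  have hsa : √a ≠ 0 := (Real.sqrt_pos.2 h1).ne'
  have ht : noiseTime K c₀ c₁ τ (k + 2) - noiseTime K c₀ c₁ τ (k + 1) = (1 - b / a) / b := by
    rw [noiseTime, noiseTime, ← ha, ← hb]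
    field_simp
    ring
  rw [ht, smul_smul (1 / √b), one_div_mul_cancel hsb, one_smul, smul_add, smul_add, smul_smul,
    smul_smul, smul_smul, smul_smul, Real.sqrt_div h2.le]
  congr 2
  · field_simp
  · have : b = √b * √b := (Real.mul_self_sqrt h2.le).symm
    field_simp
    rw [Real.sq_sqrt h2.le]

theorem runToOne_smul (X : Fin n → Rd d) (h : ∀ k, 0 < alphaBar K c₀ c₁ (k + 1)) :
    ∀ (k : ℕ) (z : Rd d), runToOne X K c₀ c₁ τ (k + 1) (√(alphaBar K c₀ c₁ (k + 1)) • z) =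
      √(alphaBar K c₀ c₁ 1) • rescaledRun X K c₀ c₁ τ (k + 1) z
  | 0, _ => rfl
  | k + 1, z => by
    rw [runToOne, reverseStep_smul X (h k) (h (k + 1)), runToOne_smul X h k, rescaledRun]

theorem outputLaw_eq (X : Fin n → Rd d) (hK : 1 ≤ K) (h : ∀ k, 0 < alphaBar K c₀ c₁ (k + 1))
    (hm : Measurable (rescaledRun X K c₀ c₁ τ K)) :
    outputLaw X K c₀ c₁ τ =
      (lawOfDensity (gaussianKernel (1 / alphaBar K c₀ c₁ K))).map (rescaledRun X K c₀ c₁ τ K) := by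
  obtain ⟨k, rfl⟩ : ∃ k, K = k + 1 := ⟨K - 1, by omega⟩
  have hk := h k
  have h1 := h 0
  rw [zero_add] at h1
  set b := alphaBar (k + 1) c₀ c₁ (k + 1) with hb
  have hsb : 0 < √b := Real.sqrt_pos.2 hk
  have hs1 : 0 < √(alphaBar (k + 1) c₀ c₁ 1) := Real.sqrt_pos.2 h1
  have e : 1 / b = (1 / √b) ^ 2 := by rw [one_div_pow, Real.sq_sqrt hk.le]
  rw [e, ← stdGaussian_map_smul (by positivity), Measure.map_map hm (by fun_prop), outputLaw]
  congr 1
  funext y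
  rw [samplerOutput, Function.comp_apply]
  have h2 := runToOne_smul X h k ((1 / √b) • y) (τ := τ)
  rw [← hb, smul_smul, mul_one_div_cancel hsb.ne', one_smul] at h2
  have ha : alpha (k + 1) c₀ c₁ 1 = alphaBar (k + 1) c₀ c₁ 1 := by
    simp [alpha, alphaBar]
  rw [h2, smul_smul, ha, one_div_mul_cancel hs1.ne', one_smul]

theorem measurable_rescaledRun (hn : 2 ≤ n) (X : Fin n → Rd d)
    (ht : ∀ k, 0 < noiseTime K c₀ c₁ τ (k + 1)) :
    ∀ k, Measurable (rescaledRun X K c₀ c₁ τ k)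
  | 0 => measurable_id
  | 1 => measurable_id
  | k + 2 => (measurable_rescaledRun hn X ht (k + 1)).comp
      (continuous_eulerMap hn (ht (k + 1)) X).measurable

/-- Accumulation of the errors of the individual steps. -/
theorem map_rescaledRun_le (hn : 2 ≤ n) (X : Fin n → Rd d)
    (ht : ∀ k, 0 < noiseTime K c₀ c₁ τ (k + 1)) {e : ℕ → ENNReal}
    (he : ∀ k, ∀ A, MeasurableSet A →
      (lawOfDensity (pHat X (noiseTime K c₀ c₁ τ (k + 2)))).map
        (eulerMap X (noiseTime K c₀ c₁ τ (k + 2))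
          (noiseTime K c₀ c₁ τ (k + 2) - noiseTime K c₀ c₁ τ (k + 1))) A ≤
        lawOfDensity (pHat X (noiseTime K c₀ c₁ τ (k + 1))) A + e k) :
    ∀ (k : ℕ) (μ : Measure (Rd d)) (δ : ENNReal),
      (∀ A, MeasurableSet A →
        μ A ≤ lawOfDensity (pHat X (noiseTime K c₀ c₁ τ (k + 1))) A + δ) →
      ∀ A, MeasurableSet A → μ.map (rescaledRun X K c₀ c₁ τ (k + 1)) A ≤
        lawOfDensity (pHat X (noiseTime K c₀ c₁ τ 1)) A + (δ + ∑ j ∈ Finset.range k, e j)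
  | 0, μ, δ, h, A, hA => by
    rw [Measure.map_apply (measurable_rescaledRun hn X ht _) hA]
    change μ A ≤ _
    simpa using h A hA
  | k + 1, μ, δ, h, A, hA => by
    have hF := (continuous_eulerMap (h := noiseTime K c₀ c₁ τ (k + 2) -
      noiseTime K c₀ c₁ τ (k + 1)) hn (ht (k + 1)) X).measurable
    have hmap : μ.map (rescaledRun X K c₀ c₁ τ (k + 1 + 1)) =
        (μ.map (eulerMap X (noiseTime K c₀ c₁ τ (k + 2)) (noiseTime K c₀ c₁ τ (k + 2) -
          noiseTime K c₀ c₁ τ (k + 1)))).map (rescaledRun X K c₀ c₁ τ (k + 1)) := by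
      rw [Measure.map_map (measurable_rescaledRun hn X ht _) hF]
      rfl
    rw [hmap]
    have h1 := map_rescaledRun_le hn X ht he k
      (μ.map (eulerMap X (noiseTime K c₀ c₁ τ (k + 2)) (noiseTime K c₀ c₁ τ (k + 2) -
          noiseTime K c₀ c₁ τ (k + 1)))) (δ + e k) (fun B hB => by
        rw [Measure.map_apply hF hB]
        refine (h _ (hF hB)).trans ?_
        rw [← Measure.map_apply hF hB, add_comm δ, ← add_assoc]
        exact add_le_add_left (he k B hB) δ) A hA
    refine h1.trans (le_of_eq ?_)
    rw [Finset.sum_range_succ, add_assoc δ, add_comm (e k)]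

end Sampler


/-! ### Growth of the noise schedule -/

section Schedule

variable {K : ℕ} {c₀ c₁ τ : ℝ}

theorem alphaBar_succ_mem_Ioo (hK : 2 ≤ K) (hc₀ : 0 < c₀) (h0 : 0 ≤ c₁ * Real.log K / K)
    (h1 : c₁ * Real.log K / K ≤ 1 / 2) : ∀ k, alphaBar K c₀ c₁ (k + 1) ∈ Set.Ioo 0 1
  | 0 => by
    have hK1 : (1 : ℝ) < K := by exact_mod_cast hK
    have := Real.one_lt_rpow hK1 hc₀
    have h2 : 1 / (K : ℝ) ^ c₀ < 1 := by rw [div_lt_one (by positivity)]; exact this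
    have h3 : 0 < 1 / (K : ℝ) ^ c₀ := by positivity
    simp only [alphaBar, Set.mem_Ioo]
    constructor <;> linarith
  | k + 1 => by
    obtain ⟨ha, hb⟩ := alphaBar_succ_mem_Ioo hK hc₀ h0 h1 k
    simp only [alphaBar, Set.mem_Ioo]
    set a := alphaBar K c₀ c₁ (k + 1)
    set ε := c₁ * Real.log K / K
    have hε : ε * (1 - a) ≤ 1 / 2 := by nlinarith
    have hε0 : 0 ≤ ε * (1 - a) := mul_nonneg h0 (by linarith)
    constructor <;> nlinarith

/-- With `ε = c₁ log K / K` and `w = (1 - ᾱ)/ᾱ`, the recursion reads `w' - w = ε w / (1 - ε (1 -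
ᾱ))`, whose denominator lies in `[1/2, 1]`. -/
theorem noiseTime_succ_sub (hK : 2 ≤ K) (hc₀ : 0 < c₀) (h0 : 0 ≤ c₁ * Real.log K / K)
    (h1 : c₁ * Real.log K / K ≤ 1 / 2) (k : ℕ) :
    c₁ * Real.log K / K * noiseTime K c₀ c₁ 0 (k + 1) ≤
        noiseTime K c₀ c₁ τ (k + 2) - noiseTime K c₀ c₁ τ (k + 1) ∧
      noiseTime K c₀ c₁ τ (k + 2) - noiseTime K c₀ c₁ τ (k + 1) ≤
        2 * (c₁ * Real.log K / K) * noiseTime K c₀ c₁ 0 (k + 1) := by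
  obtain ⟨ha, ha1⟩ := alphaBar_succ_mem_Ioo hK hc₀ h0 h1 k
  simp only [noiseTime, alphaBar]
  set a := alphaBar K c₀ c₁ (k + 1)
  set ε := c₁ * Real.log K / K
  have hε : ε * (1 - a) ≤ 1 / 2 := by nlinarith
  have hε0 : 0 ≤ ε * (1 - a) := mul_nonneg h0 (by linarith)
  have hq : 0 < 1 - ε * (1 - a) := by linarith
  have e : (1 - (a - ε * a * (1 - a))) / (a - ε * a * (1 - a)) + τ - ((1 - a) / a + τ) =
      ε * ((1 - a) / a) / (1 - ε * (1 - a)) := by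
    rw [show a - ε * a * (1 - a) = a * (1 - ε * (1 - a)) by ring]
    field_simp
    ring
  have hw : 0 ≤ ε * ((1 - a) / a) := mul_nonneg h0 (div_nonneg (by linarith) ha.le)
  rw [e, add_zero]
  constructor
  · rw [le_div_iff₀ hq]
    nlinarith
  · rw [div_le_iff₀ hq]
    nlinarith

theorem noiseTime_zero_pos (hK : 2 ≤ K) (hc₀ : 0 < c₀) (h0 : 0 ≤ c₁ * Real.log K / K)
    (h1 : c₁ * Real.log K / K ≤ 1 / 2) (k : ℕ) : 0 < noiseTime K c₀ c₁ 0 (k + 1) := by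
  obtain ⟨ha, ha1⟩ := alphaBar_succ_mem_Ioo hK hc₀ h0 h1 k
  rw [noiseTime, add_zero]
  exact div_pos (by linarith) ha

theorem noiseTime_eq_add (K : ℕ) (c₀ c₁ τ : ℝ) (k : ℕ) :
    noiseTime K c₀ c₁ τ k = noiseTime K c₀ c₁ 0 k + τ := by
  simp [noiseTime]

/-- The noise level grows geometrically along the schedule. -/
theorem le_noiseTime_zero (hK : 2 ≤ K) (hc₀ : 0 < c₀) (h0 : 0 ≤ c₁ * Real.log K / K)
    (h1 : c₁ * Real.log K / K ≤ 1 / 2) :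
    ∀ k, 1 / (K : ℝ) ^ c₀ * (1 + c₁ * Real.log K / K) ^ k ≤ noiseTime K c₀ c₁ 0 (k + 1)
  | 0 => by
    obtain ⟨ha, ha1⟩ := alphaBar_succ_mem_Ioo hK hc₀ h0 h1 0
    simp only [noiseTime, alphaBar, add_zero, pow_zero, mul_one] at ha ha1 ⊢
    have h3 : 0 < 1 / (K : ℝ) ^ c₀ := by positivity
    rw [le_div_iff₀ ha]
    nlinarith
  | k + 1 => by
    have h2 := le_noiseTime_zero hK hc₀ h0 h1 k
    have h3 := (noiseTime_succ_sub hK hc₀ h0 h1 k (τ := 0)).1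
    rw [pow_succ, ← mul_assoc]
    have h4 : 0 ≤ 1 + c₁ * Real.log K / K := by linarith
    have h5 := mul_le_mul_of_nonneg_right h2 h4
    linarith

theorem noiseTime_zero_one_le (hK : 2 ≤ K) (hc₀ : 1 ≤ c₀) :
    noiseTime K c₀ c₁ 0 1 ≤ 2 * (1 / (K : ℝ) ^ c₀) := by
  have hK1 : (2 : ℝ) ≤ K := by exact_mod_cast hK
  have h1 : (2 : ℝ) ≤ (K : ℝ) ^ c₀ := hK1.trans (by
    conv_lhs => rw [← Real.rpow_one (K : ℝ)]
    exact Real.rpow_le_rpow_of_exponent_le (by linarith) hc₀)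
  have h2 : 1 / (K : ℝ) ^ c₀ ≤ 1 / 2 := one_div_le_one_div_of_le (by norm_num) h1
  have h3 : 0 < 1 / (K : ℝ) ^ c₀ := by positivity
  simp only [noiseTime, alphaBar, add_zero]
  rw [div_le_iff₀ (by linarith)]
  nlinarith

theorem sq_le_noiseTime_zero (hK : 4 ≤ K) (hc₀ : 0 < c₀) (hc : 5 * c₀ ≤ c₁) (hc12 : 12 ≤ c₁)
    (h1 : c₁ * Real.log K / K ≤ 1 / 2) : (K : ℝ) ^ 2 ≤ noiseTime K c₀ c₁ 0 K := by
  obtain ⟨k, rfl⟩ : ∃ k, K = k + 1 := ⟨K - 1, by omega⟩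
  have hK4 : (4 : ℝ) ≤ (k + 1 : ℕ) := by exact_mod_cast hK
  have hKk : (k : ℝ) = ((k + 1 : ℕ) : ℝ) - 1 := by push_cast; ring
  set N : ℝ := ((k + 1 : ℕ) : ℝ) with hN
  have hN0 : 0 < N := by linarith
  have hl : 0 < Real.log N := Real.log_pos (by linarith)
  have h0 : 0 ≤ c₁ * Real.log N / N := by positivity
  refine le_trans ?_ (le_noiseTime_zero (by omega) hc₀ h0 h1 k)
  set ε := c₁ * Real.log N / N with hε
  have h2 : 2 / 3 * ε ≤ Real.log (1 + ε) := by
    refine le_trans ?_ (Real.one_sub_inv_le_log_of_pos (by linarith))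
    have e : 1 - (1 + ε)⁻¹ = ε / (1 + ε) := by
      have : 1 + ε ≠ 0 := by linarith
      field_simp
      ring
    rw [e, le_div_iff₀ (by linarith)]
    nlinarith
  have h3 : (1 + ε) ^ k = Real.exp (k * Real.log (1 + ε)) := by
    rw [← Real.log_pow, Real.exp_log (by positivity)]
  have h4 : (2 + c₀) * Real.log N ≤ k * Real.log (1 + ε) := by
    -- The `1/2` is `2/3` from `log (1+ε) ≥ 2ε/3` times `3/4` from `K - 1 ≥ 3K/4`. The conditions `5
    -- c₀ ≤ c₁` and `12 ≤ c₁` then give `c₁/2 ≥ 2 + c₀`: `c₀` compensates the initial level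
    -- `K^{-c₀}` and `2` reaches `K²`.
    have h5 : c₁ / 2 * Real.log N ≤ k * (2 / 3 * ε) := by
      have : (k : ℝ) * (2 / 3 * ε) = c₁ * Real.log N * (2 / 3 * ((N - 1) / N)) := by
        rw [hKk, hε]
        ring
      rw [this]
      have h6 : 3 / 4 ≤ (N - 1) / N := by rw [le_div_iff₀ hN0]; linarith
      have h7 : 0 ≤ c₁ * Real.log N := by positivity
      nlinarith
    have h6 : (k : ℝ) * (2 / 3 * ε) ≤ k * Real.log (1 + ε) := by gcongr
    nlinarith
  have h5 : N ^ 2 * N ^ c₀ ≤ (1 + ε) ^ k := by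
    rw [h3, ← Real.rpow_natCast N 2, ← Real.rpow_add hN0, Real.rpow_def_of_pos hN0]
    refine Real.exp_le_exp.2 ?_
    push_cast
    linarith
  rw [one_div_mul_eq_div, le_div_iff₀ (by positivity)]
  exact h5

end Schedule

/-! ### Error decomposition for fixed data -/

section Sampling

variable {d n K : ℕ} {c₀ c₁ τ : ℝ}

theorem measurable_thresholdedDensity_uncurry (t : ℝ) :
    Measurable fun z : (Fin n → Rd d) × Rd d => thresholdedDensity z.1 t z.2 := by
  unfold thresholdedDensity
  have h1 := measurable_pHat_uncurry (n := n) (d := d) t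
  exact Measurable.ite (measurableSet_lt h1 measurable_const)
    (h1.add ((measurable_kdeSq_uncurry t).div_const t)) measurable_const

theorem measurable_lintegral_thresholdedDensity (t : ℝ) :
    Measurable fun X : Fin n → Rd d => ∫⁻ x, ENNReal.ofReal (thresholdedDensity X t x) := by
  have h : Measurable fun z : (Fin n → Rd d) × Rd d =>
      ENNReal.ofReal (thresholdedDensity z.1 t z.2) :=
    (measurable_thresholdedDensity_uncurry t).ennreal_ofReal
  exact h.lintegral_prod_right'

/-- The error of the sampler for fixed data: initialization, discretization, and the kernel
density estimator at the final noise level. -/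
theorem exists_tvDist_outputLaw_le (d : ℕ) :
    ∃ C : ℝ, 0 < C ∧ ∀ {n K : ℕ} {c₀ c₁ τ H : ℝ}, 2 ≤ n → 2 ≤ K → 0 < τ → τ ≤ 1 → 0 ≤ H →
      (∀ k, 0 < alphaBar K c₀ c₁ (k + 1)) →
      (∀ k, 0 < noiseTime K c₀ c₁ τ (k + 1)) →
      (∀ k, 0 < noiseTime K c₀ c₁ τ (k + 2) - noiseTime K c₀ c₁ τ (k + 1)) →
      (∀ k, noiseTime K c₀ c₁ τ (k + 2) - noiseTime K c₀ c₁ τ (k + 1) ≤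
        H * noiseTime K c₀ c₁ τ (k + 2)) →
      (K : ℝ) ^ 2 ≤ noiseTime K c₀ c₁ 0 K →
      ∀ (p : Rd d → ℝ), IsDensity p → ∀ X : Fin n → Rd d,
      ENNReal.ofReal (tvDist (outputLaw X K c₀ c₁ τ) (lawOfDensity p)) ≤
        ENNReal.ofReal (C / K) * (ENNReal.ofReal (1 / n) * ∑ i, ENNReal.ofReal (1 + ‖X i‖ ^ 2)) +
        ∑ j ∈ Finset.range (K - 1), (ENNReal.ofReal (C * H ^ 2 * Real.log n ^ 2) +
          ENNReal.ofReal (C * H) * ∫⁻ x, ENNReal.ofReal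
            (thresholdedDensity X (noiseTime K c₀ c₁ τ (j + 2)) x)) +
        ∫⁻ x, ENNReal.ofReal (pHat X (noiseTime K c₀ c₁ τ 1) x - p x) := by
  obtain ⟨C, hC, hE⟩ := exists_eulerMap_le d
  refine ⟨max C (16 * 2 ^ ((d : ℝ) / 2)), by positivity,
    fun {n K c₀ c₁ τ H} hn hK hτ hτ1 hH hα ht hh hhH hKT p hp X => ?_⟩
  set D := max C (16 * 2 ^ ((d : ℝ) / 2)) with hD
  have hCD : C ≤ D := le_max_left _ _
  obtain ⟨k, rfl⟩ : ∃ k, K = k + 1 := ⟨K - 1, by omega⟩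
  have hK0 : (0 : ℝ) < (k + 1 : ℕ) := by positivity
  have hK2 : (2 : ℝ) ≤ (k + 1 : ℕ) := by exact_mod_cast hK
  have hl := log_natCast_pos hn
  have hm := measurable_rescaledRun hn X ht (k + 1)
  have := isProbabilityMeasure_outputLaw (K := k + 1) (c₀ := c₀) (c₁ := c₁) (τ := τ) X
  have := hp.2.2
  refine ofReal_tvDist_le fun A hA => ?_
  rw [outputLaw_eq X (by omega) hα hm, Nat.add_sub_cancel]
  set T := 1 / alphaBar (k + 1) c₀ c₁ (k + 1) with hT
  have hTw : T = 1 + noiseTime (k + 1) c₀ c₁ 0 (k + 1) := by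
    have := (hα k).ne'
    rw [hT, noiseTime]
    field_simp
    ring
  -- The variance of the start and the largest noise level differ by `1 - τ`, which lies in `[0,
  -- 1)`, as the initialization bound requires.
  have htT : noiseTime (k + 1) c₀ c₁ τ (k + 1) = T - 1 + τ := by
    rw [noiseTime_eq_add, hTw]
    ring
  have hsT : ((k + 1 : ℕ) : ℝ) ≤ √T := Real.le_sqrt_of_sq_le (by linarith)
  have hT2 : 2 ≤ T := by nlinarith
  have hinit := lawOfDensity_gaussianKernel_le (n := n) (by omega) hT2 (by linarith : T - 1 ≤
    noiseTime (k + 1) c₀ c₁ τ (k + 1)) (by linarith) X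
  have hstep : ∀ j, ∀ A, MeasurableSet A →
      (lawOfDensity (pHat X (noiseTime (k + 1) c₀ c₁ τ (j + 2)))).map
        (eulerMap X (noiseTime (k + 1) c₀ c₁ τ (j + 2))
          (noiseTime (k + 1) c₀ c₁ τ (j + 2) - noiseTime (k + 1) c₀ c₁ τ (j + 1))) A ≤
        lawOfDensity (pHat X (noiseTime (k + 1) c₀ c₁ τ (j + 1))) A +
        (ENNReal.ofReal (D * H ^ 2 * Real.log n ^ 2) +
          ENNReal.ofReal (D * H) * ∫⁻ x, ENNReal.ofReal
            (thresholdedDensity X (noiseTime (k + 1) c₀ c₁ τ (j + 2)) x)) := by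
    intro j A hA
    have h1 := hE hn (hh j) (sub_lt_self _ (ht j)) X A hA
    rw [sub_sub_cancel] at h1
    refine h1.trans ?_
    have h2 : (noiseTime (k + 1) c₀ c₁ τ (j + 2) - noiseTime (k + 1) c₀ c₁ τ (j + 1)) /
        noiseTime (k + 1) c₀ c₁ τ (j + 2) ≤ H := by
      rw [div_le_iff₀ (ht (j + 1))]
      exact hhH j
    have h3 : 0 ≤ (noiseTime (k + 1) c₀ c₁ τ (j + 2) - noiseTime (k + 1) c₀ c₁ τ (j + 1)) /
        noiseTime (k + 1) c₀ c₁ τ (j + 2) := div_nonneg (hh j).le (ht (j + 1)).le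
    gcongr
  refine (map_rescaledRun_le hn X ht hstep k _ _ hinit A hA).trans ?_
  have hfin : lawOfDensity (pHat X (noiseTime (k + 1) c₀ c₁ τ 1)) A ≤ lawOfDensity p A +
      ∫⁻ x, ENNReal.ofReal (pHat X (noiseTime (k + 1) c₀ c₁ τ 1) x - p x) := by
    rw [lawOfDensity, lawOfDensity, withDensity_apply _ hA, withDensity_apply _ hA]
    refine le_trans ?_ (add_le_add_right (setLIntegral_le_lintegral A _) _)
    rw [← lintegral_add_left hp.1.ennreal_ofReal]
    refine lintegral_mono fun x => ?_
    refine le_trans (ENNReal.ofReal_le_ofReal ?_) ENNReal.ofReal_add_le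
    linarith
  have hc : 16 * 2 ^ ((d : ℝ) / 2) / √T ≤ D / ((k + 1 : ℕ) : ℝ) := by
    gcongr
    exact le_max_right _ _
  calc _ ≤ lawOfDensity p A +
      (∫⁻ x, ENNReal.ofReal (pHat X (noiseTime (k + 1) c₀ c₁ τ 1) x - p x)) + _ :=
        add_le_add hfin le_rfl
    _ ≤ lawOfDensity p A +
      (∫⁻ x, ENNReal.ofReal (pHat X (noiseTime (k + 1) c₀ c₁ τ 1) x - p x)) +
      (ENNReal.ofReal (D / ((k + 1 : ℕ) : ℝ)) *
        (ENNReal.ofReal (1 / n) * ∑ i, ENNReal.ofReal (1 + ‖X i‖ ^ 2)) + _) := by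
        gcongr
    _ = _ := by
      rw [add_assoc]
      congr 1
      rw [add_comm]

end Sampling


/-! ### Expected error and assembly of the rate -/

section Risk

variable {d : ℕ} {β L σ c₀ c₁ : ℝ}

/-- From `log N ≤ 2 √N` and `4c ≤ √N`. This fixes how large `K` must be for the schedule analysis.
-/
theorem log_mul_div_le_half {c N : ℝ} (hc : 0 < c) (hN : 16 * c ^ 2 ≤ N) :
    c * Real.log N / N ≤ 1 / 2 := by
  have hN0 : 0 < N := lt_of_lt_of_le (by positivity) hN
  have h1 : 4 * c ≤ √N := Real.le_sqrt_of_sq_le (by linarith)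
  have h2 : Real.log N ≤ 2 * √N := by
    have h3 : N = √N * √N := (Real.mul_self_sqrt hN0.le).symm
    have h4 : 0 < √N := Real.sqrt_pos.2 hN0
    rw [show Real.log N = 2 * Real.log √N by rw [Real.log_sqrt hN0.le]; ring]
    linarith [Real.log_le_sub_one_of_pos h4]
  rw [div_le_iff₀ hN0]
  have h3 : √N * √N = N := Real.mul_self_sqrt hN0.le
  nlinarith

/-- Raising the exponent is legitimate for `2ℓ ≥ 1`; the factor `2^q` pays for `log n` possibly
being below one. -/
theorem rpow_le_two_rpow_mul_rpow {ℓ s q : ℝ} (hℓ : 1 / 2 ≤ ℓ) (hs : 0 ≤ s) (hsq : s ≤ q) :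
    ℓ ^ s ≤ 2 ^ q * ℓ ^ q := by
  rw [← Real.mul_rpow (by norm_num) (by linarith)]
  calc ℓ ^ s ≤ (2 * ℓ) ^ s := Real.rpow_le_rpow (by linarith) (by linarith) hs
    _ ≤ _ := Real.rpow_le_rpow_of_exponent_le (by linarith) hsq

/-- The noise schedule meets the requirements of the error analysis once `K` is large. -/
theorem noiseTime_schedule {K : ℕ} {τ : ℝ} (hK : 4 ≤ K) (hc₀ : 1 ≤ c₀) (hc : 5 * c₀ ≤ c₁)
    (hc12 : 12 ≤ c₁) (hτ : 0 < τ) (hε : c₁ * Real.log K / K ≤ 1 / 2) :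
    (∀ k, 0 < alphaBar K c₀ c₁ (k + 1)) ∧ (∀ k, τ ≤ noiseTime K c₀ c₁ τ (k + 1)) ∧
      (∀ k, 0 < noiseTime K c₀ c₁ τ (k + 2) - noiseTime K c₀ c₁ τ (k + 1)) ∧
      (∀ k, noiseTime K c₀ c₁ τ (k + 2) - noiseTime K c₀ c₁ τ (k + 1) ≤
        2 * (c₁ * Real.log K / K) * noiseTime K c₀ c₁ τ (k + 2)) ∧
      (K : ℝ) ^ 2 ≤ noiseTime K c₀ c₁ 0 K := by
  have hc00 : 0 < c₀ := by linarith
  have hK1 : (1 : ℝ) < K := by exact_mod_cast (by omega : 1 < K)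
  have hlK : 0 < Real.log K := Real.log_pos hK1
  have hε0 : 0 < c₁ * Real.log K / K := by positivity
  have hw := noiseTime_zero_pos (by omega) hc00 hε0.le hε
  have hstep := noiseTime_succ_sub (τ := τ) (by omega) hc00 hε0.le hε
  have hpos : ∀ k, 0 < noiseTime K c₀ c₁ τ (k + 2) - noiseTime K c₀ c₁ τ (k + 1) := fun k =>
    (mul_pos hε0 (hw k)).trans_le (hstep k).1
  refine ⟨fun k => (alphaBar_succ_mem_Ioo (by omega) hc00 hε0.le hε k).1, fun k => ?_, hpos,
    fun k => (hstep k).2.trans ?_, sq_le_noiseTime_zero hK hc00 hc hc12 hε⟩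
  · rw [noiseTime_eq_add]
    linarith [hw k]
  · gcongr
    have h1 := hpos k
    rw [noiseTime_eq_add K c₀ c₁ τ (k + 1)] at h1
    linarith

/-- This is where `c₀ ≥ 2/β` is needed: it makes the first noise increment `K^{-c₀}` no larger than
the bandwidth `τ`. -/
theorem noiseTime_one_le {n K : ℕ} (hβ : 0 < β) (hβ2 : β ≤ 2) (hc₀ : 2 / β ≤ c₀) (hn : 1 ≤ n)
    (hK : 2 ≤ K) (hnK : (n : ℝ) ^ (β / (d + 2 * β)) ≤ K) :
    noiseTime K c₀ c₁ ((n : ℝ) ^ (-(2 / (d + 2 * β)))) 1 ≤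
      3 * (n : ℝ) ^ (-(2 / (d + 2 * β))) := by
  have hn0 : (0 : ℝ) < n := by exact_mod_cast hn
  have hK1 : (1 : ℝ) ≤ K := by exact_mod_cast (by omega : 1 ≤ K)
  have hc1 : 1 ≤ c₀ := le_trans (by rw [le_div_iff₀ hβ]; linarith) hc₀
  have h1 := noiseTime_zero_one_le (c₁ := c₁) hK hc1
  have h2 : 1 / (K : ℝ) ^ c₀ ≤ (n : ℝ) ^ (-(2 / (d + 2 * β))) := by
    rw [Real.rpow_neg hn0.le, ← one_div]
    gcongr
    calc (n : ℝ) ^ (2 / (d + 2 * β)) = ((n : ℝ) ^ (β / (d + 2 * β))) ^ (2 / β) := by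
          rw [← Real.rpow_mul hn0.le]
          congr 1
          field_simp
      _ ≤ (K : ℝ) ^ (2 / β) := by gcongr
      _ ≤ (K : ℝ) ^ c₀ := Real.rpow_le_rpow_of_exponent_le hK1 hc₀
  rw [noiseTime_eq_add]
  linarith

/-- The sampling rate requirement turns the accumulated errors into the claimed rate. -/
theorem accumulated_error_le {ρ ℓ l N r q b C M D E : ℝ} (hρ : 0 < ρ) (hℓ : 1 / 2 ≤ ℓ)
    (hl : 1 ≤ l) (hN : 0 < N) (hr : 0 < r) (hq : 1 ≤ q) (hb0 : 0 ≤ b) (hb : b ≤ q) (hc₁ : 0 < c₁)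
    (hC : 0 < C) (hM : 0 < M) (hD : 0 < D) (hE : 0 < E) (hNρ : l ^ 3 ≤ N * ρ)
    (hrl : r * ℓ ≤ l) :
    C / N * M + N * (C * (2 * (c₁ * l / N)) ^ 2 * ℓ ^ 2 + C * (2 * (c₁ * l / N)) * (D * ρ)) +
        E * ρ * ℓ ^ b ≤
      2 ^ q * (C * M + 4 * c₁ ^ 2 * C / r + 2 * c₁ * C * D + E) * ρ * ℓ ^ q * l := by
  have hℓ0 : 0 < ℓ := by linarith
  set G := 2 ^ q * ℓ ^ q with hG
  have g0 : 1 ≤ G := by simpa using rpow_le_two_rpow_mul_rpow hℓ le_rfl (by linarith : 0 ≤ q)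
  have g1 : ℓ ≤ G := by simpa using rpow_le_two_rpow_mul_rpow hℓ zero_le_one hq
  have g2 : ℓ ^ b ≤ G := rpow_le_two_rpow_mul_rpow hℓ hb0 hb
  have hl0 : 0 < l := by linarith
  have hGl : G ≤ G * l := le_mul_of_one_le_right (by linarith) hl
  have k0 : 1 / N ≤ ρ := by
    rw [div_le_iff₀ hN, mul_comm]
    exact le_trans (one_le_pow₀ hl) hNρ
  have k1 : C / N * M ≤ C * M * ρ * (G * l) := by
    calc C / N * M = C * M * (1 / N) * 1 := by ring
      _ ≤ C * M * ρ * (G * l) := by gcongr; linarith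
  have k2 : N * (C * (2 * (c₁ * l / N)) ^ 2 * ℓ ^ 2) ≤ 4 * c₁ ^ 2 * C / r * ρ * (G * l) := by
    have e : N * (C * (2 * (c₁ * l / N)) ^ 2 * ℓ ^ 2) = 4 * c₁ ^ 2 * C * (l ^ 2 / N * ℓ * ℓ) := by
      field_simp
      ring
    have k3 : l ^ 2 / N ≤ ρ := by
      rw [div_le_iff₀ hN, mul_comm]
      exact le_trans (pow_le_pow_right₀ hl (by norm_num)) hNρ
    -- As `K ≥ n^r`, one of the two factors `log n` of the discretization error is traded for `log
    -- K`; the other fits into the exponent `q ≥ 1`.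
    have k4 : ℓ ≤ l / r := by rw [le_div_iff₀ hr]; linarith
    rw [e]
    calc 4 * c₁ ^ 2 * C * (l ^ 2 / N * ℓ * ℓ) ≤ 4 * c₁ ^ 2 * C * (ρ * G * (l / r)) := by gcongr
      _ = _ := by ring
  have k5 : N * (C * (2 * (c₁ * l / N)) * (D * ρ)) ≤ 2 * c₁ * C * D * ρ * (G * l) := by
    calc N * (C * (2 * (c₁ * l / N)) * (D * ρ)) = 2 * c₁ * C * D * ρ * (1 * l) := by field_simp
      _ ≤ _ := by gcongr
  have k6 : E * ρ * ℓ ^ b ≤ E * ρ * (G * l) := by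
    gcongr
    exact g2.trans hGl
  calc _ ≤ C * M * ρ * (G * l) + (4 * c₁ ^ 2 * C / r * ρ * (G * l) +
        2 * c₁ * C * D * ρ * (G * l)) + E * ρ * (G * l) := by
        rw [mul_add N]
        gcongr
    _ = _ := by rw [hG]; ring

theorem exists_lintegral_tvDist_outputLaw_le (hd : 1 ≤ d) (hβ : 0 < β) (hβ2 : β ≤ 2) (hL : 0 < L)
    (hσ : 0 < σ) (hc₀ : 2 / β ≤ c₀) (hc : 5 * c₀ ≤ c₁) (hc12 : 12 ≤ c₁) :
    ∃ C : ℝ, 0 < C ∧ ∀ p : Rd d → ℝ, IsDensity p → IsSubgaussian σ (lawOfDensity p) →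
      IsHolderSmooth β L p → ∀ n K : ℕ, 2 ≤ n → 16 * c₁ ^ 2 ≤ K →
      (n : ℝ) ^ (β / (d + 2 * β)) * Real.log K ^ 3 ≤ (K : ℝ) →
      ∫⁻ X : Fin n → Rd d, ENNReal.ofReal (tvDist
        (outputLaw X K c₀ c₁ ((n : ℝ) ^ (-(2 / (d + 2 * β))))) (lawOfDensity p))
        ∂(Measure.pi fun _ => lawOfDensity p) ≤
      ENNReal.ofReal (C * (n : ℝ) ^ (-(β / (d + 2 * β))) *
        Real.log n ^ (((d : ℝ) + 1) / 2) * Real.log K) := by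
  obtain ⟨C, hC, htv⟩ := exists_tvDist_outputLaw_le d
  obtain ⟨D, hD, hthr⟩ := exists_lintegral_thresholdedDensity_le hd hβ hσ
  -- The factor `3` is the one in `noiseTime_one_le`.
  obtain ⟨E, hE, hkde⟩ := exists_lintegral_pHat_sub_le hd hβ hβ2 hL hσ 3 (by norm_num)
  have hd1 : (1 : ℝ) ≤ d := by exact_mod_cast hd
  set M := 2 * (1 + d * σ ^ 2) with hM
  refine ⟨2 ^ (((d : ℝ) + 1) / 2) * (C * M + 4 * c₁ ^ 2 * C / (β / (d + 2 * β)) +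
    2 * c₁ * C * D + E), by positivity, fun p hp hsg hsm n K hn hK16 hnK => ?_⟩
  have hPp := hp.2.2
  have hc1 : 1 ≤ c₀ := le_trans (by rw [le_div_iff₀ hβ]; linarith) hc₀
  have hKr : (100 : ℝ) ≤ K := by nlinarith
  have hK : 100 ≤ K := by exact_mod_cast hKr
  have hn0 : (0 : ℝ) < n := by positivity
  have hlK : 1 ≤ Real.log K := by
    rw [Real.le_log_iff_exp_le (by linarith)]
    linarith [Real.exp_one_lt_d9]
  have hln := half_le_log_natCast hn
  have hnK' : (n : ℝ) ^ (β / (d + 2 * β)) ≤ K :=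
    le_trans (le_mul_of_one_le_right (by positivity) (one_le_pow₀ hlK)) hnK
  have hrl : β / (d + 2 * β) * Real.log n ≤ Real.log K := by
    rw [← Real.log_rpow hn0]
    exact Real.log_le_log (by positivity) hnK'
  set τ := (n : ℝ) ^ (-(2 / (d + 2 * β))) with hτ
  have hτ0 : 0 < τ := by positivity
  have hτ1 : τ ≤ 1 := natCast_rpow_neg_le_one (by omega) (by positivity)
  set ρ := (n : ℝ) ^ (-(β / (d + 2 * β))) with hρ
  have hρ0 : 0 < ρ := by positivity
  have hNρ : Real.log K ^ 3 ≤ K * ρ := by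
    calc Real.log K ^ 3 = (n : ℝ) ^ (β / (d + 2 * β)) * Real.log K ^ 3 * ρ := by
          rw [mul_right_comm, hρ, ← Real.rpow_add hn0, add_neg_cancel, Real.rpow_zero, one_mul]
      _ ≤ K * ρ := by gcongr
  have hε := log_mul_div_le_half (by linarith : 0 < c₁) hK16
  obtain ⟨hα, ht, hh, hhH, hKT⟩ := noiseTime_schedule (τ := τ) (by omega) hc1 hc hc12 hτ0 hε
  have ht1 := noiseTime_one_le (d := d) (c₁ := c₁) hβ hβ2 hc₀ (by omega : 1 ≤ n) (by omega) hnK'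
  set H := 2 * (c₁ * Real.log K / K) with hH
  have hH0 : 0 ≤ H := by positivity
  set e : ℕ → (Fin n → Rd d) → ENNReal := fun j X => ∫⁻ x, ENNReal.ofReal
    (thresholdedDensity X (noiseTime K c₀ c₁ τ (j + 2)) x) with he
  have hem : ∀ j, Measurable (e j) := fun j => measurable_lintegral_thresholdedDensity _
  have hsm1 : Measurable fun X : Fin n → Rd d =>
      ENNReal.ofReal (1 / n) * ∑ i, ENNReal.ofReal (1 + ‖X i‖ ^ 2) := by fun_prop
  have hsm2 : Measurable fun X : Fin n → Rd d => ENNReal.ofReal (C / K) *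
      (ENNReal.ofReal (1 / n) * ∑ i, ENNReal.ofReal (1 + ‖X i‖ ^ 2)) := hsm1.const_mul _
  have hem2 : ∀ j, Measurable fun X => ENNReal.ofReal (C * H ^ 2 * Real.log n ^ 2) +
      ENNReal.ofReal (C * H) * e j X := fun j => ((hem j).const_mul _).const_add _
  have hem3 : Measurable fun X => ∑ j ∈ Finset.range (K - 1),
      (ENNReal.ofReal (C * H ^ 2 * Real.log n ^ 2) + ENNReal.ofReal (C * H) * e j X) :=
    Finset.measurable_fun_sum _ fun j _ => hem2 j
  calc _ ≤ ∫⁻ X : Fin n → Rd d, (ENNReal.ofReal (C / K) *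
        (ENNReal.ofReal (1 / n) * ∑ i, ENNReal.ofReal (1 + ‖X i‖ ^ 2)) +
        ∑ j ∈ Finset.range (K - 1), (ENNReal.ofReal (C * H ^ 2 * Real.log n ^ 2) +
          ENNReal.ofReal (C * H) * e j X) +
        ∫⁻ x, ENNReal.ofReal (pHat X (noiseTime K c₀ c₁ τ 1) x - p x))
        ∂(Measure.pi fun _ => lawOfDensity p) := by
        refine lintegral_mono fun X => ?_
        exact htv hn (by omega) hτ0 hτ1 hH0 hα (fun k => hτ0.trans_le (ht k)) hh hhH hKT p hp X
    _ = ENNReal.ofReal (C / K) * (∫⁻ x, ENNReal.ofReal (1 + ‖x‖ ^ 2) ∂(lawOfDensity p)) +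
        ∑ j ∈ Finset.range (K - 1), (ENNReal.ofReal (C * H ^ 2 * Real.log n ^ 2) +
          ENNReal.ofReal (C * H) * ∫⁻ X, e j X ∂(Measure.pi fun _ => lawOfDensity p)) +
        ∫⁻ X : Fin n → Rd d, (∫⁻ x, ENNReal.ofReal (pHat X (noiseTime K c₀ c₁ τ 1) x - p x))
          ∂(Measure.pi fun _ => lawOfDensity p) := by
        have hsum : Measurable fun X : Fin n → Rd d => ENNReal.ofReal (C / K) *
            (ENNReal.ofReal (1 / n) * ∑ i, ENNReal.ofReal (1 + ‖X i‖ ^ 2)) +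
            ∑ j ∈ Finset.range (K - 1), (ENNReal.ofReal (C * H ^ 2 * Real.log n ^ 2) +
              ENNReal.ofReal (C * H) * e j X) := hsm2.add hem3
        rw [lintegral_add_left hsum, lintegral_add_left hsm2,
          lintegral_const_mul _ hsm1,
          lintegral_pi_average (f := fun x => ENNReal.ofReal (1 + ‖x‖ ^ 2)) (by omega) (by fun_prop),
          lintegral_finsetSum _ fun j _ => hem2 j]
        congr 2
        refine Finset.sum_congr rfl fun j _ => ?_
        rw [lintegral_add_left measurable_const, lintegral_const_mul _ (hem j)]
        simp
    _ ≤ ENNReal.ofReal (C / K) * ENNReal.ofReal M +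
        ∑ j ∈ Finset.range (K - 1), (ENNReal.ofReal (C * H ^ 2 * Real.log n ^ 2) +
          ENNReal.ofReal (C * H) * ENNReal.ofReal (D * ρ)) +
        ENNReal.ofReal (E * ρ * Real.log n ^ ((d : ℝ) / 2)) := by
        gcongr with j hj
        · exact lintegral_one_add_sq_norm_le hd hσ hsg
        · exact hthr _ hPp hsg n hn _ (ht (j + 1))
        · exact hkde p hp hsg hsm n hn _ (ht 0) ht1
    _ ≤ ENNReal.ofReal (C / K) * ENNReal.ofReal M +
        K * (ENNReal.ofReal (C * H ^ 2 * Real.log n ^ 2) +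
          ENNReal.ofReal (C * H) * ENNReal.ofReal (D * ρ)) +
        ENNReal.ofReal (E * ρ * Real.log n ^ ((d : ℝ) / 2)) := by
        rw [Finset.sum_const, Finset.card_range, nsmul_eq_mul]
        gcongr
        omega
    _ = ENNReal.ofReal (C / K * M + K * (C * H ^ 2 * Real.log n ^ 2 + C * H * (D * ρ)) +
        E * ρ * Real.log n ^ ((d : ℝ) / 2)) := by
        rw [ENNReal.ofReal_add (by positivity) (by positivity),
          ENNReal.ofReal_add (by positivity) (by positivity),
          ENNReal.ofReal_mul (p := C / K) (by positivity), ENNReal.ofReal_mul (p := (K : ℝ)) (by positivity), ENNReal.ofReal_natCast,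
          ENNReal.ofReal_add (p := C * H ^ 2 * Real.log n ^ 2) (by positivity) (by positivity),
          ENNReal.ofReal_mul (p := C * H) (by positivity)]
    _ ≤ _ := by
        refine ENNReal.ofReal_le_ofReal ?_
        exact accumulated_error_le hρ0 (by linarith) hlK (by linarith) (by positivity)
          (by linarith) (by positivity) (by linarith) (by linarith) hC (by positivity) hD hE hNρ hrl

/-- For bounded `K` the sampling condition bounds `n` as well, since `(log K)³ ≥ 1/8`; the claimed
rate is then at least one. -/
theorem one_le_rate_of_le {n K : ℕ} {c : ℝ} (hn : 2 ≤ n) (hK : 2 ≤ K) (hKc : (K : ℝ) ≤ c)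
    (hnK : (n : ℝ) ^ (β / (d + 2 * β)) * Real.log K ^ 3 ≤ (K : ℝ)) :
    1 ≤ 2 ^ (((d : ℝ) + 1) / 2) * (16 * c) * (n : ℝ) ^ (-(β / (d + 2 * β))) *
      Real.log n ^ (((d : ℝ) + 1) / 2) * Real.log K := by
  have hn0 : (0 : ℝ) < n := by positivity
  have hlK := half_le_log_natCast hK
  have hln := half_le_log_natCast hn
  have hc : 0 < c := lt_of_lt_of_le (by positivity) hKc
  have h1 : 1 ≤ (2 : ℝ) ^ (((d : ℝ) + 1) / 2) * Real.log n ^ (((d : ℝ) + 1) / 2) := by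
    simpa using rpow_le_two_rpow_mul_rpow (by linarith : 1 / 2 ≤ Real.log n) le_rfl
      (by positivity : 0 ≤ ((d : ℝ) + 1) / 2)
  have h2 : 1 ≤ 8 * c * (n : ℝ) ^ (-(β / (d + 2 * β))) := by
    rw [Real.rpow_neg hn0.le, ← div_eq_mul_inv, le_div_iff₀ (by positivity), one_mul]
    have h3 : (1 / 2 : ℝ) ^ 3 ≤ Real.log K ^ 3 := by gcongr; linarith
    have h4 : 0 < (n : ℝ) ^ (β / (d + 2 * β)) := by positivity
    nlinarith
  calc (1 : ℝ) = 1 * 1 * (2 * (1 / 2)) := by norm_num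
    _ ≤ (2 ^ (((d : ℝ) + 1) / 2) * Real.log n ^ (((d : ℝ) + 1) / 2)) *
        (8 * c * (n : ℝ) ^ (-(β / (d + 2 * β)))) * (2 * Real.log K) := by gcongr; linarith
    _ = _ := by ring

end Risk

end ProbabilityFlow

/-! ### The main theorem -/

open ProbabilityFlow MeasureTheory in
theorem theorem1 (d : ℕ) (hd : 1 ≤ d) (β L σ c₀ : ℝ) (hβ : 0 < β) (hβ2 : β ≤ 2)
    (hL : 0 < L) (hσ : 0 < σ) (hc₀ : 2 / β ≤ c₀) :
    ∃ C : ℝ, 0 < C ∧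
      ∀ p : Rd d → ℝ, IsDensity p → IsSubgaussian σ (lawOfDensity p) → IsHolderSmooth β L p →
      ∀ n K : ℕ, 2 ≤ n → 2 ≤ K →
        (n : ℝ) ^ (β / (d + 2 * β)) * Real.log K ^ 3 ≤ (K : ℝ) →
        Integrable
          (fun X : Fin n → Rd d => tvDist
            (outputLaw X K c₀ (max (5 * c₀) 12) ((n : ℝ) ^ (-(2 / (d + 2 * β))))) (lawOfDensity p))
          (Measure.pi fun _ => lawOfDensity p) ∧
        ∫ X : Fin n → Rd d, tvDist
            (outputLaw X K c₀ (max (5 * c₀) 12) ((n : ℝ) ^ (-(2 / (d + 2 * β))))) (lawOfDensity p)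
          ∂(Measure.pi fun _ => lawOfDensity p)
          ≤ C * (n : ℝ) ^ (-(β / (d + 2 * β))) * Real.log n ^ (((d : ℝ) + 1) / 2) * Real.log K := by
  obtain ⟨C, hC, hrisk⟩ := exists_lintegral_tvDist_outputLaw_le hd hβ hβ2 hL hσ hc₀
    (le_max_left (5 * c₀) 12) (le_max_right (5 * c₀) 12)
  set c₁ := max (5 * c₀) 12 with hc₁
  have hc12 : 12 ≤ c₁ := le_max_right _ _
  set C' := max C (2 ^ (((d : ℝ) + 1) / 2) * (16 * (16 * c₁ ^ 2))) with hC'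
  refine ⟨C', lt_max_of_lt_left hC, fun p hp hsg hsm n K hn hK hnK => ?_⟩
  have := hp.2.2
  have hlK : 0 < Real.log K := log_natCast_pos hK
  have hln : 0 < Real.log n := log_natCast_pos hn
  have hmeas := stronglyMeasurable_tvDist_outputLaw (n := n) (K := K) (c₀ := c₀) (c₁ := c₁)
    (τ := (n : ℝ) ^ (-(2 / (d + 2 * β)))) (lawOfDensity p)
  have hle1 : ∀ X : Fin n → Rd d, tvDist
      (outputLaw X K c₀ c₁ ((n : ℝ) ^ (-(2 / (d + 2 * β))))) (lawOfDensity p) ≤ 1 := fun X => by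
    have := isProbabilityMeasure_outputLaw (K := K) (c₀ := c₀) (c₁ := c₁)
      (τ := (n : ℝ) ^ (-(2 / (d + 2 * β)))) X
    exact tvDist_le_one _ _
  have hint : Integrable (fun X : Fin n → Rd d => tvDist
      (outputLaw X K c₀ c₁ ((n : ℝ) ^ (-(2 / (d + 2 * β))))) (lawOfDensity p))
      (Measure.pi fun _ => lawOfDensity p) := by
    refine Integrable.of_bound hmeas.aestronglyMeasurable 1 (Filter.Eventually.of_forall fun X => ?_)
    rw [Real.norm_of_nonneg (tvDist_nonneg _ _)]
    exact hle1 X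
  refine ⟨hint, ?_⟩
  rcases le_total (16 * c₁ ^ 2) (K : ℝ) with hK16 | hK16
  · have h1 := hrisk p hp hsg hsm n K hn hK16 hnK
    rw [← ofReal_integral_eq_lintegral_ofReal hint
      (Filter.Eventually.of_forall fun X => tvDist_nonneg _ _),
      ENNReal.ofReal_le_ofReal_iff (by positivity)] at h1
    refine h1.trans ?_
    gcongr
    exact le_max_left _ _
  · calc _ ≤ ∫ X : Fin n → Rd d, (1 : ℝ) ∂(Measure.pi fun _ => lawOfDensity p) :=
          integral_mono hint (integrable_const _) hle1
      _ = 1 := by simp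
      _ ≤ _ := one_le_rate_of_le (d := d) (β := β) hn hK hK16 hnK
      _ ≤ _ := by
        gcongr
        exact le_max_right _ _
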